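/- Let $\kappa=\pm1$ and let $M_\kappa$ be the three-dimensional space form of curvature $\kappa$: the sphere $S^3\subset\mathbb R^4$ for $\kappa=1$, and hyperbolic space $H^3$ for $\kappa=-1$ (the upper sheet of the hyperboloid $-x_0^2+x_1^2+x_2^2+x_3^2=-1$), with its canonical metric, orientation and cross product. Let $\mathcal G_\kappa$ be the four-dimensional manifold of oriented unparametrized complete geodesics $[\gamma]$ of $M_\kappa$ ($\gamma$ of unit speed), whose tangent space at $[\gamma]$ is identified with the space of Jacobi fields along $\gamma$ orthogonal to $\gamma'$. Endow $\mathcal G_\kappa$ with the Kähler structure $$\mathcal J(J)=\gamma'\times J,\qquad g_K(I,J)=\langle I,J\rangle+\kappa\langle I',J'\rangle,$$ where $g_K$ is induced by the Killing form of $\mathrm{Iso}(M_\kappa)$, and with its fundamental form $\omega_K(I,J)=g_K(\mathcal J I,J)$. Let $S\subset M_\kappa$ be a compact connected smooth embedded surface that is quadratically convex: for every $p\in S$ the complete totally geodesic surface tangent to $S$ at $p$ meets $S$ only at $p$, and the shape operator of $S$ is definite at every point. Let $\mathcal U\subset\mathcal G_\kappa$ be the set of oriented geodesics that do not meet $S$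 and, if $\kappa=1$, do not belong to the Gauss image of $S$, that is, are not of the form $[s\mapsto \cos s\,u+\sin s\,v]$ with $p\in S$ and $(u,v)$ an orthonormal basis of $T_pS\subset\mathbb R^4$ such that $(n,u,v)$ is positively oriented, $n$ being the unit normal of $S$ at $p$ pointing inwards. Let $\overline{\mathcal U}$ be the set of the oriented geodesics of $\mathcal U$ with reversed orientation (so $\overline{\mathcal U}=\mathcal U$ if $\kappa=-1$). The outer billiard map $B$ associated with $S$ is defined as follows. Let $\ell=[\gamma]\in\mathcal U$. There are exactly two complete totally geodesic surfaces $P_\pm$ tangent to $S$ and containing $\ell$; let $p_\pm\in S$ be the tangent points, $q_\pm$ a point of $\ell$ closest to $p_\pm$, at distance $d_\pm$, and $\gamma_\pm$ the shortest geodesic with $\gamma_\pm(0)=q_\pm$ and $\gamma_\pm(d_\pm)=p_\pm$. Let $W_\pm$ be the parallel vector field along $\gamma$ that equals $\gamma_\pm'(0)$ at $q_\pm$; the labels are chosen so that $\{W_+,W_-,\gamma'\}$ is a positively oriented frame along $\gamma$. Then $B(\ell)$ is the oriented geodesic obtained by parallel transport of $\ell$ along $\gamma_+$ between $0$ and $2d_+$.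 Then $B$ is well defined on $\mathcal U$ and is a symplectomorphism of $\mathcal U$ onto $\overline{\mathcal U}$ with respect to $\omega_K$: it is a bijection from $\mathcal U$ onto $\overline{\mathcal U}$, these sets are open in $\mathcal G_\kappa$, $B$ and $B^{-1}$ are smooth, and $B^*\omega_K=\omega_K$. In particular, for $\kappa=-1$ it is a symplectomorphism of $\mathcal U$ onto itself. -/

import Mathlib

open Set Filter Topology
open scoped ContDiff

noncomputable section

namespace OuterBilliard

/-! ### The space forms of curvature `κ = 1` (three-sphere) and `κ = -1` (hyperbolic space)

The curvature is a unit `κ : ℤˣ` of the integers, that is `κ = 1` or `κ = -1`. -/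

/-- The ambient vector space. -/
abbrev R4 : Type := Fin 4 → ℝ

/-- The curvature as a real number. -/
def curv (κ : ℤˣ) : ℝ := ((κ : ℤ) : ℝ)

/-- The ambient bilinear form `κ x₀ y₀ + x₁ y₁ + x₂ y₂ + x₃ y₃`. Its restriction to the tangent
spaces of `space κ` is the Riemannian metric. -/
def form (κ : ℤˣ) (x y : R4) : ℝ :=
  curv κ * (x 0 * y 0) + x 1 * y 1 + x 2 * y 2 + x 3 * y 3

/-- The space form: the unit sphere of `ℝ⁴` for `κ = 1`, the upper sheet of the hyperboloid
`-x₀² + x₁² + x₂² + x₃² = -1` for `κ = -1`. The tangent space at `x` is `{w | form κ x w = 0}`. -/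
def space (κ : ℤˣ) : Set R4 :=
  {x | form κ x x = curv κ ∧ (κ = -1 → 0 < x 0)}

/-- The oriented volume of three tangent vectors `a, b, c` at the point `x` of `space κ`. -/
def vol (x a b c : R4) : ℝ := Matrix.det (Matrix.of ![x, a, b, c])

/-- The cross product of two tangent vectors at the point `x` of `space κ`; it is
characterized by `form κ (cross κ x a b) c = vol x a b c`. -/
def cross (κ : ℤˣ) (x a b : R4) : R4 :=
  fun i => (if i = 0 then curv κ else 1) * vol x a b (Pi.single i 1)

/-- The orthogonal projection of an ambient vector to the tangent space at `x`. -/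
def tangentProj (κ : ℤˣ) (x w : R4) : R4 := w - (curv κ * form κ w x) • x

/-- The covariant derivative `DX/dt` of a vector field `X` along a curve `c` in `space κ`: the
tangential component of the derivative in the ambient space. -/
def covD (κ : ℤˣ) (c X : ℝ → R4) (t : ℝ) : R4 := tangentProj κ (c t) (deriv X t)

/-- Smooth parallel tangent vector fields along a curve. -/
def IsParallel (κ : ℤˣ) (c X : ℝ → R4) : Prop :=
  ContDiff ℝ ∞ X ∧ (∀ t, form κ (c t) (X t) = 0) ∧ ∀ t, covD κ c X t = 0

/-! ### Oriented geodesics -/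

/-- Complete unit speed geodesics of `space κ`. -/
@[ext] structure UnitGeodesic (κ : ℤˣ) where
  toFun : ℝ → R4
  smooth : ContDiff ℝ ∞ toFun
  mem : ∀ t, toFun t ∈ space κ
  unit_speed : ∀ t, form κ (deriv toFun t) (deriv toFun t) = 1
  geodesic : ∀ t, covD κ toFun (deriv toFun) t = 0

instance (κ : ℤˣ) : CoeFun (UnitGeodesic κ) (fun _ => ℝ → R4) := ⟨UnitGeodesic.toFun⟩

/-- Two unit speed geodesics are equivalent if they differ by a translation of the parameter. -/
instance geodesicSetoid (κ : ℤˣ) : Setoid (UnitGeodesic κ) where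
  r γ σ := ∃ t₀ : ℝ, ∀ t, σ t = γ (t + t₀)
  iseqv :=
    { refl := fun γ => ⟨0, fun t => by simp⟩
      symm := by
        rintro γ σ ⟨a, h⟩
        exact ⟨-a, fun t => by rw [h]; simp⟩
      trans := by
        rintro γ σ τ ⟨a, h⟩ ⟨b, h'⟩
        exact ⟨b + a, fun t => by rw [h', h, add_assoc]⟩ }

/-- The set `𝒢_κ` of oriented (unparametrized) complete geodesics. -/
def OrientedGeodesic (κ : ℤˣ) : Type := Quotient (geodesicSetoid κ)

/-- The oriented geodesic `[γ]`. -/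
def UnitGeodesic.cls {κ : ℤˣ} (γ : UnitGeodesic κ) : OrientedGeodesic κ := Quotient.mk _ γ

/-- The same geodesic, run through backwards. -/
def UnitGeodesic.reverse {κ : ℤˣ} (γ : UnitGeodesic κ) : UnitGeodesic κ where
  toFun t := γ (-t)
  smooth := γ.smooth.comp contDiff_neg
  mem t := γ.mem (-t)
  unit_speed t := by
    have h := γ.unit_speed (-t)
    rw [deriv_comp_neg]
    simpa [form] using h
  geodesic t := by
    have h := γ.geodesic (-t)
    have e : deriv (fun t => γ (-t)) = fun t => -deriv γ.toFun (-t) := by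
      funext s; rw [deriv_comp_neg]
    have e' : deriv (deriv fun t => γ (-t)) t = deriv (deriv γ.toFun) (-t) := by
      rw [e, deriv.fun_neg, deriv_comp_neg (deriv γ.toFun), neg_neg]
    simp only [covD] at h ⊢
    rw [e']
    exact h

/-- Reversal of the orientation of an oriented geodesic. -/
def OrientedGeodesic.reverse {κ : ℤˣ} : OrientedGeodesic κ → OrientedGeodesic κ :=
  Quotient.map UnitGeodesic.reverse (by
    rintro γ σ ⟨a, h⟩
    refine ⟨-a, fun t => ?_⟩
    change σ (-t) = γ (-(t + -a))
    rw [h]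
    congr 1
    ring)

/-- The unit tangent bundle of `space κ`, with its subspace topology from `ℝ⁴ × ℝ⁴`. -/
def unitTangent (κ : ℤˣ) : Set (R4 × R4) :=
  {z | z.1 ∈ space κ ∧ form κ z.1 z.2 = 0 ∧ form κ z.2 z.2 = 1}

/-- `cos` or `cosh`. -/
def cosK (κ : ℤˣ) (r : ℝ) : ℝ := if κ = 1 then Real.cos r else Real.cosh r

/-- `sin` or `sinh`. -/
def sinK (κ : ℤˣ) (r : ℝ) : ℝ := if κ = 1 then Real.sin r else Real.sinh r

theorem hasDerivAt_cosK (κ : ℤˣ) (r : ℝ) :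
    HasDerivAt (cosK κ) (-(curv κ * sinK κ r)) r := by
  rcases Int.units_eq_one_or κ with rfl | rfl
  · have e : cosK 1 = Real.cos := by funext r; simp [cosK]
    rw [e]; simpa [curv, sinK] using Real.hasDerivAt_cos r
  · have h : ((-1 : ℤˣ) = 1) = False := by decide
    have e : cosK (-1) = Real.cosh := by funext r; simp [cosK, h]
    rw [e]; simpa [curv, sinK, h] using Real.hasDerivAt_cosh r

theorem hasDerivAt_sinK (κ : ℤˣ) (r : ℝ) : HasDerivAt (sinK κ) (cosK κ r) r := by
  rcases Int.units_eq_one_or κ with rfl | rfl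
  · have e : sinK 1 = Real.sin := by funext r; simp [sinK]
    rw [e]; simpa [cosK] using Real.hasDerivAt_sin r
  · have h : ((-1 : ℤˣ) = 1) = False := by decide
    have e : sinK (-1) = Real.sinh := by funext r; simp [sinK, h]
    rw [e]; simpa [cosK, h] using Real.hasDerivAt_sinh r

theorem curv_mul_self (κ : ℤˣ) : curv κ * curv κ = 1 := by
  rcases Int.units_eq_one_or κ with rfl | rfl <;> simp [curv]

theorem cosK_sq_add (κ : ℤˣ) (r : ℝ) :
    cosK κ r * cosK κ r + curv κ * (sinK κ r * sinK κ r) = 1 := by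
  rcases Int.units_eq_one_or κ with rfl | rfl
  · simp only [cosK, sinK, curv]
    simp
    nlinarith [Real.sin_sq_add_cos_sq r]
  · have h : ((-1 : ℤˣ) = 1) = False := by decide
    simp only [cosK, sinK, curv, h]
    simp
    nlinarith [Real.cosh_sq r]

theorem contDiff_cosK (κ : ℤˣ) : ContDiff ℝ ∞ (cosK κ) := by
  rcases Int.units_eq_one_or κ with rfl | rfl
  · have e : cosK 1 = Real.cos := by funext r; simp [cosK]
    rw [e]; exact Real.contDiff_cos
  · have h : ((-1 : ℤˣ) = 1) = False := by decide
    have e : cosK (-1) = Real.cosh := by funext r; simp [cosK, h]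
    rw [e]; exact Real.contDiff_cosh

theorem contDiff_sinK (κ : ℤˣ) : ContDiff ℝ ∞ (sinK κ) := by
  rcases Int.units_eq_one_or κ with rfl | rfl
  · have e : sinK 1 = Real.sin := by funext r; simp [sinK]
    rw [e]; exact Real.contDiff_sin
  · have h : ((-1 : ℤˣ) = 1) = False := by decide
    have e : sinK (-1) = Real.sinh := by funext r; simp [sinK, h]
    rw [e]; exact Real.contDiff_sinh

theorem form_lin (κ : ℤˣ) (a b c d : ℝ) (x v : R4) :
    form κ (a • x + b • v) (c • x + d • v) =
      a * c * form κ x x + (a * d + b * c) * form κ x v + b * d * form κ v v := by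
  simp only [form, Pi.add_apply, Pi.smul_apply, smul_eq_mul]
  ring

theorem hyp_pos (κ : ℤˣ) (z : R4 × R4) (hz : z ∈ unitTangent κ) (r : ℝ) (h : κ = -1) :
    0 < (cosK κ r • z.1 + sinK κ r • z.2) 0 := by
  subst h
  obtain ⟨⟨h1, h2⟩, h3, h4⟩ := hz
  have hpos := h2 rfl
  have h : ((-1 : ℤˣ) = 1) = False := by decide
  simp only [form, curv] at h1 h3 h4
  push_cast at h1 h3 h4
  simp only [cosK, sinK, h, Pi.add_apply, Pi.smul_apply, smul_eq_mul, if_false]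
  -- Cauchy-Schwarz gives `v₀² < x₀²`
  have hcs : (z.1 0 * z.2 0) ^ 2 ≤ (z.1 0 ^ 2 - 1) * (z.2 0 ^ 2 + 1) := by
    have e1 : z.1 0 * z.2 0 = z.1 1 * z.2 1 + z.1 2 * z.2 2 + z.1 3 * z.2 3 := by linarith
    have e2 : z.1 0 ^ 2 - 1 = z.1 1 ^ 2 + z.1 2 ^ 2 + z.1 3 ^ 2 := by nlinarith
    have e3 : z.2 0 ^ 2 + 1 = z.2 1 ^ 2 + z.2 2 ^ 2 + z.2 3 ^ 2 := by nlinarith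
    rw [e1, e2, e3]
    nlinarith [sq_nonneg (z.1 1 * z.2 2 - z.1 2 * z.2 1),
      sq_nonneg (z.1 1 * z.2 3 - z.1 3 * z.2 1), sq_nonneg (z.1 2 * z.2 3 - z.1 3 * z.2 2)]
  have hlt : |z.2 0| < z.1 0 := by
    apply abs_lt_of_sq_lt_sq _ hpos.le
    nlinarith
  have hsc : |Real.sinh r| < Real.cosh r := by
    apply abs_lt_of_sq_lt_sq _ (Real.cosh_pos r).le
    nlinarith [Real.cosh_sq r]
  have hprod : |Real.sinh r * z.2 0| < Real.cosh r * z.1 0 := by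
    rw [abs_mul]
    exact mul_lt_mul'' hsc hlt (abs_nonneg _) (abs_nonneg _)
  linarith [neg_abs_le (Real.sinh r * z.2 0)]

/-- The unit speed geodesic `t ↦ c_κ(t) x + s_κ(t) v` with initial point `x` and initial
velocity `v`. -/
def geodesicOf {κ : ℤˣ} (z : unitTangent κ) : UnitGeodesic κ := by
  have hd : ∀ t, HasDerivAt (fun t => cosK κ t • z.1.1 + sinK κ t • z.1.2)
      ((-(curv κ * sinK κ t)) • z.1.1 + cosK κ t • z.1.2) t := fun t =>
    ((hasDerivAt_cosK κ t).smul_const _).add ((hasDerivAt_sinK κ t).smul_const _)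
  have hd1 : deriv (fun t => cosK κ t • z.1.1 + sinK κ t • z.1.2) =
      fun t => (-(curv κ * sinK κ t)) • z.1.1 + cosK κ t • z.1.2 := funext fun t => (hd t).deriv
  have hd2 : ∀ t, deriv (deriv (fun t => cosK κ t • z.1.1 + sinK κ t • z.1.2)) t =
      (-curv κ) • (cosK κ t • z.1.1 + sinK κ t • z.1.2) := by
    intro t
    rw [hd1]
    have := ((((hasDerivAt_sinK κ t).const_mul (curv κ)).neg).smul_const z.1.1).add
      ((hasDerivAt_cosK κ t).smul_const z.1.2)
    refine this.deriv.trans ?_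
    funext i
    simp only [Pi.add_apply, Pi.smul_apply, smul_eq_mul]
    ring
  have hx : form κ z.1.1 z.1.1 = curv κ := z.2.1.1
  have hxv : form κ z.1.1 z.1.2 = 0 := z.2.2.1
  have hv : form κ z.1.2 z.1.2 = 1 := z.2.2.2
  have hk := curv_mul_self κ
  have hn : ∀ t, form κ (cosK κ t • z.1.1 + sinK κ t • z.1.2)
      (cosK κ t • z.1.1 + sinK κ t • z.1.2) = curv κ := by
    intro t
    rw [form_lin, hx, hxv, hv]
    linear_combination (curv κ) * cosK_sq_add κ t - (sinK κ t * sinK κ t) * hk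
  exact
    { toFun := fun t => cosK κ t • z.1.1 + sinK κ t • z.1.2
      smooth := ((contDiff_cosK κ).smul contDiff_const).add
        ((contDiff_sinK κ).smul contDiff_const)
      mem := fun t => ⟨hn t, hyp_pos κ z.1 z.2 t⟩
      unit_speed := fun t => by
        rw [hd1]
        simp only
        rw [form_lin, hx, hxv, hv]
        linear_combination cosK_sq_add κ t + (curv κ * (sinK κ t * sinK κ t)) * hk
      geodesic := fun t => by
        simp only [covD, tangentProj]
        rw [hd2]
        have hs : ∀ (a : ℝ) (w : R4), form κ (a • w) w = a * form κ w w := by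
          intro a w
          simp only [form, Pi.smul_apply, smul_eq_mul]
          ring
        rw [hs, hn]
        rw [show curv κ * (-curv κ * curv κ) = -curv κ by linear_combination (-curv κ) * hk]
        exact sub_self _ }

/-! ### Smooth maps, tangent vectors and the Kähler structure on `𝒢_κ`

`𝒢_κ` carries the smooth structure for which the projection `z ↦ [γ_z]` from the unit tangent
bundle is a submersion. Tangent vectors at `[γ]` are the Jacobi fields along `γ` orthogonal
to `γ'`. -/

/-- A map between subsets of `𝒢_κ` is smooth (with open domain) if it has a smooth lift to unit
tangent vectors near every unit tangent vector of a geodesic of the domain. -/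
def IsSmoothMap {κ : ℤˣ} {U V : Set (OrientedGeodesic κ)} (f : U → V) : Prop :=
  ∀ z : unitTangent κ, (geodesicOf z).cls ∈ U →
    ∃ Ψ : R4 × R4 → R4 × R4, ContDiffAt ℝ ∞ Ψ z.1 ∧
      ∀ᶠ y : unitTangent κ in 𝓝 z,
        ∃ (hU : (geodesicOf y).cls ∈ U) (hΨ : Ψ y.1 ∈ unitTangent κ),
          (f ⟨(geodesicOf y).cls, hU⟩ : OrientedGeodesic κ) = (geodesicOf ⟨Ψ y.1, hΨ⟩).cls

theorem form_smooth (κ : ℤˣ) {X Y : ℝ → R4} (hX : ContDiff ℝ ∞ X) (hY : ContDiff ℝ ∞ Y) :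
    ContDiff ℝ ∞ (fun t => form κ (X t) (Y t)) := by
  have h1 := contDiff_pi.1 hX
  have h2 := contDiff_pi.1 hY
  exact (((contDiff_const.mul ((h1 0).mul (h2 0))).add ((h1 1).mul (h2 1))).add
    ((h1 2).mul (h2 2))).add ((h1 3).mul (h2 3))

theorem covD_smooth (κ : ℤˣ) {c X : ℝ → R4} (hc : ContDiff ℝ ∞ c) (hX : ContDiff ℝ ∞ X) :
    ContDiff ℝ ∞ (covD κ c X) := by
  have h : ContDiff ℝ ∞ (deriv X) := (contDiff_infty_iff_deriv.1 hX).2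
  exact h.sub ((contDiff_const.mul (form_smooth κ h hc)).smul hc)

theorem covD_add (κ : ℤˣ) (c : ℝ → R4) {X Y : ℝ → R4} (hX : ContDiff ℝ ∞ X)
    (hY : ContDiff ℝ ∞ Y) : covD κ c (X + Y) = covD κ c X + covD κ c Y := by
  funext t
  have h : deriv (X + Y) t = deriv X t + deriv Y t :=
    deriv_add (hX.differentiable (by simp) t) (hY.differentiable (by simp) t)
  simp only [covD, tangentProj, h, Pi.add_apply]
  funext i
  simp only [form, Pi.add_apply, Pi.sub_apply, Pi.smul_apply, smul_eq_mul]
  ring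

theorem covD_smul (κ : ℤˣ) (c : ℝ → R4) (a : ℝ) {X : ℝ → R4} (hX : ContDiff ℝ ∞ X) :
    covD κ c (a • X) = a • covD κ c X := by
  funext t
  have h : deriv (a • X) t = a • deriv X t :=
    deriv_const_smul a (hX.differentiable (by simp) t)
  simp only [covD, tangentProj, h, Pi.smul_apply]
  funext i
  simp only [form, Pi.sub_apply, Pi.smul_apply, smul_eq_mul]
  ring

/-- The space `𝔍_γ ≅ T_{[γ]} 𝒢_κ` of Jacobi fields along `γ` orthogonal to `γ'`: the smooth
tangent fields `J` along `γ` with `⟨J, γ'⟩ = 0` and `D²J/dr² + κ J = 0`. -/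
def jacobi {κ : ℤˣ} (γ : UnitGeodesic κ) : Submodule ℝ (ℝ → R4) where
  carrier := {J | ContDiff ℝ ∞ J ∧ (∀ r, form κ (γ r) (J r) = 0) ∧
    (∀ r, form κ (deriv γ r) (J r) = 0) ∧
    ∀ r, covD κ γ (covD κ γ J) r + curv κ • J r = 0}
  add_mem' := by
    rintro I J ⟨h1, h2, h3, h4⟩ ⟨k1, k2, k3, k4⟩
    have hadd : ∀ x v w : R4, form κ x (v + w) = form κ x v + form κ x w := by
      intro x v w; simp only [form, Pi.add_apply]; ring
    refine ⟨h1.add k1, fun r => ?_, fun r => ?_, fun r => ?_⟩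
    · rw [Pi.add_apply, hadd, h2, k2, add_zero]
    · rw [Pi.add_apply, hadd, h3, k3, add_zero]
    · rw [covD_add κ _ h1 k1, covD_add κ _ (covD_smooth κ γ.smooth h1)
        (covD_smooth κ γ.smooth k1), Pi.add_apply, Pi.add_apply, smul_add]
      rw [add_add_add_comm, h4, k4, add_zero]
  zero_mem' := by
    have h0 : covD κ γ (0 : ℝ → R4) = 0 := by
      funext t i
      have : deriv (0 : ℝ → R4) t = 0 := by simp
      simp [covD, tangentProj, this, form]
    refine ⟨contDiff_const, fun r => by simp [form], fun r => by simp [form], fun r => ?_⟩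
    rw [h0, h0]
    simp
  smul_mem' := by
    rintro a J ⟨h1, h2, h3, h4⟩
    have hsm : ∀ x v : R4, form κ x (a • v) = a * form κ x v := by
      intro x v; simp only [form, Pi.smul_apply, smul_eq_mul]; ring
    refine ⟨contDiff_const.smul h1, fun r => ?_, fun r => ?_, fun r => ?_⟩
    · rw [Pi.smul_apply, hsm, h2, mul_zero]
    · rw [Pi.smul_apply, hsm, h3, mul_zero]
    · rw [covD_smul κ _ a h1, covD_smul κ _ a (covD_smooth κ γ.smooth h1), Pi.smul_apply,
        Pi.smul_apply, smul_comm, ← smul_add, h4, smul_zero]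

/-- `φ` is a smooth variation of `γ` by unit speed geodesics, that is, `s ↦ [φ_s]` is a smooth
curve in `𝒢_κ` starting at `[γ]`. -/
def IsVariation {κ : ℤˣ} (γ : UnitGeodesic κ) (φ : ℝ → UnitGeodesic κ) : Prop :=
  φ 0 = γ ∧ ∃ δ > 0,
    ContDiffOn ℝ ∞ (fun q : ℝ × ℝ => φ q.2 q.1) (univ ×ˢ Ioo (-δ) δ)

/-- The component orthogonal to `γ'` of the variation field `d/ds|₀ φ_s` of a variation of `γ`;
it represents the initial velocity of the curve `s ↦ [φ_s]`. -/
def velocity {κ : ℤˣ} (γ : UnitGeodesic κ) (φ : ℝ → UnitGeodesic κ) (r : ℝ) : R4 :=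
  deriv (fun s => φ s r) 0 - form κ (deriv (fun s => φ s r) 0) (deriv γ r) • deriv γ r

/-- `D : T_{[γ]} 𝒢_κ → T_{[σ]} 𝒢_κ` is the differential at `[γ]` of `f`, where `f [γ] = [σ]`:
it sends the velocity of a curve to the velocity of the image of the curve under `f`. -/
def IsDifferential {κ : ℤˣ} {U V : Set (OrientedGeodesic κ)} (f : U → V)
    (γ σ : UnitGeodesic κ) (D : jacobi γ →ₗ[ℝ] jacobi σ) : Prop :=
  ∀ (J : jacobi γ) (φ : ℝ → UnitGeodesic κ), IsVariation γ φ → velocity γ φ = J →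
    ∃ ψ : ℝ → UnitGeodesic κ, IsVariation σ ψ ∧ velocity σ ψ = D J ∧
      ∀ᶠ s in 𝓝 (0 : ℝ), ∃ h : (φ s).cls ∈ U, (f ⟨(φ s).cls, h⟩ : OrientedGeodesic κ) = (ψ s).cls

/-- The complex structure `𝒥 J = γ' × J`. -/
def complexStructure {κ : ℤˣ} (γ : UnitGeodesic κ) (J : ℝ → R4) : ℝ → R4 :=
  fun r => cross κ (γ r) (deriv γ r) (J r)

/-- The metric `g_K (I, J) = ⟨I, J⟩ + κ ⟨I', J'⟩` induced by the Killing form. For Jacobi fields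
orthogonal to `γ'` the right-hand side does not depend on the point of `γ`. -/
def gK {κ : ℤˣ} (γ : UnitGeodesic κ) (I J : ℝ → R4) : ℝ :=
  form κ (I 0) (J 0) + curv κ * form κ (covD κ γ I 0) (covD κ γ J 0)

/-- The fundamental form `ω_K (I, J) = g_K (𝒥 I, J)`. -/
def omegaK {κ : ℤˣ} (γ : UnitGeodesic κ) (I J : jacobi γ) : ℝ :=
  gK γ (complexStructure γ I) J

/-- `B` is a diffeomorphism of the open set `U` onto the open set `V` with `B^* ω_K = ω_K`. -/
def IsSymplectomorphism {κ : ℤˣ} {U V : Set (OrientedGeodesic κ)} (B : U ≃ V) : Prop :=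
  IsSmoothMap B ∧ IsSmoothMap B.symm ∧
    ∀ (γ σ : UnitGeodesic κ) (h : γ.cls ∈ U), (B ⟨γ.cls, h⟩ : OrientedGeodesic κ) = σ.cls →
      ∃ D : jacobi γ →ₗ[ℝ] jacobi σ, IsDifferential B γ σ D ∧
        ∀ I J : jacobi γ, omegaK σ (D I) (D J) = omegaK γ I J

/-! ### Quadratically convex surfaces -/

/-- Smooth embedded surfaces in `space κ` without boundary: locally regular level sets. -/
def IsSurface (κ : ℤˣ) (S : Set R4) : Prop :=
  S ⊆ space κ ∧ ∀ p ∈ S, ∃ f : R4 → ℝ, ContDiff ℝ ∞ f ∧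
    (∃ w, form κ p w = 0 ∧ fderiv ℝ f p w ≠ 0) ∧
    ∀ᶠ x in 𝓝 p, x ∈ S ↔ x ∈ space κ ∧ f x = 0

/-- The tangent space `T_p S`: the velocities at `p` of the smooth curves in `S`. -/
def tangentSpace (S : Set R4) (p : R4) : Set R4 :=
  {w | ∃ c : ℝ → R4, ContDiff ℝ ∞ c ∧ (∀ᶠ t in 𝓝 (0 : ℝ), c t ∈ S) ∧ c 0 = p ∧ deriv c 0 = w}

/-- The complete totally geodesic surface of `space κ` tangent to `S` at `p`: the intersection of
`space κ` with the linear subspace `ℝ p ⊕ T_p S`. -/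
def tangentSurface (κ : ℤˣ) (S : Set R4) (p : R4) : Set R4 :=
  {x | x ∈ space κ ∧ ∃ a : ℝ, ∃ w ∈ tangentSpace S p, x = a • p + w}

/-- `S` is strictly convex: the complete totally geodesic surface tangent to `S` at `p` meets `S`
only at `p`. -/
def IsStrictlyConvex (κ : ℤˣ) (S : Set R4) : Prop :=
  ∀ p ∈ S, tangentSurface κ S p ∩ S = {p}

/-- `n` is a unit normal vector of `S` at `p`. -/
def IsUnitNormal (κ : ℤˣ) (S : Set R4) (p n : R4) : Prop :=
  form κ p n = 0 ∧ form κ n n = 1 ∧ ∀ w ∈ tangentSpace S p, form κ n w = 0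

/-- The shape operator `w ↦ -∇_w N` at `p`, for a unit normal field `N` near `p`. -/
def shapeOperator (κ : ℤˣ) (N : R4 → R4) (p w : R4) : R4 :=
  -tangentProj κ p (fderiv ℝ N p w)

/-- The shape operator of `S` is definite at every point. -/
def HasDefiniteShape (κ : ℤˣ) (S : Set R4) : Prop :=
  ∀ p ∈ S, ∃ N : R4 → R4, ContDiff ℝ ∞ N ∧ (∀ᶠ q in 𝓝[S] p, IsUnitNormal κ S q (N q)) ∧
    ((∀ w ∈ tangentSpace S p, w ≠ 0 → 0 < form κ (shapeOperator κ N p w) w) ∨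
      (∀ w ∈ tangentSpace S p, w ≠ 0 → form κ (shapeOperator κ N p w) w < 0))

/-- Quadratically convex surfaces: strictly convex surfaces with definite shape operator. -/
def IsQuadraticallyConvex (κ : ℤˣ) (S : Set R4) : Prop :=
  IsStrictlyConvex κ S ∧ HasDefiniteShape κ S

/-! ### The outer billiard map -/

/-- A tangent point `p` of a totally geodesic surface that contains `γ` and is tangent to `S`,
with a shortest geodesic segment `σ : [0, d] → space κ` from the point `q = γ t` of `γ` to `p`, and
the parallel field `W` along `γ` with `W t = σ' 0`. -/
structure TangentData {κ : ℤˣ} (S : Set R4) (γ : UnitGeodesic κ) where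
  p : R4
  p_mem : p ∈ S
  tangent : range γ ⊆ tangentSurface κ S p
  t : ℝ
  d : ℝ
  d_pos : 0 < d
  σ : UnitGeodesic κ
  σ_zero : σ 0 = γ t
  σ_end : σ d = p
  shortest : ∀ (τ : UnitGeodesic κ) (r s : ℝ), 0 ≤ s → τ 0 = γ r → τ s = p → d ≤ s
  W : ℝ → R4
  W_parallel : IsParallel κ γ W
  W_init : W t = deriv σ 0

/-- `ℓ'` is the image of `ℓ = [γ]` under the outer billiard map associated with `S`: with the
two tangent points labelled so that `{W₊, W₋, γ'}` is a positively oriented frame along `γ`, the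
line `ℓ'` is the parallel transport of `ℓ` along `σ₊` between `0` and `2 d₊`. -/
def IsOuterBilliardImage {κ : ℤˣ} (S : Set R4) (ℓ ℓ' : OrientedGeodesic κ) : Prop :=
  ∃ (γ : UnitGeodesic κ) (P Q : TangentData S γ) (V : ℝ → R4) (τ : UnitGeodesic κ),
    γ.cls = ℓ ∧ τ.cls = ℓ' ∧
    (∀ r, 0 < vol (γ r) (P.W r) (Q.W r) (deriv γ r)) ∧
    IsParallel κ P.σ V ∧ V 0 = deriv γ P.t ∧
    τ 0 = P.σ (2 * P.d) ∧ deriv τ 0 = V (2 * P.d)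

/-- The Gauss image of a strictly convex surface in the three-sphere (`κ = 1`): the oriented
great circles `s ↦ cos s u + sin s v`, where `(u, v)` is an orthonormal basis of `T_p S` that is
positively oriented with respect to the unit normal `n` pointing inwards (to the side of the
tangent great sphere on which `S` lies). -/
def gaussImage (κ : ℤˣ) (S : Set R4) : Set (OrientedGeodesic κ) :=
  {ℓ | ∃ p ∈ S, ∃ n, IsUnitNormal κ S p n ∧ (∀ x ∈ S, 0 ≤ form κ n x) ∧
    ∃ γ : UnitGeodesic κ, γ.cls = ℓ ∧ γ 0 ∈ tangentSpace S p ∧ deriv γ 0 ∈ tangentSpace S p ∧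
      0 < vol p n (γ 0) (deriv γ 0)}

/-- The billiard table: the oriented geodesics that do not meet `S` and, if `κ = 1`, do not belong
to the Gauss image of `S`. -/
def table (κ : ℤˣ) (S : Set R4) : Set (OrientedGeodesic κ) :=
  {ℓ | (∀ γ : UnitGeodesic κ, γ.cls = ℓ → ∀ t, γ t ∉ S) ∧ (κ = 1 → ℓ ∉ gaussImage κ S)}

/-- The oriented geodesics whose reversal belongs to the billiard table. -/
def reversedTable (κ : ℤˣ) (S : Set R4) : Set (OrientedGeodesic κ) :=
  {ℓ | ℓ.reverse ∈ table κ S}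

end OuterBilliard

end

/-!
Let `ν` be the inward unit normal of the quadratically convex surface `S`, and write `K = κ`.
All geometry takes place in `ℝ⁴` with the form `⟨·,·⟩ = form κ`: a geodesic with frame
`(u, v) = (γ t, γ' t)` lies in the plane of `u` and `v`, and a totally geodesic surface tangent to
`S` at `p` contains `γ` exactly when `⟨ν p, u⟩ = ⟨ν p, v⟩ = 0`.

*Tangent points.* `IsTangentAt` singles out the tangent points `p` for which
`vol p (ν p) u v > 0`. For such `p`, `vol p x u v` is a positive multiple of `⟨ν p, x⟩`, which is
positive for the points `x ≠ p` of `S`; since exchanging `p` and `x` changes the sign of the volume,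
there is at most one such point (`IsTangentAt.unique`). It exists for every geodesic that misses `S`
(`IsGaussMap.exists_isTangentAt`): by convexity, a linear functional `f` separates `S` from the
plane of `γ`, and on the compact set `S` a quotient of two functionals vanishing on this plane, with
denominator `f`, attains its minimum at a tangent point.

*The billiard map.* Parallel transport by `2 d₊` along the geodesic `σ₊` from `q₊` to `p₊` differs
from the geodesic symmetry `refl κ p₊` in `p₊` by a sign on tangent vectors. So the billiard map is
the composition of the reversal of orientation with the symmetry in the tangent point, and the
orientation condition on `(W₊, W₋, γ')` selects the tangent point of `IsTangentAt`
(`isOuterBilliardImage_iff`). The symmetry in `p` preserves `⟨·,·⟩`, fixes `p` and reverses both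
`ν p` and the orientation of `ℝ⁴`; hence `p` is also the tangent point of the reflected geodesic,
and the reflection `reflectMap` is an involution of the table. The Gauss image, left out for
`κ = 1`, consists of the geodesics orthogonal to `p₊`, so the reflection does not lead into it.

*Smoothness.* By definiteness of the shape operator, the implicit function theorem applies to the
equations for the tangent point (`exists_tangentFamily`), so that the billiard map and its inverse
lift to smooth maps of frames.

*Symplecticity.* At a frame `(u, v)`, the fundamental form of the tangent vectors `d` and `d'` is
`vol u v d₁ d'₁ + K vol u v d₂ d'₂` (`frameForm`); a symmetry and the reversal of orientation each
change its sign. The motion `q` of the tangent point contributes an infinitesimal rotation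
(`twist`). Writing `A` for the differential of the normal field, differentiation of
`⟨ν p, u⟩ = ⟨ν p, v⟩ = 0` gives `⟨A q, u⟩ = -⟨ν p, d₁⟩` and `⟨A q, v⟩ = -⟨ν p, d₂⟩`, and with these
equations the contribution of `q` and `q'` to the fundamental form is a multiple of
`⟨A q, q'⟩ - ⟨A q', q⟩`, which vanishes because the shape operator is symmetric
(`frameForm_add_twist`).
-/

noncomputable section

namespace OuterBilliard

/-! ### The ambient form and the volume -/

section Algebra

variable (κ : ℤˣ)

theorem form_comm (x y : R4) : form κ x y = form κ y x := by simp only [form]; ring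

theorem form_add_left (x y z : R4) : form κ (x + y) z = form κ x z + form κ y z := by
  simp only [form, Pi.add_apply]; ring

theorem form_add_right (x y z : R4) : form κ x (y + z) = form κ x y + form κ x z := by
  simp only [form, Pi.add_apply]; ring

theorem form_sub_left (x y z : R4) : form κ (x - y) z = form κ x z - form κ y z := by
  simp only [form, Pi.sub_apply]; ring

theorem form_sub_right (x y z : R4) : form κ x (y - z) = form κ x y - form κ x z := by
  simp only [form, Pi.sub_apply]; ring

theorem form_smul_left (a : ℝ) (x y : R4) : form κ (a • x) y = a * form κ x y := by
  simp only [form, Pi.smul_apply, smul_eq_mul]; ring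

theorem form_smul_right (a : ℝ) (x y : R4) : form κ x (a • y) = a * form κ x y := by
  simp only [form, Pi.smul_apply, smul_eq_mul]; ring

theorem form_neg_left (x y : R4) : form κ (-x) y = -form κ x y := by
  simp only [form, Pi.neg_apply]; ring

theorem form_neg_right (x y : R4) : form κ x (-y) = -form κ x y := by
  simp only [form, Pi.neg_apply]; ring

theorem form_zero_left (x : R4) : form κ 0 x = 0 := by simp [form]

theorem form_zero_right (x : R4) : form κ x 0 = 0 := by simp [form]

theorem eq_zero_of_form {x : R4} (h : ∀ y, form κ x y = 0) : x = 0 := by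
  have hk := curv_mul_self κ
  funext i
  have := h (Pi.single i 1)
  fin_cases i <;> simp [form] at this ⊢
  · rcases this with h | h
    · rw [h] at hk; simp at hk
    · exact h
  all_goals exact this

/-- The form as a linear functional of its second argument. -/
def formL (x : R4) : R4 →L[ℝ] ℝ := LinearMap.toContinuousLinearMap
  { toFun := form κ x
    map_add' := form_add_right κ x
    map_smul' := fun a y => form_smul_right κ a x y }

@[simp] theorem formL_apply (x y : R4) : formL κ x y = form κ x y := rfl

theorem continuous_form {X : Type*} [TopologicalSpace X] {f g : X → R4} (hf : Continuous f)
    (hg : Continuous g) : Continuous fun x => form κ (f x) (g x) := by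
  simp only [form]; fun_prop

end Algebra

theorem vol_eq (x a b c : R4) : vol x a b c =
    x 0 * (a 1 * (b 2 * c 3 - b 3 * c 2) - a 2 * (b 1 * c 3 - b 3 * c 1)
      + a 3 * (b 1 * c 2 - b 2 * c 1))
    - x 1 * (a 0 * (b 2 * c 3 - b 3 * c 2) - a 2 * (b 0 * c 3 - b 3 * c 0)
      + a 3 * (b 0 * c 2 - b 2 * c 0))
    + x 2 * (a 0 * (b 1 * c 3 - b 3 * c 1) - a 1 * (b 0 * c 3 - b 3 * c 0)
      + a 3 * (b 0 * c 1 - b 1 * c 0))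
    - x 3 * (a 0 * (b 1 * c 2 - b 2 * c 1) - a 1 * (b 0 * c 2 - b 2 * c 0)
      + a 2 * (b 0 * c 1 - b 1 * c 0)) := by
  simp [vol, Matrix.det_succ_row_zero, Fin.sum_univ_succ, Fin.succAbove]
  ring

theorem continuous_vol {X : Type*} [TopologicalSpace X] {f g h k : X → R4} (hf : Continuous f)
    (hg : Continuous g) (hh : Continuous h) (hk : Continuous k) :
    Continuous fun x => vol (f x) (g x) (h x) (k x) := by
  simp only [vol_eq]; fun_prop

/-- Cramer's rule for five vectors. -/
theorem cramer (x a b c d : R4) : vol a b c d • x =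
    vol x b c d • a + vol a x c d • b + vol a b x d • c + vol a b c x • d := by
  funext i
  simp only [vol_eq, Pi.add_apply, Pi.smul_apply, smul_eq_mul]
  fin_cases i <;> simp only [Fin.zero_eta, Fin.mk_one, Fin.reduceFinMk] <;> ring

theorem vol_add_two (a b b' c d : R4) : vol a (b + b') c d = vol a b c d + vol a b' c d := by
  simp only [vol_eq, Pi.add_apply]; ring

theorem vol_smul_two (r : ℝ) (a b c d : R4) : vol a (r • b) c d = r * vol a b c d := by
  simp only [vol_eq, Pi.smul_apply, smul_eq_mul]; ring

theorem vol_swap_one_two (a b c d : R4) : vol b a c d = -vol a b c d := by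
  simp only [vol_eq]; ring

theorem vol_swap_pairs (a b c d : R4) : vol c d a b = vol a b c d := by
  simp only [vol_eq]; ring

theorem vol_combination (x y u v : R4) (a b c d : ℝ) :
    vol x y (a • u + b • v) (c • u + d • v) = (a * d - b * c) * vol x y u v := by
  simp only [vol_eq, Pi.add_apply, Pi.smul_apply, smul_eq_mul]; ring

theorem vol_neg_four (a b c d : R4) : vol a b c (-d) = -vol a b c d := by
  simp only [vol_eq, Pi.neg_apply]; ring

theorem vol_neg_three (a b c d : R4) : vol a b (-c) d = -vol a b c d := by
  simp only [vol_eq, Pi.neg_apply]; ring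

theorem vol_eq_zero_of_eq (a b c : R4) : vol a a b c = 0 := by
  simp only [vol_eq]; ring

/-- Vectors with zero volume are linearly dependent. -/
theorem exists_dependence {a b c d : R4} (h : vol a b c d = 0) :
    ∃ r : Fin 4 → ℝ, r ≠ 0 ∧ r 0 • a + r 1 • b + r 2 • c + r 3 • d = 0 := by
  obtain ⟨r, hr, h⟩ := Matrix.exists_vecMul_eq_zero_iff.2 h
  refine ⟨r, hr, ?_⟩
  rw [← h]
  funext i
  simp [Matrix.vecMul, dotProduct, Fin.sum_univ_four]

/-- The volume as a linear functional of its second argument. -/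
def volL (a c d : R4) : R4 →L[ℝ] ℝ := LinearMap.toContinuousLinearMap
  { toFun := fun b => vol a b c d
    map_add' := fun x y => vol_add_two a x y c d
    map_smul' := fun r x => vol_smul_two r a x c d }

@[simp] theorem volL_apply (a b c d : R4) : volL a c d b = vol a b c d := rfl

/-- A linear functional vanishing on the plane spanned by `c` and `d` satisfies a Plücker type
relation with the volume. -/
theorem plucker (f : R4 →ₗ[ℝ] ℝ) {c d : R4} (hc : f c = 0) (hd : f d = 0) (e x y : R4) :
    f e * vol x y c d = f x * vol e y c d - f y * vol e x c d := by
  have h := congrArg f (cramer e x y c d)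
  simp only [map_add, map_smul, hc, hd, smul_eq_mul] at h
  have h2 : vol x e c d = -vol e x c d := vol_swap_one_two e x c d
  rw [h2] at h
  linear_combination h

variable {κ : ℤˣ}

theorem curv_ne_zero (κ : ℤˣ) : curv κ ≠ 0 := fun h => by
  have := curv_mul_self κ; rw [h] at this; simp at this

/-! ### Geodesic reflections -/

/-- The geodesic symmetry at the point `p` of `space κ`, extended linearly to the ambient space. -/
def refl (κ : ℤˣ) (p x : R4) : R4 := (2 * curv κ * form κ p x) • p - x

theorem refl_add (p x y : R4) : refl κ p (x + y) = refl κ p x + refl κ p y := by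
  simp only [refl, form_add_right]; module

theorem refl_smul (p : R4) (a : ℝ) (x : R4) : refl κ p (a • x) = a • refl κ p x := by
  simp only [refl, form_smul_right]; module

theorem form_refl_refl {p : R4} (hp : form κ p p = curv κ) (x y : R4) :
    form κ (refl κ p x) (refl κ p y) = form κ x y := by
  simp only [refl, form_sub_left, form_sub_right, form_smul_left, form_smul_right, hp,
    form_comm κ x p]
  linear_combination (4 * curv κ * form κ p x * form κ p y) * curv_mul_self κ

theorem form_refl {p : R4} (hp : form κ p p = curv κ) (x : R4) :
    form κ p (refl κ p x) = form κ p x := by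
  simp only [refl, form_sub_right, form_smul_right, hp]
  linear_combination (2 * form κ p x) * curv_mul_self κ

theorem refl_refl {p : R4} (hp : form κ p p = curv κ) (x : R4) :
    refl κ p (refl κ p x) = x := by
  rw [refl, form_refl hp, refl]; module

theorem form_refl_of_orthogonal {p n : R4} (hn : form κ n p = 0) (x : R4) :
    form κ n (refl κ p x) = -form κ n x := by
  simp only [refl, form_sub_right, form_smul_right, hn]; ring

theorem form_cramer (p a b c d : R4) : vol a b c d * form κ p p =
    vol p b c d * form κ p a + vol a p c d * form κ p b + vol a b p d * form κ p c
      + vol a b c p * form κ p d := by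
  have h := congrArg (form κ p) (cramer p a b c d)
  simpa only [form_add_right, form_smul_right] using h

/-- The geodesic symmetry reverses the ambient orientation. -/
theorem vol_refl {p : R4} (hp : form κ p p = curv κ) (a b c d : R4) :
    vol (refl κ p a) (refl κ p b) (refl κ p c) (refl κ p d) = -vol a b c d := by
  have e : ∀ r s t u : ℝ, vol (r • p - a) (s • p - b) (t • p - c) (u • p - d) =
      vol a b c d - (r * vol p b c d + s * vol a p c d + t * vol a b p d + u * vol a b c p) := by
    intro r s t u
    simp only [vol_eq, Pi.sub_apply, Pi.smul_apply, smul_eq_mul]; ring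
  have h := form_cramer (κ := κ) p a b c d
  rw [hp] at h
  simp only [refl, e]
  linear_combination (2 * curv κ) * h - (2 * vol a b c d) * curv_mul_self κ

/-- For vectors `u, v, p` orthogonal to a unit vector `n`, the functional `vol p · u v` is a
multiple of `⟨n, ·⟩`. -/
theorem vol_eq_mul_form {p n u v : R4} (hn : form κ n n = 1) (hp : form κ n p = 0)
    (hu : form κ n u = 0) (hv : form κ n v = 0) (x : R4) :
    vol p x u v = vol p n u v * form κ n x := by
  have h := congrArg (form κ n) (cramer x p n u v)
  simp only [form_add_right, form_smul_right, hn, hp, hu, hv] at h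
  linear_combination -h

/-! ### Geodesics are determined by their frames -/

theorem cosK_zero (κ : ℤˣ) : cosK κ 0 = 1 := by simp [cosK]

theorem sinK_zero (κ : ℤˣ) : sinK κ 0 = 0 := by simp [sinK]

/-- Solutions of `X'' = -κ X` are combinations of `cosK` and `sinK`. -/
theorem harmonic {X : ℝ → R4} (hX : ContDiff ℝ ∞ X)
    (h : ∀ t, deriv (deriv X) t = -curv κ • X t) (t s : ℝ) :
    X (t + s) = cosK κ s • X t + sinK κ s • deriv X t ∧
      deriv X (t + s) = (-(curv κ * sinK κ s)) • X t + cosK κ s • deriv X t := by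
  have hX' : ContDiff ℝ ∞ (deriv X) := (contDiff_infty_iff_deriv.1 hX).2
  have d1 : ∀ s, HasDerivAt (fun s => X (t + s)) (deriv X (t + s)) s := fun s =>
    HasDerivAt.comp_const_add t s (hX.differentiable (by simp) _).hasDerivAt
  have d2 : ∀ s, HasDerivAt (fun s => deriv X (t + s)) (-curv κ • X (t + s)) s := fun s => by
    rw [← h]
    exact HasDerivAt.comp_const_add t s (hX'.differentiable (by simp) _).hasDerivAt
  have cA : ∀ s, cosK κ s • X (t + s) - sinK κ s • deriv X (t + s) = X t := by
    intro s
    have hd : ∀ s, HasDerivAt (fun s => cosK κ s • X (t + s) - sinK κ s • deriv X (t + s)) 0 s :=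
      fun s => by
        refine (((hasDerivAt_cosK κ s).smul (d1 s)).sub
          ((hasDerivAt_sinK κ s).smul (d2 s))).congr_deriv ?_
        module
    have := is_const_of_deriv_eq_zero (fun s => (hd s).differentiableAt) (fun s => (hd s).deriv) s 0
    simpa [cosK_zero, sinK_zero] using this
  have cB : ∀ s, (curv κ * sinK κ s) • X (t + s) + cosK κ s • deriv X (t + s) = deriv X t := by
    intro s
    have hd : ∀ s, HasDerivAt (fun s => (curv κ * sinK κ s) • X (t + s)
        + cosK κ s • deriv X (t + s)) 0 s :=
      fun s => by
        refine ((((hasDerivAt_sinK κ s).const_mul (curv κ)).smul (d1 s)).add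
          ((hasDerivAt_cosK κ s).smul (d2 s))).congr_deriv ?_
        module
    have := is_const_of_deriv_eq_zero (fun s => (hd s).differentiableAt) (fun s => (hd s).deriv) s 0
    simpa [cosK_zero, sinK_zero] using this
  have hk := cosK_sq_add κ s
  constructor
  · rw [← cA s, ← cB s]
    generalize X (t + s) = A
    generalize deriv X (t + s) = B
    rw [show cosK κ s • (cosK κ s • A - sinK κ s • B)
      + sinK κ s • ((curv κ * sinK κ s) • A + cosK κ s • B) =
      (cosK κ s * cosK κ s + curv κ * (sinK κ s * sinK κ s)) • A by module, hk, one_smul]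
  · rw [← cA s, ← cB s]
    generalize X (t + s) = A
    generalize deriv X (t + s) = B
    rw [show (-(curv κ * sinK κ s)) • (cosK κ s • A - sinK κ s • B)
      + cosK κ s • ((curv κ * sinK κ s) • A + cosK κ s • B) =
      (cosK κ s * cosK κ s + curv κ * (sinK κ s * sinK κ s)) • B by module, hk, one_smul]

theorem HasDerivAt.form {X Y : ℝ → R4} {X' Y' : R4} {t : ℝ} (hX : HasDerivAt X X' t)
    (hY : HasDerivAt Y Y' t) :
    HasDerivAt (fun t => OuterBilliard.form κ (X t) (Y t))
      (OuterBilliard.form κ X' (Y t) + OuterBilliard.form κ (X t) Y') t := by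
  have h1 := hasDerivAt_pi.1 hX
  have h2 := hasDerivAt_pi.1 hY
  refine ((((((h1 0).mul (h2 0)).const_mul (curv κ)).add ((h1 1).mul (h2 1))).add
    ((h1 2).mul (h2 2))).add ((h1 3).mul (h2 3))).congr_deriv ?_
  simp only [OuterBilliard.form]; ring

theorem form_deriv_of_const {X Y : ℝ → R4} (hX : ContDiff ℝ ∞ X) (hY : ContDiff ℝ ∞ Y) {c : ℝ}
    (h : ∀ t, form κ (X t) (Y t) = c) (t : ℝ) :
    form κ (deriv X t) (Y t) + form κ (X t) (deriv Y t) = 0 := by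
  have h1 := HasDerivAt.form (κ := κ) (hX.differentiable (by simp) t).hasDerivAt
    (hY.differentiable (by simp) t).hasDerivAt
  have h2 : (fun t => form κ (X t) (Y t)) = fun _ => c := funext h
  rw [h2] at h1
  exact h1.unique (hasDerivAt_const t c)

namespace UnitGeodesic

theorem contDiff_deriv (γ : UnitGeodesic κ) : ContDiff ℝ ∞ (deriv γ.toFun) :=
  (contDiff_infty_iff_deriv.1 γ.smooth).2

theorem form_self (γ : UnitGeodesic κ) (t : ℝ) : form κ (γ t) (γ t) = curv κ := (γ.mem t).1

theorem form_deriv (γ : UnitGeodesic κ) (t : ℝ) : form κ (γ t) (deriv γ t) = 0 := by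
  have := form_deriv_of_const γ.smooth γ.smooth γ.form_self t
  rw [form_comm κ (deriv γ t)] at this
  linarith

theorem deriv_deriv (γ : UnitGeodesic κ) (t : ℝ) : deriv (deriv γ.toFun) t = -curv κ • γ t := by
  have h1 := form_deriv_of_const γ.smooth γ.contDiff_deriv γ.form_deriv t
  rw [γ.unit_speed] at h1
  have h2 := γ.geodesic t
  simp only [covD, tangentProj] at h2
  rw [form_comm κ _ (γ t), show form κ (γ t) (deriv (deriv γ.toFun) t) = -1 by linarith] at h2
  rw [sub_eq_zero.1 h2]; module

/-- Position and velocity of a geodesic. -/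
def frame (γ : UnitGeodesic κ) (t : ℝ) : unitTangent κ :=
  ⟨(γ t, deriv γ t), γ.mem t, γ.form_deriv t, γ.unit_speed t⟩

theorem add_apply (γ : UnitGeodesic κ) (t s : ℝ) :
    γ (t + s) = cosK κ s • γ t + sinK κ s • deriv γ t :=
  (harmonic γ.smooth γ.deriv_deriv t s).1

theorem deriv_add_apply (γ : UnitGeodesic κ) (t s : ℝ) :
    deriv γ (t + s) = (-(curv κ * sinK κ s)) • γ t + cosK κ s • deriv γ t :=
  (harmonic γ.smooth γ.deriv_deriv t s).2

theorem ext_frame {γ σ : UnitGeodesic κ} (t : ℝ) (h : γ.frame t = σ.frame t) : γ = σ := by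
  have h' := congrArg Subtype.val h
  simp only [frame, Prod.mk.injEq] at h'
  ext1
  funext s
  have := γ.add_apply t (s - t)
  rw [h'.1, h'.2, ← σ.add_apply] at this
  simpa using this

end UnitGeodesic

theorem geodesicOf_apply (z : unitTangent κ) (t : ℝ) :
    geodesicOf z t = cosK κ t • z.1.1 + sinK κ t • z.1.2 := rfl

theorem frame_geodesicOf (z : unitTangent κ) : (geodesicOf z).frame 0 = z := by
  have h : HasDerivAt (geodesicOf z).toFun
      ((-(curv κ * sinK κ 0)) • z.1.1 + cosK κ 0 • z.1.2) 0 :=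
    ((hasDerivAt_cosK κ 0).smul_const _).add ((hasDerivAt_sinK κ 0).smul_const _)
  apply Subtype.ext
  simp only [UnitGeodesic.frame, h.deriv]
  simp [geodesicOf_apply, cosK_zero, sinK_zero]

theorem geodesicOf_zero (z : unitTangent κ) : geodesicOf z 0 = z.1.1 :=
  congrArg (fun z => z.1.1) (frame_geodesicOf z)

theorem deriv_geodesicOf_zero (z : unitTangent κ) : deriv (geodesicOf z) 0 = z.1.2 :=
  congrArg (fun z => z.1.2) (frame_geodesicOf z)

theorem geodesicOf_frame (γ : UnitGeodesic κ) (c t : ℝ) :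
    geodesicOf (γ.frame c) t = γ (c + t) := by
  rw [γ.add_apply]; rfl

theorem cls_eq_iff {γ σ : UnitGeodesic κ} : γ.cls = σ.cls ↔ ∃ c, ∀ t, σ t = γ (t + c) :=
  Quotient.eq (r := geodesicSetoid κ)

theorem cls_geodesicOf_frame (γ : UnitGeodesic κ) (c : ℝ) : (geodesicOf (γ.frame c)).cls = γ.cls :=
  (cls_eq_iff.2 ⟨c, fun t => by rw [geodesicOf_frame, add_comm]⟩).symm

theorem deriv_of_shift {γ σ : UnitGeodesic κ} {c : ℝ} (h : ∀ t, σ t = γ (t + c)) (t : ℝ) :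
    deriv σ t = deriv γ (t + c) := by
  have : σ.toFun = fun t => γ (t + c) := funext h
  rw [this]
  exact deriv_comp_add_const γ.toFun c t

theorem cls_eq_iff_frame {γ σ : UnitGeodesic κ} (s : ℝ) :
    γ.cls = σ.cls ↔ ∃ c, γ.frame c = σ.frame s := by
  constructor
  · intro h
    obtain ⟨c, h⟩ := cls_eq_iff.1 h
    refine ⟨s + c, Subtype.ext ?_⟩
    simp only [UnitGeodesic.frame]
    rw [h, deriv_of_shift h]
  · rintro ⟨c, h⟩
    rw [← cls_geodesicOf_frame γ c, h, cls_geodesicOf_frame]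

theorem cls_surjective (ℓ : OrientedGeodesic κ) : ∃ γ : UnitGeodesic κ, γ.cls = ℓ :=
  Quotient.exists_rep ℓ

/-- The volume spanned by `x`, `y` and the plane of a geodesic does not depend on the parameter. -/
theorem vol_frame (γ : UnitGeodesic κ) (x y : R4) (t s : ℝ) :
    vol x y (γ t) (deriv γ t) = vol x y (γ s) (deriv γ s) := by
  obtain ⟨c, rfl⟩ : ∃ c, t = s + c := ⟨t - s, by ring⟩
  rw [γ.add_apply, γ.deriv_add_apply, vol_combination]
  linear_combination (vol x y (γ s) (deriv γ s)) * cosK_sq_add κ c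

theorem neg_one_ne_one : ((-1 : ℤˣ) = 1) = False := by decide

theorem exists_cosK_sinK {a b : ℝ} (h : a * a + curv κ * (b * b) = 1) (ha : κ = -1 → 0 < a) :
    ∃ t, cosK κ t = a ∧ sinK κ t = b := by
  rcases Int.units_eq_one_or κ with rfl | rfl
  · simp only [curv] at h
    simp only [cosK, sinK, if_true]
    have hz : ‖(⟨a, b⟩ : ℂ)‖ = 1 := by
      rw [Complex.norm_def, Complex.normSq_mk]
      rw [show a * a + b * b = 1 by simpa using h]; simp
    have hz0 : (⟨a, b⟩ : ℂ) ≠ 0 := fun h0 => by rw [h0] at hz; simp at hz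
    exact ⟨Complex.arg ⟨a, b⟩, by rw [Complex.cos_arg hz0, hz]; simp,
      by rw [Complex.sin_arg, hz]; simp⟩
  · simp only [curv] at h
    push_cast at h
    simp only [cosK, sinK, neg_one_ne_one, if_false]
    refine ⟨Real.arsinh b, ?_, Real.sinh_arsinh b⟩
    rw [Real.cosh_arsinh, show 1 + b ^ 2 = a ^ 2 by linarith, Real.sqrt_sq (ha rfl).le]

/-- The points of `space κ` in the plane of a geodesic lie on the geodesic. -/
theorem UnitGeodesic.mem_range_of_plane (γ : UnitGeodesic κ) {t a b : ℝ}
    (h : a • γ t + b • deriv γ t ∈ space κ) : a • γ t + b • deriv γ t ∈ range γ.toFun := by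
  have hab : a * a + curv κ * (b * b) = 1 := by
    have := h.1
    rw [form_lin, γ.form_self, γ.form_deriv, γ.unit_speed] at this
    linear_combination curv κ * this - (a * a - 1) * curv_mul_self κ
  have ha : κ = -1 → 0 < a := by
    rintro rfl
    by_contra hneg
    have hab' : -a * -a + curv (-1) * (-b * -b) = 1 := by linarith
    have ha0 : 0 < -a := by
      rcases (not_lt.1 hneg).lt_or_eq with h0 | h0
      · linarith
      · rw [h0] at hab; simp [curv] at hab; nlinarith
    obtain ⟨s, h1, h2⟩ := exists_cosK_sinK hab' (fun _ => ha0)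
    have h3 := (γ.mem (t + s)).2 rfl
    rw [γ.add_apply, h1, h2] at h3
    have h4 := h.2 rfl
    simp only [Pi.add_apply, Pi.smul_apply, smul_eq_mul] at h3 h4
    linarith
  obtain ⟨s, h1, h2⟩ := exists_cosK_sinK hab ha
  exact ⟨t + s, by rw [γ.add_apply, h1, h2]⟩

/-- Vectors `p, u, v` with `(u, v)` a frame are independent unless `p` is in the plane of the
frame. -/
theorem exists_vol_ne_zero {u v p : R4} (hz : (u, v) ∈ unitTangent κ)
    (hp : ∀ a b : ℝ, p ≠ a • u + b • v) : ∃ x, vol p x u v ≠ 0 := by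
  by_contra! hcon
  obtain ⟨x, hx⟩ : ∃ x, x ∉ Submodule.span ℝ (range ![p, u, v]) := by
    by_contra! hall
    have htop : Submodule.span ℝ (range ![p, u, v]) = ⊤ := by
      rw [eq_top_iff]; exact fun x _ => hall x
    have := finrank_range_le_card (R := ℝ) ![p, u, v]
    rw [Set.finrank, htop, finrank_top] at this
    simp at this
  obtain ⟨r, hr, hr0⟩ := exists_dependence (hcon x)
  have hp' : p ∈ Submodule.span ℝ (range ![p, u, v]) := Submodule.subset_span ⟨0, rfl⟩
  have hu' : u ∈ Submodule.span ℝ (range ![p, u, v]) := Submodule.subset_span ⟨1, rfl⟩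
  have hv' : v ∈ Submodule.span ℝ (range ![p, u, v]) := Submodule.subset_span ⟨2, rfl⟩
  have h1 : r 1 = 0 := by
    by_contra h1
    apply hx
    have : x = -(r 1)⁻¹ • (r 0 • p + r 2 • u + r 3 • v) := by
      have : r 0 • p + r 2 • u + r 3 • v = -(r 1 • x) := by
        rw [eq_neg_iff_add_eq_zero, ← hr0]; abel
      rw [this, smul_neg, neg_smul, neg_neg, smul_smul, inv_mul_cancel₀ h1, one_smul]
    rw [this]
    exact Submodule.smul_mem _ _ (Submodule.add_mem _ (Submodule.add_mem _
      (Submodule.smul_mem _ _ hp') (Submodule.smul_mem _ _ hu')) (Submodule.smul_mem _ _ hv'))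
  have h0 : r 0 = 0 := by
    by_contra h0
    apply hp (-(r 0)⁻¹ * r 2) (-(r 0)⁻¹ * r 3)
    have : r 2 • u + r 3 • v = -(r 0 • p) := by
      rw [eq_neg_iff_add_eq_zero, ← hr0, h1]; module
    rw [mul_smul, mul_smul, ← smul_add, this, smul_neg, neg_smul, neg_neg, smul_smul,
      inv_mul_cancel₀ h0, one_smul]
  rw [h0, h1] at hr0
  have e : r 2 • u + r 3 • v = 0 := by rw [← hr0]; module
  have e1 := congrArg (form κ u) e
  have e2 := congrArg (form κ v) e
  obtain ⟨⟨k1, -⟩, k2, k3⟩ := hz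
  simp only [form_add_right, form_smul_right, form_zero_right, form_comm κ v u] at e1 e2
  simp only at k1 k2 k3
  rw [k1, k2] at e1
  rw [k2, k3] at e2
  apply hr
  funext i
  have h2 : r 2 = 0 := by simpa [curv_ne_zero] using e1
  have h3 : r 3 = 0 := by simpa using e2
  fin_cases i <;> simp [h0, h1, h2, h3]

/-! ### Local parametrizations of surfaces -/

/-- The inverse function theorem, with an inverse that is smooth on its whole domain. -/
theorem exists_smooth_local_inverse {E F : Type*} [NormedAddCommGroup E] [NormedSpace ℝ E]
    [NormedAddCommGroup F] [NormedSpace ℝ F] [CompleteSpace E] {H : E → F}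
    (hH : ContDiff ℝ ∞ H) {a : E} (e : E ≃L[ℝ] F) (he : HasFDerivAt H (e : E →L[ℝ] F) a) :
    ∃ f : OpenPartialHomeomorph E F, (f : E → F) = H ∧ a ∈ f.source ∧
      ContDiffOn ℝ ∞ f.symm f.target := by
  have ho : IsOpen {x | fderiv ℝ H x ∈ range ((↑) : (E ≃L[ℝ] F) → E →L[ℝ] F)} :=
    ContinuousLinearEquiv.isOpen.preimage (hH.continuous_fderiv (by simp))
  set f₀ := hH.contDiffAt.toOpenPartialHomeomorph H he (by simp) with hf₀
  have hc : (f₀ : E → F) = H := rfl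
  refine ⟨f₀.restrOpen _ ho, rfl,
    ⟨hH.contDiffAt.mem_toOpenPartialHomeomorph_source he (by simp), ?_⟩,
    fun y hy => ?_⟩
  · exact ⟨e, he.fderiv.symm⟩
  · have hs := (f₀.restrOpen _ ho).map_target hy
    obtain ⟨e', he'⟩ := hs.2
    refine (OpenPartialHomeomorph.contDiffAt_symm (f₀.restrOpen _ ho) hy (f₀' := e') ?_
      ?_).contDiffWithinAt
    · rw [he']
      exact (hH.differentiable (by simp) _).hasFDerivAt
    · exact hH.contDiffAt

/-- A linear bijection `R4 → ℝ² × ℝ²` whose first component is a prescribed surjection. -/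
theorem exists_linear_completion (L : R4 →ₗ[ℝ] ℝ × ℝ) (hL : Function.Surjective L) :
    ∃ A : R4 →ₗ[ℝ] ℝ × ℝ, Function.Bijective (L.prod A) := by
  have h1 := L.finrank_range_add_finrank_ker
  rw [LinearMap.range_eq_top.2 hL, finrank_top] at h1
  simp at h1
  have e : LinearMap.ker L ≃ₗ[ℝ] ℝ × ℝ := LinearEquiv.ofFinrankEq _ _ (by simp; omega)
  obtain ⟨A, hA⟩ := (LinearMap.ker L).subtype.exists_leftInverse_of_injective
    (LinearMap.ker_eq_bot.2 (LinearMap.ker L).injective_subtype)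
  refine ⟨e.toLinearMap ∘ₗ A, ?_⟩
  have hinj : Function.Injective (L.prod (e.toLinearMap ∘ₗ A)) := by
    rw [injective_iff_map_eq_zero]
    intro x hx
    replace hx : L x = 0 ∧ e (A x) = 0 := Prod.mk_eq_zero.1 hx
    rw [LinearEquiv.map_eq_zero_iff] at hx
    have := LinearMap.congr_fun hA ⟨x, hx.1⟩
    simp only [LinearMap.comp_apply, Submodule.subtype_apply, hx.2, LinearMap.id_apply] at this
    exact (congrArg Subtype.val this).symm
  exact ⟨hinj, (LinearMap.injective_iff_surjective_of_finrank_eq_finrank (by simp)).1 hinj⟩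

theorem hasFDerivAt_form_self (p : R4) :
    HasFDerivAt (fun x => form κ x x) ((2 : ℝ) • formL κ p) p := by
  have hs : ContDiff ℝ ∞ fun x : R4 => form κ x x := by simp only [form]; fun_prop
  have hd := (hs.differentiable (by simp) p).hasFDerivAt
  refine hd.congr_fderiv (ContinuousLinearMap.ext fun w => ?_)
  have hl : HasDerivAt (fun t : ℝ => p + t • w) w 0 := by
    simpa using ((hasDerivAt_id (0 : ℝ)).smul_const w).const_add p
  have h1 := HasDerivAt.form (κ := κ) hl hl
  have h2 : HasDerivAt (fun t : ℝ => form κ (p + t • w) (p + t • w))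
      (fderiv ℝ (fun x => form κ x x) p w) 0 := by
    have hd' : HasFDerivAt (fun x => form κ x x) (fderiv ℝ (fun x => form κ x x) p)
      (p + (0 : ℝ) • w) := by simpa using hd
    exact hd'.comp_hasDerivAt (0 : ℝ) hl
  have := h1.unique h2
  simp only [zero_smul, add_zero] at this
  rw [← this, form_comm κ w p, smul_apply, formL_apply, smul_eq_mul, two_mul]

/-- The periodic reparametrization `y ↦ c + ε (sin y₁, sin y₂)` of a neighbourhood of `c`; it makes
local parametrizations global. -/
def sinePlane (c : ℝ × ℝ) (ε : ℝ) (y : ℝ × ℝ) : ℝ × ℝ :=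
  (c.1 + ε * Real.sin y.1, c.2 + ε * Real.sin y.2)

theorem contDiff_sinePlane (c : ℝ × ℝ) (ε : ℝ) : ContDiff ℝ ∞ (sinePlane c ε) := by
  unfold sinePlane; fun_prop

theorem sinePlane_mem_ball (c : ℝ × ℝ) {ε : ℝ} (hε : 0 < ε) (y : ℝ × ℝ) :
    sinePlane c ε y ∈ Metric.ball c (2 * ε) := by
  rw [Metric.mem_ball, Prod.dist_eq, max_lt_iff]
  have h : ∀ t, |ε * Real.sin t| < 2 * ε := fun t => by
    rw [abs_mul, abs_of_pos hε]
    nlinarith [Real.abs_sin_le_one t]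
  simp only [sinePlane, Real.dist_eq, add_sub_cancel_left]
  exact ⟨h _, h _⟩

theorem hasStrictDerivAt_sine (a ε : ℝ) :
    HasStrictDerivAt (fun t => a + ε * Real.sin t) ε 0 := by
  simpa using ((Real.hasStrictDerivAt_sin 0).const_mul ε).const_add a

theorem hasFDerivAt_sinePlane (c : ℝ × ℝ) (ε : ℝ) :
    HasFDerivAt (sinePlane c ε) (ε • ContinuousLinearMap.id ℝ (ℝ × ℝ)) 0 := by
  have h1 : HasFDerivAt (fun y : ℝ × ℝ => c.1 + ε * Real.sin y.1)
      (ε • ContinuousLinearMap.fst ℝ ℝ ℝ) 0 :=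
    (hasStrictDerivAt_sine c.1 ε).hasDerivAt.comp_hasFDerivAt_of_eq (0 : ℝ × ℝ) hasFDerivAt_fst rfl
  have h2 : HasFDerivAt (fun y : ℝ × ℝ => c.2 + ε * Real.sin y.2)
      (ε • ContinuousLinearMap.snd ℝ ℝ ℝ) 0 :=
    (hasStrictDerivAt_sine c.2 ε).hasDerivAt.comp_hasFDerivAt_of_eq (0 : ℝ × ℝ) hasFDerivAt_snd rfl
  exact h1.prodMk h2

theorem map_sinePlane_nhds (c : ℝ × ℝ) {ε : ℝ} (hε : ε ≠ 0) :
    map (sinePlane c ε) (𝓝 0) = 𝓝 c := by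
  have h1 := (hasStrictDerivAt_sine c.1 ε).map_nhds_eq hε
  have h2 := (hasStrictDerivAt_sine c.2 ε).map_nhds_eq hε
  simp only [Real.sin_zero, mul_zero, add_zero] at h1 h2
  rw [show (0 : ℝ × ℝ) = (0, 0) from rfl, nhds_prod_eq, show c = (c.1, c.2) from rfl,
    nhds_prod_eq, ← h1, ← h2, Filter.prod_map_map_eq]
  rfl

/-- Near each of its points, a surface is parametrized by a smooth immersion of the plane; the
parametrization can be defined on the whole plane, with values in the surface. -/
theorem exists_chart {S : Set R4} (hS : IsSurface κ S) {p : R4} (hp : p ∈ S) :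
    ∃ φ : ℝ × ℝ → R4, ContDiff ℝ ∞ φ ∧ (∀ y, φ y ∈ S) ∧ φ 0 = p ∧
      Function.Injective (fderiv ℝ φ 0) ∧ 𝓝[S] p ≤ map φ (𝓝 0) := by
  obtain ⟨f, hf, ⟨w, hw, hfw⟩, hloc⟩ := hS.2 p hp
  have hps := hS.1 hp
  have hform : ContDiff ℝ ∞ fun x : R4 => form κ x x := by simp only [form]; fun_prop
  set L : R4 →L[ℝ] ℝ × ℝ := ((2 : ℝ) • formL κ p).prod (fderiv ℝ f p) with hLdef
  have hL : Function.Surjective L := by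
    rintro ⟨a, b⟩
    have hk := curv_mul_self κ
    refine ⟨(a / 2 * curv κ) • p + ((b - a / 2 * curv κ * fderiv ℝ f p p) / fderiv ℝ f p w) • w, ?_⟩
    simp only [hLdef, ContinuousLinearMap.prod_apply, map_add, map_smul, formL_apply,
      smul_apply, hw, hps.1, smul_eq_mul, Prod.smul_mk, Prod.mk_add_mk, Prod.mk.injEq]
    constructor
    · linear_combination a * hk
    · field_simp; ring
  obtain ⟨A, hA⟩ := exists_linear_completion L.toLinearMap hL
  let e : R4 ≃L[ℝ] (ℝ × ℝ) × (ℝ × ℝ) :=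
    (LinearEquiv.ofBijective (L.toLinearMap.prod A) hA).toContinuousLinearEquiv
  let A' : R4 →L[ℝ] ℝ × ℝ := A.toContinuousLinearMap
  let H : R4 → (ℝ × ℝ) × (ℝ × ℝ) := fun x => ((form κ x x, f x), A' x)
  have hH : ContDiff ℝ ∞ H := (hform.prodMk hf).prodMk A'.contDiff
  have he : HasFDerivAt H (e : R4 →L[ℝ] (ℝ × ℝ) × (ℝ × ℝ)) p :=
    (((hasFDerivAt_form_self p).prodMk (hf.differentiable (by simp) p).hasFDerivAt).prodMk
      A'.hasFDerivAt)
  obtain ⟨g, hg, hgp, hgs⟩ := exists_smooth_local_inverse hH e he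
  have hpos : ∀ᶠ x in 𝓝 p, κ = -1 → 0 < x 0 := by
    by_cases hκ : κ = -1
    · have ht : Tendsto (fun x : R4 => x 0) (𝓝 p) (𝓝 (p 0)) :=
        (continuous_apply (0 : Fin 4)).tendsto p
      filter_upwards [ht.eventually_const_lt (hps.2 hκ)] with x hx _ using hx
    · exact Eventually.of_forall fun x h => absurd h hκ
  have hfp : f p = 0 := ((hloc.self_of_nhds).1 hp).2
  set c := A' p with hc
  have hHp : H p = ((curv κ, 0), c) := by simp only [H, hps.1, hfp, hc]
  have hgt : ((curv κ, (0 : ℝ)), c) ∈ g.target := by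
    rw [← hHp, ← hg]; exact g.map_source hgp
  have hgp' : g.symm ((curv κ, 0), c) = p := by
    rw [← hHp, ← hg]; exact g.left_inv hgp
  -- the points of the slice near `c` are mapped to the surface
  have hgood : ∀ᶠ y in 𝓝 c, ((curv κ, (0 : ℝ)), y) ∈ g.target ∧
      (g.symm ((curv κ, 0), y) ∈ S ↔ g.symm ((curv κ, 0), y) ∈ space κ ∧
        f (g.symm ((curv κ, 0), y)) = 0) ∧ (κ = -1 → 0 < g.symm ((curv κ, 0), y) 0) := by
    have hi : Tendsto (fun y : ℝ × ℝ => ((curv κ, (0 : ℝ)), y)) (𝓝 c)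
        (𝓝 ((curv κ, (0 : ℝ)), c)) := by
      exact (Continuous.prodMk_right (curv κ, (0 : ℝ))).tendsto c
    have hs : Tendsto g.symm (𝓝 ((curv κ, (0 : ℝ)), c)) (𝓝 p) := by
      have := g.symm.continuousAt (x := ((curv κ, (0 : ℝ)), c)) hgt
      rwa [ContinuousAt, hgp'] at this
    exact (hi.eventually (g.open_target.mem_nhds hgt)).and
      (((hs.comp hi).eventually hloc).and ((hs.comp hi).eventually hpos))
  obtain ⟨ε', hε', hball⟩ := Metric.eventually_nhds_iff_ball.1 hgood
  obtain ⟨ε, hε, rfl⟩ : ∃ ε > 0, ε' = 2 * ε := ⟨ε' / 2, by positivity, by ring⟩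
  let φ : ℝ × ℝ → R4 := fun y => g.symm ((curv κ, 0), sinePlane c ε y)
  have hHφ : ∀ y, H (φ y) = ((curv κ, 0), sinePlane c ε y) := fun y => by
    rw [← hg]; exact g.right_inv (hball _ (sinePlane_mem_ball c hε y)).1
  have hφs : ContDiff ℝ ∞ φ := by
    rw [← contDiffOn_univ]
    refine hgs.comp ((contDiff_const.prodMk (contDiff_sinePlane c ε)).contDiffOn) fun y _ => ?_
    exact (hball _ (sinePlane_mem_ball c hε y)).1
  have hφ0 : φ 0 = p := by
    simp only [φ]
    rw [show sinePlane c ε 0 = c by simp [sinePlane]]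
    exact hgp'
  refine ⟨φ, hφs, fun y => ?_, hφ0, ?_, ?_⟩
  · have hb := hball _ (sinePlane_mem_ball c hε y)
    have hy := hHφ y
    simp only [H, Prod.mk.injEq] at hy
    exact hb.2.1.2 ⟨⟨hy.1.1, hb.2.2⟩, hy.1.2⟩
  · rw [injective_iff_map_eq_zero]
    intro y hy
    have h1 : HasFDerivAt (fun y => A' (φ y)) (A'.comp (fderiv ℝ φ 0)) 0 :=
      A'.hasFDerivAt.comp 0 (hφs.differentiable (by simp) 0).hasFDerivAt
    have h2 : (fun y => A' (φ y)) = sinePlane c ε :=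
      funext fun y => congrArg Prod.snd (hHφ y)
    rw [h2] at h1
    have h3 := congrArg (fun l => l y) (h1.unique (hasFDerivAt_sinePlane c ε))
    simp only [ContinuousLinearMap.comp_apply, hy, map_zero, smul_apply,
      ContinuousLinearMap.id_apply] at h3
    exact (smul_eq_zero.1 h3.symm).resolve_left hε.ne'
  · intro U hU
    rw [mem_map] at hU
    have hV : sinePlane c ε '' (φ ⁻¹' U) ∈ 𝓝 c := by
      rw [← map_sinePlane_nhds c hε.ne']; exact image_mem_map hU
    have hV' : ∀ᶠ x in 𝓝 p, A' x ∈ sinePlane c ε '' (φ ⁻¹' U) :=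
      A'.continuous.continuousAt.eventually hV
    filter_upwards [nhdsWithin_le_nhds hV', nhdsWithin_le_nhds hloc, self_mem_nhdsWithin,
      nhdsWithin_le_nhds (g.open_source.mem_nhds hgp)] with x h1 h2 h3 h4
    obtain ⟨y, hy, hyx⟩ := h1
    have hx := h2.1 h3
    have : φ y = x := by
      have hHx : H x = ((curv κ, 0), sinePlane c ε y) := by
        simp only [H, hx.1.1, hx.2, hyx]
      simp only [φ]
      rw [← hHx, ← hg]; exact g.left_inv h4
    rwa [mem_preimage, this] at hy

/-! ### Tangent planes and one-sidedness -/

theorem abs_form_le (x y : R4) : |form κ x y| ≤ 4 * (‖x‖ * ‖y‖) := by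
  have hc : |curv κ| = 1 := by
    have := curv_mul_self κ
    rw [← abs_mul_abs_self] at this
    nlinarith [abs_nonneg (curv κ)]
  have h : ∀ i, |x i * y i| ≤ ‖x‖ * ‖y‖ := fun i => by
    rw [abs_mul]
    exact mul_le_mul (norm_le_pi_norm x i) (norm_le_pi_norm y i) (abs_nonneg _) (norm_nonneg _)
  have h0 : |curv κ * (x 0 * y 0)| ≤ ‖x‖ * ‖y‖ := by rw [abs_mul, hc, one_mul]; exact h 0
  simp only [form]
  have a1 := abs_add_le (curv κ * (x 0 * y 0) + x 1 * y 1 + x 2 * y 2) (x 3 * y 3)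
  have a2 := abs_add_le (curv κ * (x 0 * y 0) + x 1 * y 1) (x 2 * y 2)
  have a3 := abs_add_le (curv κ * (x 0 * y 0)) (x 1 * y 1)
  linarith [h 1, h 2, h 3]

theorem form_eq_zero_of_mem_tangentSpace {S : Set R4} (hS : S ⊆ space κ) {p w : R4}
    (hw : w ∈ tangentSpace S p) : form κ p w = 0 := by
  obtain ⟨c, hc, hcS, rfl, rfl⟩ := hw
  have hd := (hc.differentiable (by simp) 0).hasDerivAt
  have h1 := HasDerivAt.form (κ := κ) hd hd
  have h2 : HasDerivAt (fun t => form κ (c t) (c t)) 0 0 :=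
    (hasDerivAt_const (0 : ℝ) (curv κ)).congr_of_eventuallyEq
      (hcS.mono fun t ht => (hS ht).1)
  have := h1.unique h2
  rw [form_comm κ (deriv c 0)] at this
  linarith

theorem fderiv_mem_tangentSpace {S : Set R4} {φ : ℝ × ℝ → R4} (hφ : ContDiff ℝ ∞ φ)
    (hφS : ∀ y, φ y ∈ S) (y a : ℝ × ℝ) : fderiv ℝ φ y a ∈ tangentSpace S (φ y) := by
  refine ⟨fun t => φ (y + t • a), by fun_prop, Eventually.of_forall fun t => hφS _, by simp, ?_⟩
  have hl : HasDerivAt (fun t : ℝ => y + t • a) a 0 := by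
    simpa using ((hasDerivAt_id (0 : ℝ)).smul_const a).const_add y
  exact ((hφ.differentiable (by simp) y).hasFDerivAt.comp_hasDerivAt_of_eq (0 : ℝ) hl
    (by simp)).deriv

/-- The vectors orthogonal to `p` and `n` form a plane. -/
theorem finrank_ker_pair {p n : R4} (hp : form κ p p = curv κ) (hn : form κ n n = 1)
    (hpn : form κ p n = 0) :
    Module.finrank ℝ (LinearMap.ker ((formL κ p).prod (formL κ n)).toLinearMap) = 2 := by
  set L := ((formL κ p).prod (formL κ n)).toLinearMap with hLdef
  have hL : Function.Surjective L := by
    rintro ⟨a, b⟩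
    refine ⟨(a * curv κ) • p + b • n, ?_⟩
    have hk := curv_mul_self κ
    simp only [hLdef, ContinuousLinearMap.coe_prod, LinearMap.prod_apply, Function.prod,
      ContinuousLinearMap.coe_coe, map_add, map_smul, formL_apply, hp, hn, hpn,
      form_comm κ n p, Prod.smul_mk, Prod.mk_add_mk, smul_eq_mul,
      Prod.mk.injEq]
    constructor
    · linear_combination a * hk
    · ring
  have h1 := L.finrank_range_add_finrank_ker
  rw [LinearMap.range_eq_top.2 hL, finrank_top] at h1
  simp at h1
  omega

theorem mem_range_fderiv_chart {S : Set R4} (hS : S ⊆ space κ) {φ : ℝ × ℝ → R4}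
    (hφ : ContDiff ℝ ∞ φ) (hφS : ∀ y, φ y ∈ S) (hinj : Function.Injective (fderiv ℝ φ 0))
    {n : R4} (hn : IsUnitNormal κ S (φ 0) n) {w : R4} (h1 : form κ (φ 0) w = 0)
    (h2 : form κ n w = 0) : ∃ y, fderiv ℝ φ 0 y = w := by
  have hle : LinearMap.range (fderiv ℝ φ 0).toLinearMap ≤
      LinearMap.ker ((formL κ (φ 0)).prod (formL κ n)).toLinearMap := by
    rintro _ ⟨y, rfl⟩
    have ht := fderiv_mem_tangentSpace hφ hφS 0 y
    exact Prod.mk_eq_zero.2 ⟨form_eq_zero_of_mem_tangentSpace hS ht, hn.2.2 _ ht⟩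
  have heq := Submodule.eq_of_le_of_finrank_eq hle (by
    rw [finrank_ker_pair (hS (hφS 0)).1 hn.2.1 hn.1,
      LinearMap.finrank_range_of_inj (f := (fderiv ℝ φ 0).toLinearMap) hinj]
    simp)
  have hw : w ∈ LinearMap.ker ((formL κ (φ 0)).prod (formL κ n)).toLinearMap :=
    Prod.mk_eq_zero.2 ⟨h1, h2⟩
  rw [← heq] at hw
  exact hw

theorem tangentSpace_eq {S : Set R4} (hS : IsSurface κ S) {p n : R4} (hp : p ∈ S)
    (hn : IsUnitNormal κ S p n) :
    tangentSpace S p = {w | form κ p w = 0 ∧ form κ n w = 0} := by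
  ext w
  constructor
  · exact fun hw => ⟨form_eq_zero_of_mem_tangentSpace hS.1 hw, hn.2.2 w hw⟩
  · rintro ⟨h1, h2⟩
    obtain ⟨φ, hφ, hφS, rfl, hinj, -⟩ := exists_chart hS hp
    obtain ⟨y, rfl⟩ := mem_range_fderiv_chart hS.1 hφ hφS hinj hn h1 h2
    exact fderiv_mem_tangentSpace hφ hφS 0 y

theorem mem_tangentSurface_iff {S : Set R4} (hS : IsSurface κ S) {p n : R4} (hp : p ∈ S)
    (hn : IsUnitNormal κ S p n) (x : R4) :
    x ∈ tangentSurface κ S p ↔ x ∈ space κ ∧ form κ n x = 0 := by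
  have hpp : form κ p p = curv κ := (hS.1 hp).1
  simp only [tangentSurface, tangentSpace_eq hS hp hn, mem_ofPred_eq]
  refine and_congr_right fun hx => ⟨?_, fun h => ?_⟩
  · rintro ⟨a, w, ⟨h1, h2⟩, rfl⟩
    rw [form_add_right, form_smul_right, h2, form_comm κ n, hn.1]; ring
  · refine ⟨curv κ * form κ p x, x - (curv κ * form κ p x) • p, ⟨?_, ?_⟩, by abel⟩
    · rw [form_sub_right, form_smul_right, hpp]
      linear_combination (-form κ p x) * curv_mul_self κ
    · rw [form_sub_right, form_smul_right, h, form_comm κ n, hn.1]; ring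

theorem form_tangentProj {p w : R4} (x : R4) (hw : form κ p w = 0) :
    form κ (tangentProj κ p x) w = form κ x w := by
  rw [tangentProj, form_sub_left, form_smul_left, hw]; ring

theorem IsUnitNormal.neg {S : Set R4} {p n : R4} (h : IsUnitNormal κ S p n) :
    IsUnitNormal κ S p (-n) := by
  refine ⟨?_, ?_, fun w hw => ?_⟩
  · rw [form_neg_right, h.1, neg_zero]
  · rw [form_neg_left, form_neg_right, h.2.1, neg_neg]
  · rw [form_neg_left, h.2.2 w hw, neg_zero]

/-- Near each point of a surface with definite shape operator there is a unit normal field with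
negative definite differential. -/
theorem exists_normal_field {S : Set R4} (hS : S ⊆ space κ) (hdef : HasDefiniteShape κ S) {p : R4}
    (hp : p ∈ S) : ∃ N : R4 → R4, ContDiff ℝ ∞ N ∧ (∀ᶠ q in 𝓝[S] p, IsUnitNormal κ S q (N q)) ∧
      ∀ w ∈ tangentSpace S p, w ≠ 0 → form κ (fderiv ℝ N p w) w < 0 := by
  obtain ⟨N, hN, hNn, h⟩ := hdef p hp
  have key : ∀ w ∈ tangentSpace S p, form κ (shapeOperator κ N p w) w =
      -form κ (fderiv ℝ N p w) w := fun w hw => by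
    rw [shapeOperator, form_neg_left,
      form_tangentProj _ (form_eq_zero_of_mem_tangentSpace hS hw)]
  rcases h with h | h
  · refine ⟨N, hN, hNn, fun w hw hw0 => ?_⟩
    have := h w hw hw0
    rw [key w hw] at this
    linarith
  · refine ⟨fun x => -N x, hN.neg, hNn.mono fun q hq => hq.neg, fun w hw hw0 => ?_⟩
    have := h w hw hw0
    rw [key w hw] at this
    rw [fderiv_fun_neg, neg_apply, form_neg_left]
    linarith

theorem eventually_chart {S : Set R4} {φ : ℝ × ℝ → R4} (hφ : ContDiff ℝ ∞ φ)
    (hφS : ∀ y, φ y ∈ S) {P : R4 → Prop} (h : ∀ᶠ q in 𝓝[S] (φ 0), P q) :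
    ∀ᶠ y in 𝓝 (0 : ℝ × ℝ), P (φ y) := by
  have : Tendsto φ (𝓝 0) (𝓝[S] (φ 0)) :=
    tendsto_nhdsWithin_iff.2 ⟨hφ.continuous.tendsto 0, Eventually.of_forall hφS⟩
  exact this.eventually h

theorem quadratic_lower_bound {Q : ℝ × ℝ → ℝ} (hQ : Continuous Q)
    (hhom : ∀ (r : ℝ) y, Q (r • y) = r ^ 2 * Q y) (hpos : ∀ y, y ≠ 0 → 0 < Q y) :
    ∃ c > 0, ∀ y, c * ‖y‖ ^ 2 ≤ Q y := by
  have hne : (Metric.sphere (0 : ℝ × ℝ) 1).Nonempty := NormedSpace.sphere_nonempty.2 zero_le_one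
  obtain ⟨y₀, hy₀, hmin⟩ := (isCompact_sphere (0 : ℝ × ℝ) 1).exists_isMinOn hne hQ.continuousOn
  have hy₀0 : y₀ ≠ 0 := by
    rintro rfl; simp at hy₀
  refine ⟨Q y₀, hpos _ hy₀0, fun y => ?_⟩
  by_cases hy : y = 0
  · subst hy
    have := hhom 0 0
    simp at this
    simp [this]
  · have hn : ‖y‖ ≠ 0 := norm_ne_zero_iff.2 hy
    have h1 : ‖y‖⁻¹ • y ∈ Metric.sphere (0 : ℝ × ℝ) 1 := by
      rw [mem_sphere_zero_iff_norm, norm_smul, norm_inv, norm_norm, inv_mul_cancel₀ hn]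
    have h2 : Q y₀ ≤ Q (‖y‖⁻¹ • y) := hmin h1
    rw [hhom] at h2
    have : Q y = ‖y‖ ^ 2 * (‖y‖⁻¹ ^ 2 * Q y) := by field_simp
    rw [this, mul_comm]
    gcongr

/-- A surface with definite shape operator lies locally strictly on one side of its tangent
hyperplane. -/
theorem eventually_form_pos {S : Set R4} {φ : ℝ × ℝ → R4} (hφ : ContDiff ℝ ∞ φ)
    (hφS : ∀ y, φ y ∈ S) (hinj : Function.Injective (fderiv ℝ φ 0)) {N : R4 → R4}
    (hN : ContDiff ℝ ∞ N) (hNn : ∀ᶠ q in 𝓝[S] (φ 0), IsUnitNormal κ S q (N q))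
    (hneg : ∀ w ∈ tangentSpace S (φ 0), w ≠ 0 → form κ (fderiv ℝ N (φ 0) w) w < 0) :
    ∀ᶠ y in 𝓝 (0 : ℝ × ℝ), y ≠ 0 → 0 < form κ (N (φ 0)) (φ y) := by
  set A := fderiv ℝ φ 0 with hA
  set M' := (fderiv ℝ N (φ 0)).comp A with hM'
  have hM : HasFDerivAt (fun y => N (φ y)) M' 0 :=
    (hN.differentiable (by simp) (φ 0)).hasFDerivAt.comp 0
      (hφ.differentiable (by simp) 0).hasFDerivAt
  obtain ⟨c, hc, hQ⟩ := quadratic_lower_bound (Q := fun y => -form κ (M' y) (A y))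
    (continuous_form κ M'.continuous A.continuous).neg
    (fun r y => by simp only [map_smul, form_smul_left, form_smul_right]; ring)
    (fun y hy => by
      have := hneg (A y) (fderiv_mem_tangentSpace hφ hφS 0 y)
        (fun h => hy (hinj (by rw [h, map_zero])))
      simpa [hM'] using this)
  obtain ⟨η, hη, hηc⟩ : ∃ η > 0, 4 * η * (‖A‖ + η) + 4 * ‖M'‖ * η < c := by
    have ht : Tendsto (fun η : ℝ => 4 * η * (‖A‖ + η) + 4 * ‖M'‖ * η) (𝓝[>] 0) (𝓝 0) := by
      have : Continuous fun η : ℝ => 4 * η * (‖A‖ + η) + 4 * ‖M'‖ * η := by fun_prop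
      simpa using (this.tendsto 0).mono_left nhdsWithin_le_nhds
    obtain ⟨η, h1, h2⟩ := ((ht.eventually_lt_const hc).and self_mem_nhdsWithin).exists
    exact ⟨η, h2, h1⟩
  have e1 : ∀ᶠ y in 𝓝 (0 : ℝ × ℝ), ‖N (φ y) - N (φ 0) - M' y‖ ≤ η * ‖y‖ := by
    have := (hasFDerivAt_iff_isLittleO.1 hM).def hη
    simpa using this
  have e2 : ∀ᶠ y in 𝓝 (0 : ℝ × ℝ), ‖fderiv ℝ φ y - A‖ < η := by
    have ht : Tendsto (fderiv ℝ φ) (𝓝 0) (𝓝 A) :=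
      (hφ.continuous_fderiv (by simp)).tendsto 0
    have := (tendsto_iff_norm_sub_tendsto_zero.1 ht).eventually_lt_const hη
    exact this
  have e3 := eventually_chart hφ hφS hNn
  have hk : ∀ᶠ y in 𝓝 (0 : ℝ × ℝ), y ≠ 0 → 0 < form κ (N (φ 0)) (fderiv ℝ φ y y) := by
    filter_upwards [e1, e2, e3] with y h1 h2 h3 hy
    have horth : form κ (N (φ y)) (fderiv ℝ φ y y) = 0 :=
      h3.2.2 _ (fderiv_mem_tangentSpace hφ hφS y y)
    set R := N (φ y) - N (φ 0) - M' y with hR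
    set D := fderiv ℝ φ y - A with hD
    have hDy : fderiv ℝ φ y y = A y + D y := by simp [hD]
    have hN0 : N (φ 0) = N (φ y) - R - M' y := by rw [hR]; abel
    have hsplit : form κ (N (φ 0)) (fderiv ℝ φ y y) =
        -form κ R (A y + D y) - form κ (M' y) (D y) - form κ (M' y) (A y) := by
      rw [hN0, form_sub_left, form_sub_left, horth, hDy, form_add_right κ (M' y)]; ring
    have hyp : 0 < ‖y‖ := norm_pos_iff.2 hy
    have n1 : ‖A y‖ ≤ ‖A‖ * ‖y‖ := A.le_opNorm y
    have n2 : ‖D y‖ ≤ η * ‖y‖ := (D.le_opNorm y).trans (by gcongr)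
    have n3 : ‖M' y‖ ≤ ‖M'‖ * ‖y‖ := M'.le_opNorm y
    have n4 : ‖A y + D y‖ ≤ (‖A‖ + η) * ‖y‖ := (norm_add_le _ _).trans (by linarith)
    have b1 := abs_form_le (κ := κ) R (A y + D y)
    have b2 := abs_form_le (κ := κ) (M' y) (D y)
    have b3 : ‖R‖ * ‖A y + D y‖ ≤ (η * ‖y‖) * ((‖A‖ + η) * ‖y‖) := by gcongr
    have b4 : ‖M' y‖ * ‖D y‖ ≤ (‖M'‖ * ‖y‖) * (η * ‖y‖) := by gcongr
    have q := hQ y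
    have hlt : (4 * η * (‖A‖ + η) + 4 * ‖M'‖ * η) * ‖y‖ ^ 2 < c * ‖y‖ ^ 2 := by gcongr
    rw [hsplit]
    have c1 := (abs_le.1 b1).2
    have c2 := (abs_le.1 b2).2
    nlinarith
  obtain ⟨ε, hε, hball⟩ := Metric.eventually_nhds_iff_ball.1 hk
  filter_upwards [Metric.ball_mem_nhds (0 : ℝ × ℝ) hε] with y hy hy0
  have hd : ∀ t : ℝ, HasDerivAt (fun t : ℝ => form κ (N (φ 0)) (φ (t • y)))
      (form κ (N (φ 0)) (fderiv ℝ φ (t • y) y)) t := fun t => by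
    have hl : HasDerivAt (fun t : ℝ => t • y) y t := by
      simpa using (hasDerivAt_id t).smul_const y
    exact (formL κ (N (φ 0))).hasFDerivAt.comp_hasDerivAt t
      ((hφ.differentiable (by simp) (t • y)).hasFDerivAt.comp_hasDerivAt t hl)
  have hmono : StrictMonoOn (fun t : ℝ => form κ (N (φ 0)) (φ (t • y))) (Icc 0 1) := by
    refine strictMonoOn_of_deriv_pos (convex_Icc 0 1)
      (fun t _ => (hd t).continuousAt.continuousWithinAt) fun t ht => ?_
    rw [interior_Icc] at ht
    rw [(hd t).deriv]
    have hmem : t • y ∈ Metric.ball (0 : ℝ × ℝ) ε := by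
      rw [mem_ball_zero_iff, norm_smul, Real.norm_eq_abs, abs_of_pos ht.1]
      rw [mem_ball_zero_iff] at hy
      nlinarith [ht.1, ht.2, norm_nonneg y]
    have := hball _ hmem (smul_ne_zero ht.1.ne' hy0)
    rw [map_smul, form_smul_right] at this
    exact pos_of_mul_pos_right this ht.1.le
  have := hmono (left_mem_Icc.2 zero_le_one) (right_mem_Icc.2 zero_le_one) zero_lt_one
  simp only [zero_smul, one_smul] at this
  have h0 := e3.self_of_nhds.1
  rw [form_comm] at h0
  rwa [h0] at this

/-! ### The inward Gauss map of a quadratically convex surface -/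

theorem hasDerivAt_comp_line {E F : Type*} [NormedAddCommGroup E] [NormedSpace ℝ E]
    [NormedAddCommGroup F] [NormedSpace ℝ F] {g : E → F} {g' : E →L[ℝ] F} {y : E}
    (hg : HasFDerivAt g g' y) (a : E) : HasDerivAt (fun t : ℝ => g (y + t • a)) (g' a) 0 := by
  have hl : HasDerivAt (fun t : ℝ => y + t • a) a 0 := by
    simpa using ((hasDerivAt_id (0 : ℝ)).smul_const a).const_add y
  exact hg.comp_hasDerivAt_of_eq (0 : ℝ) hl (by simp)

theorem eventually_line {E : Type*} [NormedAddCommGroup E] [NormedSpace ℝ E] {P : E → Prop} {y : E}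
    (h : ∀ᶠ x in 𝓝 y, P x) (a : E) : ∀ᶠ t in 𝓝 (0 : ℝ), P (y + t • a) := by
  have : Tendsto (fun t : ℝ => y + t • a) (𝓝 0) (𝓝 y) := by
    have hc : Continuous fun t : ℝ => y + t • a := by fun_prop
    simpa using hc.tendsto 0
  exact this.eventually h

theorem exists_ne_of_chart {S : Set R4} {φ : ℝ × ℝ → R4}
    (hφS : ∀ y, φ y ∈ S) (hinj : Function.Injective (fderiv ℝ φ 0)) (p : R4) :
    ∃ x ∈ S, x ≠ p := by
  by_contra! hcon
  have hconst : φ = fun _ => p := funext fun y => hcon _ (hφS y)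
  have h1 : fderiv ℝ φ 0 = 0 := by rw [hconst]; simp
  have : ((1 : ℝ), (0 : ℝ)) = 0 := hinj (by rw [h1]; simp)
  simp at this

/-- A quadratically convex surface lies strictly on one side of its tangent hyperplane: the side
is constant near the point of tangency by definiteness, hence on the whole connected surface. -/
theorem form_pos_of_connected {S : Set R4} (hS : IsSurface κ S) (hconn : IsConnected S)
    (hconvex : IsStrictlyConvex κ S) {p : R4} (hp : p ∈ S) {N : R4 → R4} (hN : ContDiff ℝ ∞ N)
    (hNn : ∀ᶠ q in 𝓝[S] p, IsUnitNormal κ S q (N q))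
    (hneg : ∀ w ∈ tangentSpace S p, w ≠ 0 → form κ (fderiv ℝ N p w) w < 0) {x : R4}
    (hx : x ∈ S) (hxp : x ≠ p) : 0 < form κ (N p) x := by
  obtain ⟨φ, hφ, hφS, rfl, hinj, hmap⟩ := exists_chart hS hp
  have hn : IsUnitNormal κ S (φ 0) (N (φ 0)) := hNn.self_of_nhdsWithin hp
  have hloc : ∀ᶠ q in 𝓝[S] (φ 0), 0 ≤ form κ (N (φ 0)) q := by
    refine Eventually.filter_mono hmap (eventually_map.2 ?_)
    filter_upwards [eventually_form_pos hφ hφS hinj hN hNn hneg] with y hy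
    by_cases h0 : y = 0
    · subst h0
      rw [form_comm, hn.1]
    · exact (hy h0).le
  have hzero : ∀ y ∈ S, form κ (N (φ 0)) y = 0 → y = φ 0 := fun y hy h0 => by
    have : y ∈ tangentSurface κ S (φ 0) ∩ S :=
      ⟨(mem_tangentSurface_iff hS hp hn y).2 ⟨hS.1 hy, h0⟩, hy⟩
    rw [hconvex _ hp] at this
    exact this
  obtain ⟨O, hO, hpO, hOS⟩ := mem_nhdsWithin.1 hloc
  have hcont : Continuous fun y => form κ (N (φ 0)) y :=
    continuous_form κ continuous_const continuous_id
  by_contra! hle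
  have hlt : form κ (N (φ 0)) x < 0 := lt_of_le_of_ne hle fun h0 => hxp (hzero x hx h0)
  obtain ⟨y, hyS, hy1, hy2⟩ := hconn.isPreconnected {y | form κ (N (φ 0)) y < 0}
    ({y | 0 < form κ (N (φ 0)) y} ∪ O) (isOpen_lt hcont continuous_const)
    ((isOpen_lt continuous_const hcont).union hO)
    (fun y hy => by
      rcases lt_trichotomy (form κ (N (φ 0)) y) 0 with h | h | h
      · exact Or.inl h
      · rw [hzero y hy h]; exact Or.inr (Or.inr hpO)
      · exact Or.inr (Or.inl h))
    ⟨x, hx, hlt⟩ ⟨φ 0, hp, Or.inr hpO⟩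
  rw [mem_ofPred_eq] at hy1
  rcases hy2 with h | h
  · rw [mem_ofPred_eq] at h
    exact lt_asymm hy1 h
  · have h2 := hOS ⟨h, hyS⟩
    rw [mem_ofPred_eq] at h2
    exact not_lt.2 h2 hy1

/-- The properties of the inward unit normal `ν` of a quadratically convex surface. In a chart `φ`
around a point, `ν` extends to a smooth field `N` whose differential is symmetric and definite. -/
structure IsGaussMap (κ : ℤˣ) (S : Set R4) (ν : R4 → R4) : Prop where
  subset : S ⊆ space κ
  form_self : ∀ p ∈ S, form κ (ν p) (ν p) = 1
  form_point : ∀ p ∈ S, form κ (ν p) p = 0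
  mem_tangentSpace : ∀ p ∈ S, ∀ w, w ∈ tangentSpace S p ↔ form κ p w = 0 ∧ form κ (ν p) w = 0
  form_pos : ∀ p ∈ S, ∀ x ∈ S, x ≠ p → 0 < form κ (ν p) x
  exists_ne : ∀ p, ∃ x ∈ S, x ≠ p
  exists_local : ∀ p ∈ S, ∃ (φ : ℝ × ℝ → R4) (N : R4 → R4), ContDiff ℝ ∞ φ ∧ (∀ y, φ y ∈ S) ∧
    φ 0 = p ∧ Function.Injective (fderiv ℝ φ 0) ∧ ContDiff ℝ ∞ N ∧
    (∀ᶠ q in 𝓝[S] p, N q = ν q) ∧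
    (∀ w ∈ tangentSpace S p, w ≠ 0 → form κ (fderiv ℝ N p w) w ≠ 0) ∧
    (∀ w ∈ tangentSpace S p, form κ (fderiv ℝ N p w) p = 0) ∧
    ∀ w ∈ tangentSpace S p, ∀ w' ∈ tangentSpace S p,
      form κ (fderiv ℝ N p w) w' = form κ (fderiv ℝ N p w') w

/-- The differential of a unit normal field is symmetric, because second derivatives of a chart
are. -/
theorem form_fderiv_normal_symm {S : Set R4} {φ : ℝ × ℝ → R4} (hφ : ContDiff ℝ ∞ φ)
    (hφS : ∀ y, φ y ∈ S) {N : R4 → R4} (hN : ContDiff ℝ ∞ N)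
    (hNn : ∀ᶠ q in 𝓝[S] (φ 0), IsUnitNormal κ S q (N q)) (a b : ℝ × ℝ) :
    form κ (fderiv ℝ N (φ 0) (fderiv ℝ φ 0 a)) (fderiv ℝ φ 0 b) =
      form κ (fderiv ℝ N (φ 0) (fderiv ℝ φ 0 b)) (fderiv ℝ φ 0 a) := by
  have hd : ∀ a b, form κ (fderiv ℝ N (φ 0) (fderiv ℝ φ 0 a)) (fderiv ℝ φ 0 b) +
      form κ (N (φ 0)) (fderiv ℝ (fderiv ℝ φ) 0 a b) = 0 := by
    intro a b
    have hM : HasFDerivAt (fun y => N (φ y)) ((fderiv ℝ N (φ 0)).comp (fderiv ℝ φ 0)) 0 :=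
      (hN.differentiable (by simp) (φ 0)).hasFDerivAt.comp 0
        (hφ.differentiable (by simp) 0).hasFDerivAt
    have h1 := hasDerivAt_comp_line hM a
    have hφ' : ContDiff ℝ ∞ (fderiv ℝ φ) := hφ.fderiv_right (by simp)
    have h2 := hasDerivAt_comp_line (hφ'.differentiable (by simp) 0).hasFDerivAt a
    have h3 : HasDerivAt (fun t : ℝ => fderiv ℝ φ (0 + t • a) b)
        (fderiv ℝ (fderiv ℝ φ) 0 a b) 0 :=
      ((ContinuousLinearMap.apply ℝ R4 b).hasFDerivAt).comp_hasDerivAt (0 : ℝ) h2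
    have h4 := HasDerivAt.form (κ := κ) h1 h3
    have h5 : HasDerivAt (fun t : ℝ => form κ (N (φ (0 + t • a))) (fderiv ℝ φ (0 + t • a) b)) 0 0 :=
      (hasDerivAt_const (0 : ℝ) (0 : ℝ)).congr_of_eventuallyEq
        ((eventually_line (eventually_chart hφ hφS hNn) a).mono fun t ht =>
          ht.2.2 _ (fderiv_mem_tangentSpace hφ hφS _ b))
    have := h4.unique h5
    simpa using this
  have hsymm : fderiv ℝ (fderiv ℝ φ) 0 a b = fderiv ℝ (fderiv ℝ φ) 0 b a :=
    ((contDiff_infty.1 hφ 2).contDiffAt.isSymmSndFDerivAt (by simp)) a b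
  have h1 := hd a b
  have h2 := hd b a
  rw [hsymm] at h1
  linarith

theorem form_fderiv_normal_point {S : Set R4} {φ : ℝ × ℝ → R4} (hφ : ContDiff ℝ ∞ φ)
    (hφS : ∀ y, φ y ∈ S) {N : R4 → R4} (hN : ContDiff ℝ ∞ N)
    (hNn : ∀ᶠ q in 𝓝[S] (φ 0), IsUnitNormal κ S q (N q)) (a : ℝ × ℝ) :
    form κ (fderiv ℝ N (φ 0) (fderiv ℝ φ 0 a)) (φ 0) = 0 := by
  have hφd := (hφ.differentiable (by simp) 0).hasFDerivAt
  have h1 := hasDerivAt_comp_line (((hN.differentiable (by simp) (φ 0)).hasFDerivAt).comp 0 hφd) a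
  have h4 := HasDerivAt.form (κ := κ) h1 (hasDerivAt_comp_line hφd a)
  have h5 : HasDerivAt (fun t : ℝ => form κ ((N ∘ φ) (0 + t • a)) (φ (0 + t • a))) 0 0 :=
    (hasDerivAt_const (0 : ℝ) (0 : ℝ)).congr_of_eventuallyEq
      ((eventually_line (eventually_chart hφ hφS hNn) a).mono fun t ht => by
        have := ht.1
        rwa [form_comm] at this)
  have := h4.unique h5
  have h0 := (eventually_chart hφ hφS hNn).self_of_nhds.2.2 _ (fderiv_mem_tangentSpace hφ hφS 0 a)
  simpa [h0] using this

/-- Unit normals at the same point agree up to sign, which is fixed by a point `x` on their positive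
side. -/
theorem IsUnitNormal.eq_of_form_nonneg {S : Set R4} (hS : IsSurface κ S) {p n m x : R4} (hp : p ∈ S)
    (hn : IsUnitNormal κ S p n) (hm : IsUnitNormal κ S p m) (hnx : 0 < form κ n x)
    (hmx : 0 ≤ form κ m x) : m = n := by
  have hpp : form κ p p = curv κ := (hS.1 hp).1
  have e : m = form κ n m • n := by
    rw [← sub_eq_zero]
    refine eq_zero_of_form κ fun y => ?_
    set w := y - (curv κ * form κ p y) • p - form κ n y • n with hw
    have hwt : w ∈ tangentSpace S p := by
      rw [tangentSpace_eq hS hp hn]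
      constructor
      · simp only [hw, form_sub_right, form_smul_right, hpp, hn.1]
        linear_combination (-form κ p y) * curv_mul_self κ
      · simp only [hw, form_sub_right, form_smul_right, form_comm κ n p, hn.2.1, hn.1]
        ring
    have h1 := hm.2.2 w hwt
    have h2 := hn.2.2 w hwt
    simp only [hw, form_sub_right, form_smul_right, form_comm κ m p, form_comm κ m n, hm.1] at h1
    rw [form_sub_left, form_smul_left]
    linarith
  have h1 := hm.2.1
  rw [e, form_smul_left, form_smul_right, hn.2.1] at h1
  have h2 : 0 ≤ form κ n m := by
    rw [e, form_smul_left] at hmx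
    exact nonneg_of_mul_nonneg_left hmx hnx
  have h3 : form κ n m = 1 := by nlinarith
  rw [e, h3, one_smul]

theorem exists_gaussMap {S : Set R4} (hS : IsSurface κ S) (hconn : IsConnected S)
    (hconvex : IsQuadraticallyConvex κ S) :
    ∃ ν, IsGaussMap κ S ν := by
  have hfield : ∀ p ∈ S, ∃ N : R4 → R4, ContDiff ℝ ∞ N ∧
      (∀ᶠ q in 𝓝[S] p, IsUnitNormal κ S q (N q)) ∧
      (∀ w ∈ tangentSpace S p, w ≠ 0 → form κ (fderiv ℝ N p w) w < 0) ∧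
      ∀ x ∈ S, x ≠ p → 0 < form κ (N p) x := fun p hp => by
    obtain ⟨N, h1, h2, h3⟩ := exists_normal_field hS.1 hconvex.2 hp
    exact ⟨N, h1, h2, h3, fun x hx hxp =>
      form_pos_of_connected hS hconn hconvex.1 hp h1 h2 h3 hx hxp⟩
  have hpt : ∀ p : R4, ∃ n, p ∈ S → IsUnitNormal κ S p n ∧ ∀ x ∈ S, x ≠ p → 0 < form κ n x :=
    fun p => by
      by_cases hp : p ∈ S
      · obtain ⟨N, -, h2, -, h4⟩ := hfield p hp
        exact ⟨N p, fun _ => ⟨h2.self_of_nhdsWithin hp, h4⟩⟩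
      · exact ⟨0, fun h => absurd h hp⟩
  choose ν hν using hpt
  have hne : ∀ p, ∃ x ∈ S, x ≠ p := fun p => by
    obtain ⟨q, hq⟩ := hconn.nonempty
    obtain ⟨φ, hφ, hφS, -, hinj, -⟩ := exists_chart hS hq
    exact exists_ne_of_chart hφS hinj p
  refine ⟨ν, hS.1, fun p hp => (hν p hp).1.2.1, fun p hp => ?_, fun p hp w => ?_,
    fun p hp => (hν p hp).2, hne, fun p hp => ?_⟩
  · rw [form_comm]; exact (hν p hp).1.1
  · rw [tangentSpace_eq hS hp (hν p hp).1]; rfl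
  · obtain ⟨N, h1, h2, h3, h4⟩ := hfield p hp
    obtain ⟨φ, hφ, hφS, rfl, hinj, -⟩ := exists_chart hS hp
    obtain ⟨x₀, hx₀, hx₀p⟩ := hne (φ 0)
    have hT : ∀ w ∈ tangentSpace S (φ 0), ∃ a, fderiv ℝ φ 0 a = w := fun w hw => by
      rw [tangentSpace_eq hS hp (hν _ hp).1] at hw
      exact mem_range_fderiv_chart hS.1 hφ hφS hinj (hν _ hp).1 hw.1 hw.2
    refine ⟨φ, N, hφ, hφS, rfl, hinj, h1, ?_, fun w hw hw0 => (h3 w hw hw0).ne, fun w hw => ?_,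
      fun w hw w' hw' => ?_⟩
    · have hpos : ∀ᶠ q in 𝓝 (φ 0), 0 < form κ (N q) x₀ := by
        have hc : Continuous fun q => form κ (N q) x₀ :=
          continuous_form κ h1.continuous continuous_const
        exact (hc.tendsto (φ 0)).eventually_const_lt (h4 x₀ hx₀ hx₀p)
      filter_upwards [h2, self_mem_nhdsWithin, nhdsWithin_le_nhds hpos,
        nhdsWithin_le_nhds (isOpen_ne.mem_nhds hx₀p.symm)] with q hq hqS hq0 hqx
      exact (hν q hqS).1.eq_of_form_nonneg hS hqS hq ((hν q hqS).2 x₀ hx₀ hqx.symm) hq0.le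
    · obtain ⟨a, rfl⟩ := hT w hw
      exact form_fderiv_normal_point hφ hφS h1 h2 a
    · obtain ⟨a, rfl⟩ := hT w hw
      obtain ⟨b, rfl⟩ := hT w' hw'
      exact form_fderiv_normal_symm hφ hφS h1 h2 a b

variable {S : Set R4} {ν : R4 → R4}

/-! ### The tangent hyperplanes through a geodesic -/

/-- `p` is the point `p₊` where a tangent hyperplane containing the plane of the frame `z` touches
`S`: the one for which the frame, the point and the inward normal are positively oriented. The other
tangent point `p₋` is obtained from the reversed frame `(z.1, -z.2)`. -/
structure IsTangentAt (κ : ℤˣ) (S : Set R4) (ν : R4 → R4) (z : R4 × R4) (p : R4) : Prop where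
  mem : p ∈ S
  form_fst : form κ (ν p) z.1 = 0
  form_snd : form κ (ν p) z.2 = 0
  vol_pos : 0 < vol p (ν p) z.1 z.2

namespace IsTangentAt

variable {z : R4 × R4} {p q : R4}

theorem vol_eq_mul (hν : IsGaussMap κ S ν) (hp : p ∈ S) (h1 : form κ (ν p) z.1 = 0)
    (h2 : form κ (ν p) z.2 = 0) (x : R4) :
    vol p x z.1 z.2 = vol p (ν p) z.1 z.2 * form κ (ν p) x :=
  vol_eq_mul_form (hν.form_self p hp) (hν.form_point p hp) h1 h2 x

theorem vol_pos_of_ne (hν : IsGaussMap κ S ν) (h : IsTangentAt κ S ν z p) {x : R4} (hx : x ∈ S)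
    (hxp : x ≠ p) : 0 < vol p x z.1 z.2 := by
  rw [vol_eq_mul hν h.mem h.form_fst h.form_snd]
  exact mul_pos h.vol_pos (hν.form_pos p h.mem x hx hxp)

theorem unique (hν : IsGaussMap κ S ν) (hp : IsTangentAt κ S ν z p) (hq : IsTangentAt κ S ν z q) :
    p = q := by
  by_contra hne
  have h1 := hp.vol_pos_of_ne hν hq.mem (Ne.symm hne)
  have h2 := hq.vol_pos_of_ne hν hp.mem hne
  rw [vol_swap_one_two] at h2
  linarith

theorem ne_combination (h : IsTangentAt κ S ν z p) (a b : ℝ) : p ≠ a • z.1 + b • z.2 := by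
  intro he
  have h1 := h.vol_pos
  have : ∀ n u v : R4, vol (a • u + b • v) n u v = 0 := fun n u v => by
    simp only [vol_eq, Pi.add_apply, Pi.smul_apply, smul_eq_mul]; ring
  have h0 := this (ν p) z.1 z.2
  rw [← he] at h0
  linarith

theorem of_combination (h : IsTangentAt κ S ν z p) {a b c d : ℝ} (hdet : 0 < a * d - b * c) :
    IsTangentAt κ S ν (a • z.1 + b • z.2, c • z.1 + d • z.2) p := by
  refine ⟨h.mem, ?_, ?_, ?_⟩
  · simp only [form_add_right, form_smul_right, h.form_fst, h.form_snd]; ring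
  · simp only [form_add_right, form_smul_right, h.form_fst, h.form_snd]; ring
  · rw [vol_combination]; exact mul_pos hdet h.vol_pos

theorem frame_change {γ : UnitGeodesic κ} {t : ℝ} (h : IsTangentAt κ S ν (γ.frame t).1 p) (s : ℝ) :
    IsTangentAt κ S ν (γ.frame s).1 p := by
  obtain ⟨c, rfl⟩ : ∃ c, s = t + c := ⟨s - t, by ring⟩
  have := h.of_combination (a := cosK κ c) (b := sinK κ c) (c := -(curv κ * sinK κ c))
    (d := cosK κ c) (by linarith [cosK_sq_add κ c])
  simpa only [UnitGeodesic.frame, γ.add_apply, γ.deriv_add_apply] using this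

theorem refl (hν : IsGaussMap κ S ν) (h : IsTangentAt κ S ν z p) :
    IsTangentAt κ S ν (refl κ p z.1, refl κ p z.2) p := by
  have hn := hν.form_point p h.mem
  refine ⟨h.mem, ?_, ?_, ?_⟩
  · rw [form_refl_of_orthogonal hn, h.form_fst, neg_zero]
  · rw [form_refl_of_orthogonal hn, h.form_snd, neg_zero]
  · have : ∀ (r s : ℝ) (n u v : R4), vol p n (r • p - u) (s • p - v) = vol p n u v := by
      intro r s n u v
      simp only [vol_eq, Pi.sub_apply, Pi.smul_apply, smul_eq_mul]; ring
    simp only [OuterBilliard.refl, this]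
    exact h.vol_pos

/-- A geodesic with a tangent point does not meet the surface. -/
theorem notMem {γ : UnitGeodesic κ} {t : ℝ} (hν : IsGaussMap κ S ν)
    (h : IsTangentAt κ S ν (γ.frame t).1 p) (s : ℝ) : γ s ∉ S := by
  intro hs
  have h' := h.frame_change s
  by_cases hp : γ s = p
  · exact h'.ne_combination 1 0 (by simp [UnitGeodesic.frame, hp])
  · have h1 := hν.form_pos p h.mem _ hs hp
    have h2 := h'.form_fst
    simp only [UnitGeodesic.frame] at h2
    linarith

end IsTangentAt

namespace IsGaussMap

theorem isUnitNormal (hν : IsGaussMap κ S ν) {p : R4} (hp : p ∈ S) : IsUnitNormal κ S p (ν p) :=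
  ⟨by rw [form_comm]; exact hν.form_point p hp, hν.form_self p hp,
    fun w hw => ((hν.mem_tangentSpace p hp w).1 hw).2⟩

theorem continuousOn (hν : IsGaussMap κ S ν) : ContinuousOn ν S := by
  intro p hp
  obtain ⟨φ, N, -, -, -, -, hN, hNν, -⟩ := hν.exists_local p hp
  exact hN.continuous.continuousWithinAt.congr_of_eventuallyEq
    (hNν.mono fun q hq => hq.symm) (hNν.self_of_nhdsWithin hp).symm

/-- A vector in the closed dual cone of the normals that is orthogonal to one of the normals is a
multiple of the point with this normal. -/
theorem eq_smul_of_minimum (hν : IsGaussMap κ S ν) {p y : R4} (hp : p ∈ S)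
    (h0 : form κ (ν p) y = 0) (hmin : ∀ q ∈ S, 0 ≤ form κ (ν q) y) :
    y = (curv κ * form κ p y) • p := by
  obtain ⟨φ, N, hφ, hφS, rfl, hinj, hN, hNν, hdef, hpt, -⟩ := hν.exists_local p hp
  have hpp := (hν.subset hp).1
  have hcrit : ∀ a, form κ (fderiv ℝ N (φ 0) (fderiv ℝ φ 0 a)) y = 0 := by
    intro a
    have hM : HasFDerivAt (fun y => N (φ y)) ((fderiv ℝ N (φ 0)).comp (fderiv ℝ φ 0)) 0 :=
      (hN.differentiable (by simp) (φ 0)).hasFDerivAt.comp 0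
        (hφ.differentiable (by simp) 0).hasFDerivAt
    have h1 := HasDerivAt.form (κ := κ) (hasDerivAt_comp_line hM a) (hasDerivAt_const (0 : ℝ) y)
    have hlm : IsLocalMin (fun t : ℝ => form κ (N (φ (0 + t • a))) y) 0 := by
      filter_upwards [eventually_line (eventually_chart hφ hφS hNν) a] with t ht
      rw [ht, zero_smul, add_zero, hNν.self_of_nhdsWithin hp, h0]
      exact hmin _ (hφS _)
    have := hlm.hasDerivAt_eq_zero h1
    rw [form_zero_right, add_zero] at this
    exact this
  set w := y - (curv κ * form κ (φ 0) y) • φ 0 with hw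
  have hwT : w ∈ tangentSpace S (φ 0) := by
    rw [hν.mem_tangentSpace _ hp]
    constructor
    · simp only [hw, form_sub_right, form_smul_right, hpp]
      linear_combination (-form κ (φ 0) y) * curv_mul_self κ
    · simp only [hw, form_sub_right, form_smul_right, hν.form_point _ hp, h0]; ring
  by_contra hne
  have hw0 : w ≠ 0 := fun h => hne (sub_eq_zero.1 h)
  -- the tangent plane is the image of the chart
  obtain ⟨a, ha⟩ : ∃ a, fderiv ℝ φ 0 a = w :=
    mem_range_fderiv_chart hν.subset hφ hφS hinj (hν.isUnitNormal hp)
      ((hν.mem_tangentSpace _ hp w).1 hwT).1 ((hν.mem_tangentSpace _ hp w).1 hwT).2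
  apply hdef w hwT hw0
  have h1 := hcrit a
  rw [ha] at h1
  have h2 := hpt w hwT
  calc form κ (fderiv ℝ N (φ 0) w) w
      = form κ (fderiv ℝ N (φ 0) w) y -
          (curv κ * form κ (φ 0) y) * form κ (fderiv ℝ N (φ 0) w) (φ 0) := by
        rw [← form_smul_right, ← form_sub_right]
    _ = 0 := by rw [h1, h2]; ring

/-- If a geodesic misses the surface, its plane meets the closed dual cone of the normals only
in the origin. -/
theorem eq_zero_of_plane (hν : IsGaussMap κ S ν) (hc : IsCompact S) {γ : UnitGeodesic κ}
    (hγ : ∀ t, γ t ∉ S) {a b : ℝ} (h : ∀ p ∈ S, 0 ≤ form κ (ν p) (a • γ 0 + b • deriv γ 0)) :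
    a • γ 0 + b • deriv γ 0 = 0 := by
  -- no boundary point of the cone is in the plane
  have key : ∀ a b : ℝ, (∀ p ∈ S, 0 ≤ form κ (ν p) (a • γ 0 + b • deriv γ 0)) →
      a • γ 0 + b • deriv γ 0 ≠ 0 → ∀ p ∈ S, form κ (ν p) (a • γ 0 + b • deriv γ 0) ≠ 0 := by
    intro a b hab hne p hp h0
    have he := hν.eq_smul_of_minimum hp h0 hab
    set c := curv κ * form κ p (a • γ 0 + b • deriv γ 0)
    have hc0 : c ≠ 0 := fun hc0 => hne (by rw [he, hc0, zero_smul])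
    have hpe : p = (c⁻¹ * a) • γ 0 + (c⁻¹ * b) • deriv γ 0 := by
      rw [mul_smul, mul_smul, ← smul_add, he, smul_smul, inv_mul_cancel₀ hc0, one_smul]
    have hps := hν.subset hp
    rw [hpe] at hps
    obtain ⟨t, ht⟩ := γ.mem_range_of_plane hps
    exact hγ t (by rw [ht, ← hpe]; exact hp)
  by_contra hne
  have hpos : ∀ p ∈ S, 0 < form κ (ν p) (a • γ 0 + b • deriv γ 0) := fun p hp =>
    lt_of_le_of_ne (h p hp) (key a b h hne p hp).symm
  set x := a • γ 0 + b • deriv γ 0 with hx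
  -- `v` is a second vector of the plane, independent of `x`
  set v := (-b) • γ 0 + a • deriv γ 0 with hv
  have hSne : S.Nonempty := let ⟨x, hx, _⟩ := hν.exists_ne 0; ⟨x, hx⟩
  have hcont : ∀ w, ContinuousOn (fun p => form κ (ν p) w) S := fun w => by
    have : Continuous fun n => form κ n w := continuous_form κ continuous_id continuous_const
    exact this.comp_continuousOn hν.continuousOn
  obtain ⟨p, hp, hmin⟩ := hc.exists_isMinOn hSne
    ((hcont v).div (hcont x) fun q hq => (hpos q hq).ne')
  set r := form κ (ν p) v / form κ (ν p) x with hr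
  have hy : v - r • x = (-b - r * a) • γ 0 + (a - r * b) • deriv γ 0 := by
    rw [hv, hx]; module
  have hyq : ∀ q ∈ S, 0 ≤ form κ (ν q) (v - r • x) := fun q hq => by
    have h1 : r ≤ form κ (ν q) v / form κ (ν q) x := hmin hq
    rw [le_div_iff₀ (hpos q hq)] at h1
    rw [form_sub_right, form_smul_right]; linarith
  have hyp : form κ (ν p) (v - r • x) = 0 := by
    rw [form_sub_right, form_smul_right, hr, div_mul_cancel₀ _ (hpos p hp).ne', sub_self]
  have hy0 : v - r • x = 0 := by
    by_contra hy0
    rw [hy] at hyq hyp hy0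
    exact key _ _ hyq hy0 p hp hyp
  rw [hy] at hy0
  have e1 := congrArg (form κ (γ 0)) hy0
  have e2 := congrArg (form κ (deriv γ 0)) hy0
  simp only [form_add_right, form_smul_right, γ.form_self, γ.form_deriv, γ.unit_speed,
    form_zero_right, form_comm κ (deriv γ 0) (γ 0), mul_zero, add_zero, zero_add, mul_one] at e1 e2
  have e3 : -b - r * a = 0 := by simpa [curv_ne_zero] using e1
  have hb : (r * r + 1) * b = 0 := by linear_combination -e3 - r * e2
  have hb0 : b = 0 := by
    rcases mul_eq_zero.1 hb with h1 | h1
    · nlinarith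
    · exact h1
  apply hne
  rw [hx, hb0, show a = 0 by rw [hb0] at e2; linarith]; simp

/-- The plane of a geodesic that misses the surface is separated from the surface by a linear
functional. -/
theorem exists_separating (hν : IsGaussMap κ S ν) (hc : IsCompact S) {γ : UnitGeodesic κ}
    (hγ : ∀ t, γ t ∉ S) : ∃ f : R4 →L[ℝ] ℝ, f (γ 0) = 0 ∧ f (deriv γ 0) = 0 ∧
      ∀ x ∈ S, 0 < f x := by
  have hnonneg : ∀ p ∈ S, ∀ x ∈ S, 0 ≤ form κ (ν p) x := fun p hp x hx => by
    by_cases hxp : x = p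
    · rw [hxp, hν.form_point p hp]
    · exact (hν.form_pos p hp x hx hxp).le
  obtain ⟨p, hp, -⟩ := hν.exists_ne 0
  obtain ⟨q, hq, hqp⟩ := hν.exists_ne p
  have hcompact : IsCompact (closedConvexHull ℝ S) := by
    rw [closedConvexHull_eq_closure_convexHull]
    exact isCompact_iff_totallyBounded_isComplete.2
      ⟨hc.totallyBounded.convexHull.closure, isClosed_closure.isComplete⟩
  have hhalf : ∀ (L : R4 →L[ℝ] ℝ) (c : ℝ), (∀ x ∈ S, c ≤ L x) →
      ∀ x ∈ closedConvexHull ℝ S, c ≤ L x := fun L c h x hx =>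
    closedConvexHull_min (t := {x | c ≤ L x}) (fun x hx => h x hx)
      (convex_halfSpace_ge L.toLinearMap.isLinear c) (isClosed_le continuous_const L.continuous) hx
  -- the sum of two inward normals is positive on the surface, hence on its closed convex hull
  have hhull : ∀ x ∈ closedConvexHull ℝ S, x ≠ 0 := by
    obtain ⟨m, hm, hmin⟩ := hc.exists_isMinOn ⟨p, hp⟩
      (formL κ (ν p + ν q)).continuous.continuousOn
    have hmpos : 0 < formL κ (ν p + ν q) m := by
      rw [formL_apply, form_add_left]
      by_cases hmp : m = p
      · rw [hmp]
        linarith [hν.form_pos q hq p hp hqp.symm, hnonneg p hp p hp]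
      · linarith [hν.form_pos p hp m hm hmp, hnonneg q hq m hm]
    rintro x hx rfl
    have := hhalf (formL κ (ν p + ν q)) _ hmin 0 hx
    rw [map_zero] at this
    exact not_lt.2 this hmpos
  have hhull' : ∀ r ∈ S, ∀ x ∈ closedConvexHull ℝ S, 0 ≤ form κ (ν r) x := fun r hr =>
    hhalf (formL κ (ν r)) 0 (hnonneg r hr)
  let E : Submodule ℝ R4 := Submodule.span ℝ {γ 0, deriv γ 0}
  have hdisj : Disjoint (closedConvexHull ℝ S) (E : Set R4) := by
    rw [Set.disjoint_left]
    intro x hx hxE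
    obtain ⟨a, b, rfl⟩ := Submodule.mem_span_pair.1 hxE
    exact hhull _ hx (hν.eq_zero_of_plane hc hγ fun r hr => hhull' r hr _ hx)
  obtain ⟨f, s, t, hs, hst, ht⟩ := geometric_hahn_banach_compact_closed convex_closedConvexHull
    hcompact E.convex E.closed_of_finiteDimensional hdisj
  -- a functional bounded below on a subspace vanishes there
  have hzero : ∀ x ∈ E, f x = 0 := by
    intro x hx
    by_contra h0
    have := ht _ (E.smul_mem (t / f x) hx)
    rw [map_smul, smul_eq_mul, div_mul_cancel₀ _ h0] at this
    exact lt_irrefl _ this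
  have ht0 : t < 0 := by simpa using ht 0 E.zero_mem
  refine ⟨-f, ?_, ?_, fun x hx => ?_⟩
  · simp [hzero _ (Submodule.subset_span (by simp : γ 0 ∈ ({γ 0, deriv γ 0} : Set R4)))]
  · simp [hzero _ (Submodule.subset_span (by simp : deriv γ 0 ∈ ({γ 0, deriv γ 0} : Set R4)))]
  · have := hs x (subset_closedConvexHull hx)
    simp only [neg_apply]
    linarith

/-- Every geodesic that misses the surface has a tangent point: rotate a separating hyperplane
around the geodesic until it touches the surface. -/
theorem exists_isTangentAt (hν : IsGaussMap κ S ν) (hc : IsCompact S) {γ : UnitGeodesic κ}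
    (hγ : ∀ t, γ t ∉ S) : ∃ p, IsTangentAt κ S ν (γ.frame 0).1 p := by
  obtain ⟨f, hfu, hfv, hfpos⟩ := hν.exists_separating hc hγ
  obtain ⟨e, he, -⟩ := hν.exists_ne 0
  set u := γ 0 with hu
  set v := deriv γ 0 with hv
  obtain ⟨p, hp, hmin⟩ := hc.exists_isMinOn ⟨e, he⟩
    ((volL e u v).continuous.continuousOn.div f.continuous.continuousOn
      fun q hq => (hfpos q hq).ne')
  -- the hyperplane through `p` and the geodesic supports the surface
  have hsupp : ∀ x ∈ S, 0 ≤ vol p x u v := fun x hx => by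
    have h1 : volL e u v p / f p ≤ volL e u v x / f x := hmin hx
    rw [div_le_div_iff₀ (hfpos p hp) (hfpos x hx), volL_apply, volL_apply] at h1
    have h2 := plucker f.toLinearMap hfu hfv e p x
    simp only [ContinuousLinearMap.coe_coe] at h2
    have h3 : 0 ≤ f e * vol p x u v := by rw [h2]; linarith
    exact nonneg_of_mul_nonneg_right h3 (hfpos e he)
  have hpE : ∀ a b : ℝ, p ≠ a • u + b • v := fun a b h => by
    have := hfpos p hp
    rw [h, map_add, map_smul, map_smul, hfu, hfv] at this
    simp at this
  have hpp := (hν.subset hp).1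
  have hself : vol p p u v = 0 := vol_eq_zero_of_eq p u v
  -- the supporting functional vanishes on the tangent plane
  have htan : ∀ w ∈ tangentSpace S p, vol p w u v = 0 := by
    rintro w ⟨c, hcs, hcS, hc0, rfl⟩
    have hd : HasDerivAt (fun t => volL p u v (c t)) (volL p u v (deriv c 0)) 0 :=
      (volL p u v).hasFDerivAt.comp_hasDerivAt (0 : ℝ)
        (hcs.differentiable (by simp) 0).hasDerivAt
    have hlm : IsLocalMin (fun t => volL p u v (c t)) 0 := by
      filter_upwards [hcS] with t ht
      rw [hc0, volL_apply, hself]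
      exact hsupp _ ht
    exact hlm.hasDerivAt_eq_zero hd
  have hform : ∀ x, vol p x u v = vol p (ν p) u v * form κ (ν p) x := by
    intro x
    set w := x - (curv κ * form κ p x) • p - form κ (ν p) x • ν p with hw
    have hwT : w ∈ tangentSpace S p := by
      rw [hν.mem_tangentSpace p hp]
      have h1 := hν.form_point p hp
      constructor
      · simp only [hw, form_sub_right, form_smul_right, hpp, form_comm κ p (ν p), h1]
        linear_combination (-form κ p x) * curv_mul_self κ
      · simp only [hw, form_sub_right, form_smul_right, h1, hν.form_self p hp]
        ring
    have h2 : volL p u v w = 0 := htan w hwT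
    simp only [hw, map_sub, map_smul, volL_apply, hself, smul_eq_mul] at h2
    linarith
  obtain ⟨x, hx⟩ := exists_vol_ne_zero (γ.frame 0).2 hpE
  have hne : vol p (ν p) u v ≠ 0 := fun h => hx (by rw [hform x, h, zero_mul])
  have hker : ∀ x, vol p x u v = 0 → form κ (ν p) x = 0 := fun x h0 => by
    rw [hform] at h0
    exact (mul_eq_zero.1 h0).resolve_left hne
  refine ⟨p, hp, hker u ?_, hker v ?_, lt_of_le_of_ne ?_ hne.symm⟩
  · simp only [vol_eq]; ring
  · simp only [vol_eq]; ring
  · obtain ⟨x, hx, hxp⟩ := hν.exists_ne p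
    have h1 := hsupp x hx
    rw [hform] at h1
    exact nonneg_of_mul_nonneg_left h1 (hν.form_pos p hp x hx hxp)

end IsGaussMap

/-! ### The billiard map as a reflection in the tangent point -/

theorem form_le_neg_one {x y : R4} (hx : x ∈ space (-1)) (hy : y ∈ space (-1)) :
    form (-1) x y ≤ -1 := by
  obtain ⟨h1, h2⟩ := hx
  obtain ⟨k1, k2⟩ := hy
  have h2 := h2 rfl
  have k2 := k2 rfl
  simp only [form, curv] at h1 k1 ⊢
  push_cast at h1 k1 ⊢
  have hcs : (x 1 * y 1 + x 2 * y 2 + x 3 * y 3) ^ 2 ≤ (x 0 ^ 2 - 1) * (y 0 ^ 2 - 1) := by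
    have e2 : x 0 ^ 2 - 1 = x 1 ^ 2 + x 2 ^ 2 + x 3 ^ 2 := by linarith
    have e3 : y 0 ^ 2 - 1 = y 1 ^ 2 + y 2 ^ 2 + y 3 ^ 2 := by linarith
    rw [e2, e3]
    nlinarith [sq_nonneg (x 1 * y 2 - x 2 * y 1), sq_nonneg (x 1 * y 3 - x 3 * y 1),
      sq_nonneg (x 2 * y 3 - x 3 * y 2)]
  have hx1 : 1 ≤ x 0 := by nlinarith [sq_nonneg (x 1), sq_nonneg (x 2), sq_nonneg (x 3)]
  have hy1 : 1 ≤ y 0 := by nlinarith [sq_nonneg (y 1), sq_nonneg (y 2), sq_nonneg (y 3)]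
  have h3 : (x 1 * y 1 + x 2 * y 2 + x 3 * y 3) ^ 2 ≤ (x 0 * y 0 - 1) ^ 2 := by
    nlinarith [sq_nonneg (x 0 - y 0)]
  have h4 := abs_le_of_sq_le_sq' h3 (by nlinarith)
  linarith [h4.2]

theorem refl_mem_space {p x : R4} (hp : p ∈ space κ) (hx : x ∈ space κ) :
    refl κ p x ∈ space κ := by
  have h1 : form κ (refl κ p x) (refl κ p x) = curv κ := by
    rw [form_refl_refl hp.1]; exact hx.1
  refine ⟨h1, ?_⟩
  rintro rfl
  -- otherwise the antipode is on the upper sheet, and its product with `p` has the wrong sign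
  by_contra hneg
  have hne : refl (-1) p x 0 ≠ 0 := fun h0 => by
    simp only [form, curv, h0] at h1
    push_cast at h1
    nlinarith [sq_nonneg (refl (-1) p x 1), sq_nonneg (refl (-1) p x 2),
      sq_nonneg (refl (-1) p x 3)]
  have hanti : -refl (-1) p x ∈ space (-1) :=
    ⟨by rw [form_neg_left, form_neg_right, neg_neg, h1], fun _ => by
      rw [Pi.neg_apply]; linarith [lt_of_le_of_ne (not_lt.1 hneg) hne]⟩
  have h2 := form_le_neg_one hp hanti
  rw [form_neg_right, form_refl hp.1] at h2
  linarith [form_le_neg_one hp hx]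

theorem refl_mem_unitTangent {p : R4} (hp : p ∈ space κ) {z : R4 × R4} (hz : z ∈ unitTangent κ) :
    (refl κ p z.1, refl κ p z.2) ∈ unitTangent κ :=
  ⟨refl_mem_space hp hz.1, by simp only [form_refl_refl hp.1]; exact hz.2.1,
    by simp only [form_refl_refl hp.1]; exact hz.2.2⟩

namespace UnitGeodesic

/-- The image of a geodesic under the geodesic symmetry at `p`. -/
def reflect {p : R4} (hp : p ∈ space κ) (γ : UnitGeodesic κ) : UnitGeodesic κ :=
  geodesicOf ⟨_, refl_mem_unitTangent hp (γ.frame 0).2⟩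

theorem frame_reflect {p : R4} (hp : p ∈ space κ) (γ : UnitGeodesic κ) (t : ℝ) :
    ((γ.reflect hp).frame t).1 = (refl κ p (γ t), refl κ p (deriv γ t)) := by
  have h0 := frame_geodesicOf ⟨_, refl_mem_unitTangent hp (γ.frame 0).2⟩
  have h1 : (γ.reflect hp) 0 = refl κ p (γ 0) := congrArg (fun z => z.1.1) h0
  have h2 : deriv (γ.reflect hp) 0 = refl κ p (deriv γ 0) := congrArg (fun z => z.1.2) h0
  have e1 := (γ.reflect hp).add_apply 0 t
  have e2 := (γ.reflect hp).deriv_add_apply 0 t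
  have e3 := γ.add_apply 0 t
  have e4 := γ.deriv_add_apply 0 t
  rw [zero_add] at e1 e2 e3 e4
  simp only [frame, e1, e2, e3, e4, h1, h2, refl_add, refl_smul]

theorem reflect_apply {p : R4} (hp : p ∈ space κ) (γ : UnitGeodesic κ) (t : ℝ) :
    γ.reflect hp t = refl κ p (γ t) := congrArg Prod.fst (γ.frame_reflect hp t)

theorem reflect_reflect {p : R4} (hp : p ∈ space κ) (γ : UnitGeodesic κ) :
    (γ.reflect hp).reflect hp = γ := by
  ext1
  funext t
  rw [reflect_apply, reflect_apply, refl_refl hp.1]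

theorem reverse_apply (γ : UnitGeodesic κ) (t : ℝ) : γ.reverse t = γ (-t) := rfl

theorem deriv_reverse (γ : UnitGeodesic κ) (t : ℝ) : deriv γ.reverse t = -deriv γ (-t) := by
  change deriv (fun t => γ (-t)) t = _
  rw [deriv_comp_neg]

theorem reverse_reverse (γ : UnitGeodesic κ) : γ.reverse.reverse = γ := by
  ext1
  funext t
  rw [reverse_apply, reverse_apply, neg_neg]

theorem cls_reverse (γ : UnitGeodesic κ) : γ.reverse.cls = γ.cls.reverse := rfl

end UnitGeodesic

theorem OrientedGeodesic.reverse_reverse (ℓ : OrientedGeodesic κ) : ℓ.reverse.reverse = ℓ := by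
  obtain ⟨γ, rfl⟩ := cls_surjective ℓ
  rw [← UnitGeodesic.cls_reverse, ← UnitGeodesic.cls_reverse, UnitGeodesic.reverse_reverse]

theorem cls_reflect_congr {p : R4} (hp : p ∈ space κ) {γ σ : UnitGeodesic κ} (h : γ.cls = σ.cls) :
    (γ.reflect hp).cls = (σ.reflect hp).cls := by
  obtain ⟨c, hc⟩ := cls_eq_iff.1 h
  exact cls_eq_iff.2 ⟨c, fun t => by
    rw [UnitGeodesic.reflect_apply, UnitGeodesic.reflect_apply, hc]⟩

theorem IsTangentAt.congr_cls {γ σ : UnitGeodesic κ} {p : R4} {t : ℝ}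
    (h : IsTangentAt κ S ν (γ.frame t).1 p) (hc : γ.cls = σ.cls) (s : ℝ) :
    IsTangentAt κ S ν (σ.frame s).1 p := by
  obtain ⟨c, hc⟩ := (cls_eq_iff_frame s).1 hc
  rw [← hc]
  exact h.frame_change c

open Classical in
/-- The symmetry of the geodesic `ℓ` in its tangent point `p₊`; geodesics without a tangent point
are left fixed. -/
def reflectMap (κ : ℤˣ) (S : Set R4) (ν : R4 → R4) (ℓ : OrientedGeodesic κ) : OrientedGeodesic κ :=
  if h : ∃ (γ : UnitGeodesic κ) (p : R4), γ.cls = ℓ ∧ p ∈ space κ ∧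
      IsTangentAt κ S ν (γ.frame 0).1 p then
    (h.choose.reflect h.choose_spec.choose_spec.2.1).cls
  else ℓ

theorem reflectMap_cls (hν : IsGaussMap κ S ν) {γ : UnitGeodesic κ} {p : R4} {t : ℝ}
    (h : IsTangentAt κ S ν (γ.frame t).1 p) :
    reflectMap κ S ν γ.cls = (γ.reflect (hν.subset h.mem)).cls := by
  have hex : ∃ (σ : UnitGeodesic κ) (q : R4), σ.cls = γ.cls ∧ q ∈ space κ ∧
      IsTangentAt κ S ν (σ.frame 0).1 q := ⟨γ, p, rfl, hν.subset h.mem, h.frame_change 0⟩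
  rw [reflectMap, dif_pos hex]
  have h1 := hex.choose_spec.choose_spec
  have hq : hex.choose_spec.choose = p :=
    (h1.2.2.congr_cls h1.1 0).unique hν (h.frame_change 0)
  have := cls_reflect_congr h1.2.1 h1.1
  rw [this]
  congr 2

theorem IsTangentAt.frame_reflect (hν : IsGaussMap κ S ν) {γ : UnitGeodesic κ} {p : R4} {t : ℝ}
    (h : IsTangentAt κ S ν (γ.frame t).1 p) :
    IsTangentAt κ S ν ((γ.reflect (hν.subset h.mem)).frame t).1 p := by
  rw [UnitGeodesic.frame_reflect]
  exact h.refl hν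

theorem orthogonal_frame_change {γ : UnitGeodesic κ} {p : R4} {t : ℝ}
    (h : form κ p (γ t) = 0 ∧ form κ p (deriv γ t) = 0) (s : ℝ) :
    form κ p (γ s) = 0 ∧ form κ p (deriv γ s) = 0 := by
  obtain ⟨c, rfl⟩ : ∃ c, s = t + c := ⟨s - t, by ring⟩
  rw [γ.add_apply, γ.deriv_add_apply]
  simp only [form_add_right, form_smul_right, h.1, h.2]
  simp

/-- The Gauss image consists of the geodesics orthogonal to their tangent point `p₊`. -/
theorem cls_mem_gaussImage (hS : IsSurface κ S) (hν : IsGaussMap κ S ν) {γ : UnitGeodesic κ} :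
    γ.cls ∈ gaussImage κ S ↔ ∃ p, IsTangentAt κ S ν (γ.frame 0).1 p ∧
      form κ p (γ 0) = 0 ∧ form κ p (deriv γ 0) = 0 := by
  constructor
  · rintro ⟨p, hp, n, hn, hpos, σ, hσ, h1, h2, hvol⟩
    obtain ⟨x, hx, hxp⟩ := hν.exists_ne p
    obtain rfl : n = ν p := (hν.isUnitNormal hp).eq_of_form_nonneg hS hp hn
      (hν.form_pos p hp x hx hxp) (hpos x hx)
    rw [hν.mem_tangentSpace p hp] at h1 h2
    have ht : IsTangentAt κ S ν (σ.frame 0).1 p := ⟨hp, h1.2, h2.2, hvol⟩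
    obtain ⟨c, hc⟩ := (cls_eq_iff_frame 0).1 hσ
    have h3 := orthogonal_frame_change (γ := σ) ⟨h1.1, h2.1⟩ c
    refine ⟨p, ht.congr_cls hσ 0, ?_⟩
    have hc' := congrArg Subtype.val hc
    simp only [UnitGeodesic.frame, Prod.mk.injEq] at hc'
    rwa [hc'.1, hc'.2] at h3
  · rintro ⟨p, hp, h1, h2⟩
    refine ⟨p, hp.mem, ν p, hν.isUnitNormal hp.mem, fun x hx => ?_, γ, rfl,
      (hν.mem_tangentSpace p hp.mem _).2 ⟨h1, hp.form_fst⟩,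
      (hν.mem_tangentSpace p hp.mem _).2 ⟨h2, hp.form_snd⟩, hp.vol_pos⟩
    by_cases hxp : x = p
    · rw [hxp, hν.form_point p hp.mem]
    · exact (hν.form_pos p hp.mem x hx hxp).le

theorem cls_mem_table (hS : IsSurface κ S) (hν : IsGaussMap κ S ν) (hc : IsCompact S)
    {γ : UnitGeodesic κ} : γ.cls ∈ table κ S ↔ ∃ p, IsTangentAt κ S ν (γ.frame 0).1 p ∧
      (κ = 1 → ¬(form κ p (γ 0) = 0 ∧ form κ p (deriv γ 0) = 0)) := by
  constructor
  · rintro ⟨h1, h2⟩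
    obtain ⟨p, hp⟩ := hν.exists_isTangentAt hc (h1 γ rfl)
    exact ⟨p, hp, fun hκ h => h2 hκ ((cls_mem_gaussImage hS hν).2 ⟨p, hp, h⟩)⟩
  · rintro ⟨p, hp, h⟩
    refine ⟨fun σ hσ t => (hp.congr_cls hσ.symm 0).notMem hν t, fun hκ hg => ?_⟩
    obtain ⟨q, hq, hq'⟩ := (cls_mem_gaussImage hS hν).1 hg
    rw [hq.unique hν hp] at hq'
    exact h hκ hq'

theorem reflectMap_mem_table (hS : IsSurface κ S) (hν : IsGaussMap κ S ν) (hc : IsCompact S)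
    {ℓ : OrientedGeodesic κ} (hℓ : ℓ ∈ table κ S) : reflectMap κ S ν ℓ ∈ table κ S := by
  obtain ⟨γ, rfl⟩ := cls_surjective ℓ
  obtain ⟨p, hp, h⟩ := (cls_mem_table hS hν hc).1 hℓ
  rw [reflectMap_cls hν hp, cls_mem_table hS hν hc]
  refine ⟨p, hp.frame_reflect hν, fun hκ => ?_⟩
  have h1 := congrArg Prod.fst (γ.frame_reflect (hν.subset hp.mem) 0)
  have h2 := congrArg Prod.snd (γ.frame_reflect (hν.subset hp.mem) 0)
  simp only [UnitGeodesic.frame] at h1 h2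
  rw [h1, h2, form_refl (hν.subset hp.mem).1, form_refl (hν.subset hp.mem).1]
  exact h hκ

theorem reflectMap_reflectMap (hS : IsSurface κ S) (hν : IsGaussMap κ S ν) (hc : IsCompact S)
    {ℓ : OrientedGeodesic κ} (hℓ : ℓ ∈ table κ S) :
    reflectMap κ S ν (reflectMap κ S ν ℓ) = ℓ := by
  obtain ⟨γ, rfl⟩ := cls_surjective ℓ
  obtain ⟨p, hp, h⟩ := (cls_mem_table hS hν hc).1 hℓ
  rw [reflectMap_cls hν hp, reflectMap_cls hν (hp.frame_reflect hν), UnitGeodesic.reflect_reflect]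

/-- The outer billiard map: the geodesic symmetry in the tangent point `p₊`, followed by the
reversal of the orientation. -/
def billiardMap (hS : IsSurface κ S) (hν : IsGaussMap κ S ν) (hc : IsCompact S) :
    table κ S ≃ reversedTable κ S where
  toFun ℓ := ⟨(reflectMap κ S ν ℓ).reverse, by
    change OrientedGeodesic.reverse _ ∈ table κ S
    rw [OrientedGeodesic.reverse_reverse]
    exact reflectMap_mem_table hS hν hc ℓ.2⟩
  invFun ℓ := ⟨reflectMap κ S ν (ℓ : OrientedGeodesic κ).reverse,
    reflectMap_mem_table hS hν hc ℓ.2⟩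
  left_inv ℓ := Subtype.ext (by
    simp only [OrientedGeodesic.reverse_reverse]
    exact reflectMap_reflectMap hS hν hc ℓ.2)
  right_inv ℓ := Subtype.ext (by
    simp only
    rw [reflectMap_reflectMap hS hν hc ℓ.2, OrientedGeodesic.reverse_reverse])

theorem reversedTable_eq_table (S : Set R4) : reversedTable (-1) S = table (-1) S := by
  have h : ∀ ℓ : OrientedGeodesic (-1), ℓ ∈ table (-1) S → ℓ.reverse ∈ table (-1) S := by
    rintro ℓ ⟨h1, -⟩
    refine ⟨fun γ hγ t => ?_, fun h => absurd h (by decide)⟩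
    have := h1 γ.reverse (by rw [UnitGeodesic.cls_reverse, hγ, OrientedGeodesic.reverse_reverse])
      (-t)
    rwa [UnitGeodesic.reverse_apply, neg_neg] at this
  ext ℓ
  refine ⟨fun hℓ => ?_, fun hℓ => h ℓ hℓ⟩
  have := h _ hℓ
  rwa [OrientedGeodesic.reverse_reverse] at this

/-! ### The geometric description of the billiard map -/

/-- The form is positive definite on the tangent spaces of `space κ`. -/
theorem form_pos_of_orthogonal {u w : R4} (hu : u ∈ space κ) (huw : form κ u w = 0) (hw : w ≠ 0) :
    0 < form κ w w := by
  obtain ⟨h1, -⟩ := hu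
  have hne : 0 < w 0 ^ 2 + (w 1 ^ 2 + w 2 ^ 2 + w 3 ^ 2) := by
    by_contra hle
    apply hw
    have h0 := sq_nonneg (w 0)
    have h1 := sq_nonneg (w 1)
    have h2 := sq_nonneg (w 2)
    have h3 := sq_nonneg (w 3)
    funext i
    apply pow_eq_zero_iff (two_ne_zero) |>.1
    fin_cases i <;> simp only [Fin.zero_eta, Fin.mk_one, Fin.reduceFinMk] <;>
      linarith
  rcases Int.units_eq_one_or κ with rfl | rfl
  · simp only [form, curv]
    push_cast
    nlinarith
  · simp only [form, curv] at h1 huw ⊢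
    push_cast at h1 huw ⊢
    have hcs : (u 0 * w 0) ^ 2 ≤ (u 0 ^ 2 - 1) * (w 1 ^ 2 + w 2 ^ 2 + w 3 ^ 2) := by
      have e1 : u 0 * w 0 = u 1 * w 1 + u 2 * w 2 + u 3 * w 3 := by linarith
      have e2 : u 0 ^ 2 - 1 = u 1 ^ 2 + u 2 ^ 2 + u 3 ^ 2 := by linarith
      rw [e1, e2]
      nlinarith [sq_nonneg (u 1 * w 2 - u 2 * w 1), sq_nonneg (u 1 * w 3 - u 3 * w 1),
        sq_nonneg (u 2 * w 3 - u 3 * w 2)]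
    have hu0 : 1 ≤ u 0 ^ 2 := by nlinarith [sq_nonneg (u 1), sq_nonneg (u 2), sq_nonneg (u 3)]
    set W := w 1 ^ 2 + w 2 ^ 2 + w 3 ^ 2 with hW
    have hW0 : 0 ≤ W := by positivity
    have hgoal : w 0 ^ 2 < W := by
      by_contra hle
      have h2 : u 0 ^ 2 * W ≤ (u 0 * w 0) ^ 2 := by nlinarith
      have h3 : W = 0 := by nlinarith
      rw [h3] at hcs hne
      nlinarith [sq_nonneg (u 0 * w 0)]
    nlinarith

/-- The distance `d` between two points, from its `cosK` and `sinK`. -/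
theorem exists_radius {a b : ℝ} (h : a * a + curv κ * (b * b) = 1) (hb : 0 < b)
    (ha : κ = -1 → 0 < a) :
    ∃ d, 0 < d ∧ (κ = 1 → d < Real.pi) ∧ cosK κ d = a ∧ sinK κ d = b := by
  rcases Int.units_eq_one_or κ with rfl | rfl
  · simp only [curv] at h
    push_cast at h
    simp only [cosK, sinK, if_true]
    have h1 : a < 1 := by nlinarith
    have h2 : -1 < a := by nlinarith
    refine ⟨Real.arccos a, Real.arccos_pos.2 h1, fun _ => ?_, Real.cos_arccos h2.le h1.le, ?_⟩
    · exact lt_of_le_of_ne (Real.arccos_le_pi a) fun h => by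
        rw [Real.arccos_eq_pi] at h; linarith
    · rw [Real.sin_arccos, show 1 - a ^ 2 = b ^ 2 by linarith, Real.sqrt_sq hb.le]
  · simp only [curv] at h
    push_cast at h
    simp only [cosK, sinK, neg_one_ne_one, if_false]
    refine ⟨Real.arsinh b, Real.arsinh_pos_iff.2 hb, fun h => absurd h (by decide), ?_,
      Real.sinh_arsinh b⟩
    rw [Real.cosh_arsinh, show 1 + b ^ 2 = a ^ 2 by linarith, Real.sqrt_sq (ha rfl).le]

theorem curv_mul_cosK_le {d s : ℝ} (hd : 0 ≤ d) (hds : d ≤ s) (hs : κ = 1 → s ≤ Real.pi) :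
    curv κ * cosK κ s ≤ curv κ * cosK κ d := by
  rcases Int.units_eq_one_or κ with rfl | rfl
  · simp only [cosK, curv, if_true]
    push_cast
    linarith [Real.cos_le_cos_of_nonneg_of_le_pi hd (hs rfl) hds]
  · simp only [cosK, curv, neg_one_ne_one, if_false]
    push_cast
    linarith [Real.cosh_le_cosh.2 (by rwa [abs_of_nonneg hd, abs_of_nonneg (hd.trans hds)] :
      |d| ≤ |s|)]

theorem le_of_curv_mul_cosK_le {d s : ℝ} (hs : 0 ≤ s) (hd : κ = 1 → d ≤ Real.pi)
    (h : curv κ * cosK κ s ≤ curv κ * cosK κ d) : d ≤ s := by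
  by_contra! hlt
  rcases Int.units_eq_one_or κ with rfl | rfl
  · simp only [cosK, curv, if_true] at h
    push_cast at h
    linarith [Real.cos_lt_cos_of_nonneg_of_le_pi hs (hd rfl) hlt]
  · simp only [cosK, curv, neg_one_ne_one, if_false] at h
    push_cast at h
    linarith [Real.cosh_lt_cosh.2 (by rwa [abs_of_nonneg hs, abs_of_nonneg (hs.trans hlt.le)] :
      |s| < |d|)]

theorem sinK_pos {d : ℝ} (h0 : 0 < d) (h : κ = 1 → d < Real.pi) : 0 < sinK κ d := by
  rcases Int.units_eq_one_or κ with rfl | rfl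
  · simp only [sinK, if_true]
    exact Real.sin_pos_of_pos_of_lt_pi h0 (h rfl)
  · simp only [sinK, neg_one_ne_one, if_false]
    exact Real.sinh_pos_iff.2 h0

theorem curv_mul_cosK_le_curv (c : ℝ) : curv κ * cosK κ c ≤ curv κ := by
  rcases Int.units_eq_one_or κ with rfl | rfl
  · simp only [cosK, curv, if_true]
    push_cast
    linarith [Real.cos_le_one c]
  · simp only [cosK, curv, neg_one_ne_one, if_false]
    push_cast
    linarith [Real.one_le_cosh c]

theorem cosK_neg (c : ℝ) : cosK κ (-c) = cosK κ c := by
  simp [cosK]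

theorem sinK_neg (c : ℝ) : sinK κ (-c) = -sinK κ c := by
  simp only [sinK]; split_ifs <;> simp

namespace UnitGeodesic

theorem form_apply_apply (γ : UnitGeodesic κ) (t : ℝ) :
    form κ (γ 0) (γ t) = curv κ * cosK κ t := by
  have h := γ.add_apply 0 t
  rw [zero_add] at h
  rw [h, form_add_right, form_smul_right, form_smul_right, γ.form_self, γ.form_deriv]
  ring

/-- Two points that are neither equal nor antipodal are joined by a shortest geodesic. -/
theorem exists_segment {x p : R4} (hx : x ∈ space κ) (hp : p ∈ space κ) (hne : ∀ a : ℝ, p ≠ a • x) :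
    ∃ (d : ℝ) (σ : UnitGeodesic κ), 0 < d ∧ (κ = 1 → d < Real.pi) ∧ σ 0 = x ∧ σ d = p := by
  set C := curv κ * form κ p x with hC
  set w := p - C • x with hw
  have hk := curv_mul_self κ
  have hxx := hx.1
  have hpp := hp.1
  have hxw : form κ x w = 0 := by
    rw [hw, form_sub_right, form_smul_right, hxx, hC, form_comm κ x p]
    linear_combination (-form κ p x) * hk
  have hw0 : w ≠ 0 := fun h => hne C (sub_eq_zero.1 h)
  have hpos := form_pos_of_orthogonal hx hxw hw0
  set b := Real.sqrt (form κ w w) with hb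
  have hbb : b * b = form κ w w := Real.mul_self_sqrt hpos.le
  have hbpos : 0 < b := Real.sqrt_pos.2 hpos
  have hww : form κ w w = curv κ - curv κ * (C * C) := by
    rw [show form κ w w = form κ w p - C * form κ x w by
      conv_lhs => rw [hw, form_sub_right, form_smul_right, form_comm κ _ x]
      , hxw, hw, form_sub_left, form_smul_left, hpp, form_comm κ x p, hC]
    linear_combination (form κ p x * form κ p x * curv κ) * hk
  obtain ⟨d, hd0, hdpi, hdc, hds⟩ := exists_radius (κ := κ) (a := C) (b := b)
    (by rw [hbb, hww]; linear_combination (1 - C * C) * hk) hbpos (by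
      rintro rfl
      have := form_le_neg_one hp hx
      simp only [hC, curv]
      push_cast
      linarith)
  have hz : (x, b⁻¹ • w) ∈ unitTangent κ := by
    refine ⟨hx, ?_, ?_⟩
    · simp only [form_smul_right, hxw, mul_zero]
    · simp only [form_smul_right, form_smul_left, ← hbb]
      field_simp
  refine ⟨d, geodesicOf ⟨_, hz⟩, hd0, hdpi, geodesicOf_zero _, ?_⟩
  rw [geodesicOf_apply, hdc, hds, smul_smul, mul_inv_cancel₀ hbpos.ne', one_smul]
  exact add_sub_cancel (C • x) p

/-- The foot of the perpendicular from a point to a geodesic, on the side of the point. -/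
theorem exists_foot (γ : UnitGeodesic κ) {p : R4} (hp : p ∈ space κ) :
    ∃ t, form κ p (deriv γ t) = 0 ∧ 0 ≤ curv κ * form κ p (γ t) := by
  set U := form κ p (γ 0) with hU
  set V := form κ p (deriv γ 0) with hV
  have hk := curv_mul_self κ
  have hneg : κ = -1 → 1 ≤ U * U + curv κ * (V * V) ∧ 0 < curv κ * U := by
    rintro rfl
    set w := p - (curv (-1) * U) • γ 0 - V • deriv γ 0 with hw
    have h1 : form (-1) (γ 0) w = 0 := by
      simp only [hw, form_sub_right, form_smul_right, γ.form_self, γ.form_deriv,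
        form_comm (-1) (γ 0) p]
      linear_combination (-U) * hk
    have h2 : 0 ≤ form (-1) w w := by
      by_cases hw0 : w = 0
      · rw [hw0, form_zero_left]
      · exact (form_pos_of_orthogonal (γ.mem 0) h1 hw0).le
    have h3 : form (-1) w w = curv (-1) - curv (-1) * (U * U) - V * V := by
      simp only [hw, form_sub_right, form_sub_left, form_smul_left, form_smul_right, γ.form_self,
        γ.form_deriv, γ.unit_speed, form_comm (-1) (deriv γ 0) (γ 0), form_comm (-1) (γ 0) p,
        form_comm (-1) (deriv γ 0) p, hp.1, ← hU, ← hV]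
      linear_combination (U * U * curv (-1)) * hk
    have h4 := form_le_neg_one hp (γ.mem 0)
    rw [h3] at h2
    simp only [curv] at h2 ⊢
    push_cast at h2 ⊢
    constructor <;> linarith
  by_cases h0 : U * U + curv κ * (V * V) = 0
  · rcases Int.units_eq_one_or κ with rfl | rfl
    · simp only [curv] at h0 ⊢
      push_cast at h0 ⊢
      have hU0 : U = 0 := by nlinarith [mul_self_nonneg U, mul_self_nonneg V]
      have hV0 : V = 0 := by nlinarith [mul_self_nonneg U, mul_self_nonneg V]
      exact ⟨0, hV0, by rw [← hU, hU0]; simp⟩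
    · have := (hneg rfl).1
      linarith
  · have hpos : 0 < U * U + curv κ * (V * V) := by
      rcases Int.units_eq_one_or κ with rfl | rfl
      · refine lt_of_le_of_ne ?_ (Ne.symm h0)
        simp only [curv]
        push_cast
        nlinarith [mul_self_nonneg U, mul_self_nonneg V]
      · linarith [(hneg rfl).1]
    set m := Real.sqrt (U * U + curv κ * (V * V)) with hm
    have hm0 : 0 < m := Real.sqrt_pos.2 hpos
    have hmm : m * m = U * U + curv κ * (V * V) := Real.mul_self_sqrt hpos.le
    obtain ⟨t, h1, h2⟩ := exists_cosK_sinK (κ := κ) (a := curv κ * U / m) (b := V / m) (by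
      field_simp
      linear_combination (U ^ 2) * hk - hmm) (fun h => div_pos (hneg h).2 hm0)
    have e1 := γ.add_apply 0 t
    have e2 := γ.deriv_add_apply 0 t
    rw [zero_add] at e1 e2
    refine ⟨t, ?_, ?_⟩
    · rw [e2, form_add_right, form_smul_right, form_smul_right, ← hU, ← hV, h1, h2]
      field_simp; ring
    · rw [e1, form_add_right, form_smul_right, form_smul_right, ← hU, ← hV, h1, h2]
      rw [show curv κ * (curv κ * U / m * U + V / m * V) = m by
        field_simp
        linear_combination (U ^ 2) * hk - hmm]
      exact hm0.le

theorem form_le_foot (γ : UnitGeodesic κ) {p : R4} {t : ℝ} (h1 : form κ p (deriv γ t) = 0)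
    (h2 : 0 ≤ curv κ * form κ p (γ t)) (r : ℝ) : form κ p (γ r) ≤ form κ p (γ t) := by
  obtain ⟨c, rfl⟩ : ∃ c, r = t + c := ⟨r - t, by ring⟩
  rw [γ.add_apply, form_add_right, form_smul_right, form_smul_right, h1]
  have h3 := mul_le_mul_of_nonneg_left (curv_mul_cosK_le_curv (κ := κ) c) h2
  have hk := curv_mul_self κ
  have e1 : curv κ * form κ p (γ t) * (curv κ * cosK κ c) = cosK κ c * form κ p (γ t) := by
    linear_combination (cosK κ c * form κ p (γ t)) * hk
  have e2 : curv κ * form κ p (γ t) * curv κ = form κ p (γ t) := by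
    linear_combination (form κ p (γ t)) * hk
  linarith

end UnitGeodesic

/-! ### Parallel fields -/

/-- A parallel field that is orthogonal to a geodesic at one point is constant in the ambient
space. -/
theorem IsParallel.eq_const {γ : UnitGeodesic κ} {X : ℝ → R4} (h : IsParallel κ γ X) {t : ℝ}
    (ht : form κ (deriv γ t) (X t) = 0) (s : ℝ) : X s = X t := by
  obtain ⟨hX, hγX, hcov⟩ := h
  have hX' : ∀ s, deriv X s = (curv κ * form κ (deriv X s) (γ s)) • γ s := fun s =>
    sub_eq_zero.1 (hcov s)
  have hXd : ∀ s, HasDerivAt X (deriv X s) s := fun s =>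
    (hX.differentiable (by simp) s).hasDerivAt
  have h1 : ∀ s, form κ (deriv γ s) (X s) = 0 := by
    intro s
    have hd : ∀ s, HasDerivAt (fun s => form κ (deriv γ s) (X s)) 0 s := fun s => by
      refine (HasDerivAt.form (γ.contDiff_deriv.differentiable (by simp) s).hasDerivAt
        (hXd s)).congr_deriv ?_
      rw [γ.deriv_deriv, hX' s, form_smul_left, form_smul_right, hγX, form_comm κ (deriv γ s) (γ s),
        γ.form_deriv]
      ring
    have := is_const_of_deriv_eq_zero (fun s => (hd s).differentiableAt) (fun s => (hd s).deriv) s t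
    rw [this, ht]
  have h2 : ∀ s, deriv X s = 0 := fun s => by
    have := form_deriv_of_const γ.smooth hX hγX s
    rw [h1, zero_add] at this
    rw [hX' s, form_comm, this]
    simp
  exact is_const_of_deriv_eq_zero (fun s => (hXd s).differentiableAt) h2 s t

theorem isParallel_const {γ : UnitGeodesic κ} {w : R4} {t : ℝ} (h1 : form κ w (γ t) = 0)
    (h2 : form κ w (deriv γ t) = 0) : IsParallel κ γ fun _ => w := by
  refine ⟨contDiff_const, fun s => ?_, fun s => ?_⟩
  · rw [form_comm]; exact (orthogonal_frame_change ⟨h1, h2⟩ s).1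
  · simp [covD, tangentProj, form_zero_left]

/-! ### Shortest segments to the tangent points -/

theorem UnitGeodesic.ne_combination_of_notMem (γ : UnitGeodesic κ) {p : R4} (hp : p ∈ space κ)
    (h : ∀ t, γ t ≠ p) (t a b : ℝ) : p ≠ a • γ t + b • deriv γ t := by
  rintro rfl
  obtain ⟨s, hs⟩ := γ.mem_range_of_plane hp
  exact h s hs

namespace TangentData

theorem form_normal_eq_zero (hS : IsSurface κ S) (hν : IsGaussMap κ S ν) {γ : UnitGeodesic κ}
    (P : TangentData S γ) : form κ (ν P.p) (γ 0) = 0 ∧ form κ (ν P.p) (deriv γ 0) = 0 := by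
  have h : ∀ t, form κ (ν P.p) (γ t) = 0 := fun t =>
    ((mem_tangentSurface_iff hS P.p_mem (hν.isUnitNormal P.p_mem) _).1 (P.tangent ⟨t, rfl⟩)).2
  refine ⟨h 0, ?_⟩
  have h1 := γ.add_apply 0 1
  rw [zero_add] at h1
  have h2 := h 1
  rw [h1, form_add_right, form_smul_right, form_smul_right, h 0, mul_zero, zero_add] at h2
  exact (mul_eq_zero.1 h2).resolve_left
    (sinK_pos one_pos fun _ => by linarith [Real.pi_gt_three]).ne'

/-- The shortest segment meets the geodesic orthogonally, and has length less than `π` in the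
sphere. -/
theorem perpendicular (hS : S ⊆ space κ) {γ : UnitGeodesic κ} (hγ : ∀ t, γ t ∉ S)
    (P : TangentData S γ) : form κ P.p (deriv γ P.t) = 0 ∧ 0 < sinK κ P.d := by
  have hp := hS P.p_mem
  have hpγ : ∀ t a b : ℝ, P.p ≠ a • γ t + b • deriv γ t :=
    γ.ne_combination_of_notMem hp fun t h => hγ t (by rw [h]; exact P.p_mem)
  -- compare with the segment from the foot of the perpendicular
  obtain ⟨t, ht1, ht2⟩ := γ.exists_foot hp
  obtain ⟨d, σ, hd0, hdpi, hσ0, hσd⟩ := UnitGeodesic.exists_segment (γ.mem t) hp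
    fun a h => hpγ t a 0 (by rw [h]; simp)
  have hle : P.d ≤ d := P.shortest σ t d hd0.le hσ0 hσd
  have hsin : 0 < sinK κ P.d := sinK_pos P.d_pos fun h => hle.trans_lt (hdpi h)
  refine ⟨?_, hsin⟩
  have e1 := P.σ.form_apply_apply P.d
  rw [P.σ_zero, P.σ_end] at e1
  have e2 := σ.form_apply_apply d
  rw [hσ0, hσd] at e2
  have h3 : form κ P.p (γ t) ≤ form κ P.p (γ P.t) := by
    rw [form_comm κ _ (γ t), form_comm κ _ (γ P.t), e1, e2]
    exact curv_mul_cosK_le P.d_pos.le hle fun h => (hdpi h).le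
  have hmax : IsLocalMax (fun r => form κ P.p (γ r)) P.t :=
    Eventually.of_forall fun r => (γ.form_le_foot ht1 ht2 r).trans h3
  have hd : HasDerivAt (fun r => form κ P.p (γ r)) (form κ P.p (deriv γ P.t)) P.t :=
    (formL κ P.p).hasFDerivAt.comp_hasDerivAt P.t
      (γ.smooth.differentiable (by simp) P.t).hasDerivAt
  exact hmax.hasDerivAt_eq_zero hd

theorem p_eq {γ : UnitGeodesic κ} (P : TangentData S γ) :
    P.p = cosK κ P.d • γ P.t + sinK κ P.d • deriv P.σ 0 := by
  rw [← P.σ_end, ← P.σ_zero]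
  simpa using P.σ.add_apply 0 P.d

theorem form_deriv_σ (hS : S ⊆ space κ) {γ : UnitGeodesic κ} (hγ : ∀ t, γ t ∉ S)
    (P : TangentData S γ) : form κ (deriv P.σ 0) (deriv γ P.t) = 0 := by
  obtain ⟨h1, h2⟩ := P.perpendicular hS hγ
  rw [P.p_eq, form_add_left, form_smul_left, form_smul_left, γ.form_deriv, mul_zero,
    zero_add] at h1
  exact (mul_eq_zero.1 h1).resolve_left h2.ne'

theorem W_eq (hS : S ⊆ space κ) {γ : UnitGeodesic κ} (hγ : ∀ t, γ t ∉ S)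
    (P : TangentData S γ) (r : ℝ) : P.W r = deriv P.σ 0 := by
  rw [← P.W_init]
  refine P.W_parallel.eq_const ?_ r
  rw [P.W_init, form_comm]
  exact P.form_deriv_σ hS hγ

/-- The frame `W₊, W₋, γ'` and the tangent points have the same orientation over `γ`. -/
theorem vol_W (hS : S ⊆ space κ) {γ : UnitGeodesic κ} (hγ : ∀ t, γ t ∉ S)
    (P Q : TangentData S γ) (r : ℝ) : sinK κ P.d * sinK κ Q.d *
      vol (γ r) (P.W r) (Q.W r) (deriv γ r) = vol P.p Q.p (γ 0) (deriv γ 0) := by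
  have key : ∀ (u v w w' : R4) (a b c a' b' c' : ℝ), c * c' * vol u w w' v =
      vol (a • u + b • v + c • w) (a' • u + b' • v + c' • w') u v := by
    intro u v w w' a b c a' b' c'
    simp only [vol_eq, Pi.add_apply, Pi.smul_apply, smul_eq_mul]; ring
  rw [← vol_frame γ _ _ r 0, P.W_eq hS hγ, Q.W_eq hS hγ]
  have e : ∀ t, ∃ a b : ℝ, γ t = a • γ r + b • deriv γ r := fun t =>
    ⟨_, _, by simpa using γ.add_apply r (t - r)⟩
  obtain ⟨a, b, hab⟩ := e P.t
  obtain ⟨a', b', hab'⟩ := e Q.t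
  rw [key _ _ _ _ (cosK κ P.d * a) (cosK κ P.d * b) _ (cosK κ Q.d * a') (cosK κ Q.d * b'),
    P.p_eq, Q.p_eq, hab, hab']
  simp only [smul_add, mul_smul]

end TangentData

/-- Every tangent point has a shortest segment. -/
theorem exists_tangentData (hS : IsSurface κ S) (hν : IsGaussMap κ S ν) {γ : UnitGeodesic κ}
    (hγ : ∀ t, γ t ∉ S) {p : R4} (hp : p ∈ S) (h1 : form κ (ν p) (γ 0) = 0)
    (h2 : form κ (ν p) (deriv γ 0) = 0) : ∃ P : TangentData S γ, P.p = p := by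
  have hps := hS.1 hp
  have hpγ : ∀ t a b : ℝ, p ≠ a • γ t + b • deriv γ t :=
    γ.ne_combination_of_notMem hps fun t h => hγ t (by rw [h]; exact hp)
  obtain ⟨t, ht1, ht2⟩ := γ.exists_foot hps
  obtain ⟨d, σ, hd0, hdpi, hσ0, hσd⟩ := UnitGeodesic.exists_segment (γ.mem t) hps
    fun a h => hpγ t a 0 (by rw [h]; simp)
  have hpe : p = cosK κ d • γ t + sinK κ d • deriv σ 0 := by
    rw [← hσd, ← hσ0]
    simpa using σ.add_apply 0 d
  have horth : form κ (deriv σ 0) (deriv γ t) = 0 := by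
    rw [hpe, form_add_left, form_smul_left, form_smul_left, γ.form_deriv, mul_zero,
      zero_add] at ht1
    exact (mul_eq_zero.1 ht1).resolve_left (sinK_pos hd0 hdpi).ne'
  refine ⟨{
    p := p
    p_mem := hp
    tangent := ?_
    t := t
    d := d
    d_pos := hd0
    σ := σ
    σ_zero := hσ0
    σ_end := hσd
    shortest := fun τ r s hs h0 hs' => ?_
    W := fun _ => deriv σ 0
    W_parallel := isParallel_const (t := t) ?_ horth
    W_init := rfl }, rfl⟩
  · rintro _ ⟨s, rfl⟩
    refine (mem_tangentSurface_iff hS hp (hν.isUnitNormal hp) _).2 ⟨γ.mem s, ?_⟩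
    exact (orthogonal_frame_change ⟨h1, h2⟩ s).1
  · refine le_of_curv_mul_cosK_le hs (fun h => (hdpi h).le) ?_
    rw [← τ.form_apply_apply, ← σ.form_apply_apply, h0, hs', hσ0, hσd, form_comm κ _ p,
      form_comm κ _ p]
    exact γ.form_le_foot ht1 ht2 r
  · rw [form_comm, ← hσ0]; exact σ.form_deriv 0

theorem UnitGeodesic.add_sub_apply (σ : UnitGeodesic κ) (t c : ℝ) :
    σ (t + c) = (2 * cosK κ c) • σ t - σ (t - c) := by
  rw [sub_eq_add_neg t c, σ.add_apply, σ.add_apply, cosK_neg, sinK_neg]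
  module

theorem TangentData.σ_two_mul {γ : UnitGeodesic κ} (P : TangentData S γ) :
    P.σ (2 * P.d) = refl κ P.p (γ P.t) := by
  have e := P.σ.add_sub_apply P.d P.d
  rw [sub_self, P.σ_end, P.σ_zero] at e
  have e2 := P.σ.form_apply_apply P.d
  rw [P.σ_zero, P.σ_end] at e2
  rw [two_mul, e, refl, form_comm, e2]
  congr 2
  linear_combination (-(2 * cosK κ P.d)) * curv_mul_self κ

/-- Parallel transport along the doubled segment to `p` is the geodesic symmetry at `p`, followed
by a reversal. -/
theorem cls_transport {γ τ : UnitGeodesic κ} (P : TangentData S γ) (hS : S ⊆ space κ)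
    (hγ : ∀ t, γ t ∉ S) (h0 : τ 0 = P.σ (2 * P.d)) (h1 : deriv τ 0 = deriv γ P.t) :
    τ.cls = (γ.reflect (hS P.p_mem)).cls.reverse := by
  rw [← UnitGeodesic.cls_reverse, eq_comm, cls_eq_iff_frame 0]
  refine ⟨-P.t, Subtype.ext ?_⟩
  have hf := γ.frame_reflect (hS P.p_mem) P.t
  simp only [UnitGeodesic.frame, Prod.mk.injEq] at hf
  simp only [UnitGeodesic.frame, UnitGeodesic.reverse_apply, UnitGeodesic.deriv_reverse, neg_neg,
    hf.1, hf.2, h0, h1, Prod.mk.injEq]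
  constructor
  · exact P.σ_two_mul.symm
  · rw [refl, (P.perpendicular hS hγ).1]
    simp

/-- The geometric definition of the outer billiard map agrees with the symmetry in the tangent
point. -/
theorem isOuterBilliardImage_iff (hS : IsSurface κ S) (hν : IsGaussMap κ S ν) (hc : IsCompact S)
    {ℓ : OrientedGeodesic κ} (hℓ : ℓ ∈ table κ S) (ℓ' : OrientedGeodesic κ) :
    IsOuterBilliardImage S ℓ ℓ' ↔ ℓ' = (reflectMap κ S ν ℓ).reverse := by
  constructor
  · rintro ⟨γ, P, Q, V, τ, rfl, rfl, hvol, hV, hV0, hτ0, hτ1⟩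
    have hγ := hℓ.1 γ rfl
    have hn := P.form_normal_eq_zero hS hν
    have hP := P.perpendicular hS.1 hγ
    have hQ := Q.perpendicular hS.1 hγ
    have hpos : 0 < vol P.p Q.p (γ 0) (deriv γ 0) := by
      rw [← P.vol_W hS.1 hγ Q 0]
      exact mul_pos (mul_pos hP.2 hQ.2) (hvol 0)
    have ht : IsTangentAt κ S ν (γ.frame 0).1 P.p := by
      refine ⟨P.p_mem, hn.1, hn.2, ?_⟩
      have h2 := IsTangentAt.vol_eq_mul (z := (γ.frame 0).1) hν P.p_mem hn.1 hn.2 Q.p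
      have h3 : 0 ≤ form κ (ν P.p) Q.p := by
        by_cases hpq : Q.p = P.p
        · rw [hpq, hν.form_point _ P.p_mem]
        · exact (hν.form_pos _ P.p_mem _ Q.p_mem hpq).le
      refine pos_of_mul_pos_left ?_ h3
      rw [← h2]
      exact hpos
    rw [reflectMap_cls hν ht]
    refine cls_transport P hS.1 hγ hτ0 ?_
    rw [hτ1, ← hV0]
    refine hV.eq_const ?_ _
    rw [hV0]
    exact P.form_deriv_σ hS.1 hγ
  · rintro rfl
    obtain ⟨γ, rfl⟩ := cls_surjective ℓ
    have hγ := hℓ.1 γ rfl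
    obtain ⟨p, hp, -⟩ := (cls_mem_table hS hν hc).1 hℓ
    -- the second tangent point is the first one of the reversed geodesic
    obtain ⟨q, hq⟩ := hν.exists_isTangentAt hc (γ := γ.reverse) fun t => hγ (-t)
    have hq1 : form κ (ν q) (γ 0) = 0 := by
      simpa [UnitGeodesic.frame, UnitGeodesic.reverse_apply] using hq.form_fst
    have hq2 : form κ (ν q) (deriv γ 0) = 0 := by
      simpa [UnitGeodesic.frame, UnitGeodesic.deriv_reverse, form_neg_right] using hq.form_snd
    have hqv : vol q (ν q) (γ 0) (deriv γ 0) < 0 := by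
      simpa [UnitGeodesic.frame, UnitGeodesic.deriv_reverse, UnitGeodesic.reverse_apply,
        vol_neg_four] using hq.vol_pos
    have hqp : q ≠ p := by
      rintro rfl
      exact lt_asymm hp.vol_pos hqv
    obtain ⟨P, rfl⟩ := exists_tangentData hS hν hγ hp.mem hp.form_fst hp.form_snd
    obtain ⟨Q, rfl⟩ := exists_tangentData hS hν hγ hq.mem hq1 hq2
    have hP := P.perpendicular hS.1 hγ
    have hQ := Q.perpendicular hS.1 hγ
    set τ := geodesicOf ((γ.reflect (hS.1 P.p_mem)).reverse.frame (-P.t)) with hτ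
    have hpσ : form κ (deriv γ P.t) (P.σ 0) = 0 := by
      rw [form_comm, P.σ_zero]; exact γ.form_deriv _
    have hpσ' : form κ (deriv γ P.t) (deriv P.σ 0) = 0 := by
      rw [form_comm]; exact P.form_deriv_σ hS.1 hγ
    have hf := γ.frame_reflect (hS.1 P.p_mem) P.t
    simp only [UnitGeodesic.frame, Prod.mk.injEq] at hf
    refine ⟨γ, P, Q, fun _ => deriv γ P.t, τ, rfl, ?_, fun r => ?_, isParallel_const hpσ hpσ', rfl,
      ?_, ?_⟩
    · rw [hτ, cls_geodesicOf_frame, UnitGeodesic.cls_reverse, reflectMap_cls hν hp]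
    · have h1 := P.vol_W hS.1 hγ Q r
      have h2 : 0 < vol P.p Q.p (γ 0) (deriv γ 0) := hp.vol_pos_of_ne hν hq.mem hqp
      rw [← h1] at h2
      exact pos_of_mul_pos_right h2 (mul_pos hP.2 hQ.2).le
    · rw [hτ, geodesicOf_zero]
      simp only [UnitGeodesic.frame, UnitGeodesic.reverse_apply, neg_neg, hf.1, P.σ_two_mul]
    · rw [hτ, deriv_geodesicOf_zero]
      simp only [UnitGeodesic.frame, UnitGeodesic.deriv_reverse, neg_neg, hf.2]
      rw [refl, hP.1]
      simp

/-! ### Smooth dependence of the tangent point -/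

/-- The bilinear information about the differential `A` of the normal field at `p`: it is symmetric
and definite on the tangent plane and takes values orthogonal to `p` there. -/
structure IsShape (κ : ℤˣ) (p n : R4) (A : R4 →L[ℝ] R4) : Prop where
  form_point : ∀ w, form κ p w = 0 → form κ n w = 0 → form κ (A w) p = 0
  symm : ∀ w w', form κ p w = 0 → form κ n w = 0 → form κ p w' = 0 → form κ n w' = 0 →
    form κ (A w) w' = form κ (A w') w
  definite : ∀ w, form κ p w = 0 → form κ n w = 0 → form κ (A w) w = 0 → w = 0

/-- A smooth family of tangent points near the frame `z₀`, with the equations for its differential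
at `z₀`. -/
structure IsTangentFamily (κ : ℤˣ) (S : Set R4) (ν : R4 → R4) (z₀ : R4 × R4)
    (O : Set (R4 × R4)) (P : R4 × R4 → R4) (A : R4 →L[ℝ] R4) : Prop where
  isOpen : IsOpen O
  mem : z₀ ∈ O
  contDiffOn : ContDiffOn ℝ ∞ P O
  isTangentAt : ∀ z ∈ O, IsTangentAt κ S ν z (P z)
  shape : IsShape κ (P z₀) (ν (P z₀)) A
  form_point : ∀ d, form κ (P z₀) (fderiv ℝ P z₀ d) = 0
  form_normal : ∀ d, form κ (ν (P z₀)) (fderiv ℝ P z₀ d) = 0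
  eq_fst : ∀ d, form κ (A (fderiv ℝ P z₀ d)) z₀.1 = -form κ (ν (P z₀)) d.1
  eq_snd : ∀ d, form κ (A (fderiv ℝ P z₀ d)) z₀.2 = -form κ (ν (P z₀)) d.2

theorem contDiff_form {E : Type*} [NormedAddCommGroup E] [NormedSpace ℝ E] {f g : E → R4}
    (hf : ContDiff ℝ ∞ f) (hg : ContDiff ℝ ∞ g) : ContDiff ℝ ∞ fun x => form κ (f x) (g x) := by
  have h1 := contDiff_pi.1 hf
  have h2 := contDiff_pi.1 hg
  exact (((contDiff_const.mul ((h1 0).mul (h2 0))).add ((h1 1).mul (h2 1))).add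
    ((h1 2).mul (h2 2))).add ((h1 3).mul (h2 3))

/-- The implicit function theorem with a solution that is smooth on an open set. -/
theorem exists_implicit {E G : Type*} [NormedAddCommGroup E] [NormedSpace ℝ E]
    [NormedAddCommGroup G] [NormedSpace ℝ G] [FiniteDimensional ℝ E] [FiniteDimensional ℝ G]
    {F : E × G → G} (hF : ContDiff ℝ ∞ F) {z₀ : E} {y₀ : G} (h0 : F (z₀, y₀) = 0)
    (hinj : ∀ y, fderiv ℝ F (z₀, y₀) (0, y) = 0 → y = 0) :
    ∃ (O : Set E) (q : E → G), IsOpen O ∧ z₀ ∈ O ∧ ContDiffOn ℝ ∞ q O ∧ q z₀ = y₀ ∧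
      ∀ z ∈ O, F (z, q z) = 0 := by
  have : CompleteSpace E := FiniteDimensional.complete ℝ E
  have : CompleteSpace G := FiniteDimensional.complete ℝ G
  let H : E × G → E × G := fun x => (x.1, F x)
  have hH : ContDiff ℝ ∞ H := contDiff_fst.prodMk hF
  let D : E × G →L[ℝ] E × G := (ContinuousLinearMap.fst ℝ E G).prod (fderiv ℝ F (z₀, y₀))
  have hHD : HasFDerivAt H D (z₀, y₀) :=
    hasFDerivAt_fst.prodMk (hF.differentiable (by simp) _).hasFDerivAt
  have hDinj : Function.Injective D := by
    rw [injective_iff_map_eq_zero]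
    rintro ⟨d, y⟩ h
    have hd : d = 0 := congrArg Prod.fst h
    subst hd
    rw [hinj y (congrArg Prod.snd h)]
    rfl
  let e : (E × G) ≃L[ℝ] E × G :=
    (LinearEquiv.ofInjectiveEndo D.toLinearMap hDinj).toContinuousLinearEquiv
  obtain ⟨g, hg, hg0, hgs⟩ := exists_smooth_local_inverse hH e (a := (z₀, y₀)) hHD
  have hH0 : H (z₀, y₀) = (z₀, 0) := by simp only [H, h0]
  have ht0 : (z₀, (0 : G)) ∈ g.target := by
    have := g.map_source hg0
    rwa [hg, hH0] at this
  have hsym0 : g.symm (z₀, 0) = (z₀, y₀) := by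
    have := g.left_inv hg0
    rwa [hg, hH0] at this
  refine ⟨{z | (z, (0 : G)) ∈ g.target}, fun z => (g.symm (z, 0)).2,
    g.open_target.preimage (by fun_prop), ht0, ?_, by simp only [hsym0], fun z hz => ?_⟩
  · exact contDiff_snd.comp_contDiffOn (hgs.comp (contDiff_id.prodMk contDiff_const).contDiffOn
      fun z hz => hz)
  · have h1 := g.right_inv hz
    rw [hg] at h1
    have h2 : (g.symm (z, 0)).1 = z := congrArg Prod.fst h1
    have h3 : F (g.symm (z, 0)) = 0 := congrArg Prod.snd h1
    rwa [show g.symm (z, 0) = (z, (g.symm (z, 0)).2) from Prod.ext h2 rfl] at h3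

/-- The tangent point depends smoothly on the frame, by the implicit function theorem for the
equations `⟨N(φ y), u⟩ = ⟨N(φ y), v⟩ = 0`. -/
theorem exists_tangentFamily (hν : IsGaussMap κ S ν) {z₀ : R4 × R4} {p : R4}
    (h : IsTangentAt κ S ν z₀ p) : ∃ O P A, IsTangentFamily κ S ν z₀ O P A ∧ P z₀ = p := by
  have hp := h.mem
  obtain ⟨φ, N, hφ, hφS, hφ0, hinj, hN, hNν, hdef, hpt, hsym⟩ := hν.exists_local p hp
  have hNp : N p = ν p := hNν.self_of_nhdsWithin hp
  set A := fderiv ℝ N p with hA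
  have hT := hν.mem_tangentSpace p hp
  have hφT : ∀ a, fderiv ℝ φ 0 a ∈ tangentSpace S p := fun a => by
    have := fderiv_mem_tangentSpace hφ hφS 0 a
    rwa [hφ0] at this
  have hM : HasFDerivAt (fun y => N (φ y)) (A.comp (fderiv ℝ φ 0)) 0 := by
    have := (hN.differentiable (by simp) (φ 0)).hasFDerivAt.comp 0
      (hφ.differentiable (by simp) 0).hasFDerivAt
    rw [hφ0] at this
    exact this
  have hF : ContDiff ℝ ∞ fun x : (R4 × R4) × (ℝ × ℝ) =>
      (form κ (N (φ x.2)) x.1.1, form κ (N (φ x.2)) x.1.2) := by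
    have h1 : ContDiff ℝ ∞ fun x : (R4 × R4) × (ℝ × ℝ) => N (φ x.2) :=
      (hN.comp hφ).comp contDiff_snd
    exact (contDiff_form h1 (contDiff_fst.comp contDiff_fst)).prodMk
      (contDiff_form h1 (contDiff_snd.comp contDiff_fst))
  obtain ⟨O₁, q, hO₁, ht0, hqs, hq0, hsol⟩ := exists_implicit hF (z₀ := z₀) (y₀ := 0)
    (by simp only [hφ0, hNp, h.form_fst, h.form_snd]; rfl) (by
      intro y h0
      have hm := hasDerivAt_comp_line hM y
      have h1 := hasDerivAt_comp_line (hF.differentiable (by simp) (z₀, 0)).hasFDerivAt (0, y)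
      have h2 := (HasDerivAt.form (κ := κ) hm (hasDerivAt_const (0 : ℝ) z₀.1)).prodMk
        (HasDerivAt.form (κ := κ) hm (hasDerivAt_const (0 : ℝ) z₀.2))
      have h3 := h1.unique (h2.congr_of_eventuallyEq (Eventually.of_forall fun t => by simp))
      rw [h0] at h3
      simp only [form_zero_right, add_zero, zero_smul, ContinuousLinearMap.comp_apply] at h3
      have h1 : form κ (A (fderiv ℝ φ 0 y)) z₀.1 = 0 := (congrArg Prod.fst h3).symm
      have h2 : form κ (A (fderiv ℝ φ 0 y)) z₀.2 = 0 := (congrArg Prod.snd h3).symm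
      set w := fderiv ℝ φ 0 y with hw
      have hwT : w ∈ tangentSpace S p := hφT y
      -- `w` is a combination of the point and the frame, so that `⟨A w, w⟩ = 0`
      have hvol : vol p w z₀.1 z₀.2 = 0 := by
        rw [IsTangentAt.vol_eq_mul hν hp h.form_fst h.form_snd, ((hT w).1 hwT).2, mul_zero]
      have hcr := congrArg (form κ (A w)) (cramer w p (ν p) z₀.1 z₀.2)
      simp only [form_add_right, form_smul_right, hvol, h1, h2, hpt w hwT] at hcr
      have hww : form κ (A w) w = 0 := by
        have : vol p (ν p) z₀.1 z₀.2 * form κ (A w) w = 0 := by rw [hcr]; ring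
        exact (mul_eq_zero.1 this).resolve_left h.vol_pos.ne'
      have hw0 : w = 0 := by
        by_contra hw0
        exact hdef w hwT hw0 hww
      exact hinj (by rw [← hw, hw0, map_zero]))
  obtain ⟨P, hP⟩ : ∃ P : R4 × R4 → R4, ∀ z, P z = φ (q z) := ⟨_, fun _ => rfl⟩
  have hPq : P = φ ∘ q := funext hP
  have hPs : ContDiffOn ℝ ∞ P O₁ := by rw [hPq]; exact hφ.comp_contDiffOn hqs
  have hP0 : P z₀ = p := by rw [hP, hq0, hφ0]
  have hPS : ∀ z, P z ∈ S := fun z => by rw [hP]; exact hφS _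
  have hPc : ContinuousAt P z₀ := hPs.continuousOn.continuousAt (hO₁.mem_nhds ht0)
  replace hsol : ∀ z ∈ O₁, form κ (N (P z)) z.1 = 0 ∧ form κ (N (P z)) z.2 = 0 := by
    intro z hz
    have h1 := hsol z hz
    rw [hP]
    exact ⟨congrArg Prod.fst h1, congrArg Prod.snd h1⟩
  have hNP : ∀ᶠ z in 𝓝 z₀, N (P z) = ν (P z) := by
    have ht : Tendsto P (𝓝 z₀) (𝓝[S] p) := by
      refine tendsto_nhdsWithin_iff.2 ⟨?_, Eventually.of_forall hPS⟩
      have := hPc.tendsto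
      rwa [hP0] at this
    exact ht.eventually hNν
  have hvol : ∀ᶠ z in 𝓝 z₀, 0 < vol (P z) (N (P z)) z.1 z.2 := by
    have hcont : Continuous fun x : R4 × (R4 × R4) => vol x.1 (N x.1) x.2.1 x.2.2 :=
      continuous_vol continuous_fst (hN.continuous.comp continuous_fst)
        (continuous_fst.comp continuous_snd) (continuous_snd.comp continuous_snd)
    have hpos : ∀ᶠ x : R4 × (R4 × R4) in 𝓝 (P z₀, z₀), 0 < vol x.1 (N x.1) x.2.1 x.2.2 := by
      refine (isOpen_lt continuous_const hcont).mem_nhds ?_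
      rw [mem_ofPred_eq, hP0, hNp]
      exact h.vol_pos
    exact (hPc.tendsto.prodMk_nhds tendsto_id).eventually hpos
  obtain ⟨O, hO, hOo, hOz⟩ := mem_nhds_iff.1 ((hO₁.eventually_mem ht0).and
    (hNP.and hvol))
  have hPd : HasFDerivAt P (fderiv ℝ P z₀) z₀ :=
    ((hPs.contDiffAt (hO₁.mem_nhds ht0)).differentiableAt (by simp)).hasFDerivAt
  have hPT : ∀ d, fderiv ℝ P z₀ d ∈ tangentSpace S p := by
    intro d
    have hqd : HasFDerivAt q (fderiv ℝ q z₀) z₀ :=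
      ((hqs.contDiffAt (hO₁.mem_nhds ht0)).differentiableAt (by simp)).hasFDerivAt
    have hφd : HasFDerivAt φ (fderiv ℝ φ 0) (q z₀) := by
      rw [hq0]; exact (hφ.differentiable (by simp) 0).hasFDerivAt
    have hcomp : HasFDerivAt P ((fderiv ℝ φ 0).comp (fderiv ℝ q z₀)) z₀ := by
      rw [hPq]; exact hφd.comp z₀ hqd
    rw [hPd.unique hcomp]
    exact hφT _
  have hderiv : ∀ (L : R4 × R4 →L[ℝ] R4), (∀ z ∈ O₁,
      form κ (N (P z)) (L z) = 0) → ∀ d,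
      form κ (A (fderiv ℝ P z₀ d)) (L z₀) = -form κ (ν p) (L d) := by
    intro L hL d
    have hNd : HasFDerivAt N A (P z₀) := by
      rw [hP0]; exact (hN.differentiable (by simp) p).hasFDerivAt
    have h1 := hasDerivAt_comp_line (hNd.comp z₀ hPd) d
    have h2 := hasDerivAt_comp_line L.hasFDerivAt (y := z₀) d
    have h3 := HasDerivAt.form (κ := κ) h1 h2
    have h4 : HasDerivAt (fun t : ℝ => form κ ((N ∘ P) (z₀ + t • d)) (L (z₀ + t • d))) 0 0 :=
      (hasDerivAt_const (0 : ℝ) (0 : ℝ)).congr_of_eventuallyEq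
        ((eventually_line (hO₁.mem_nhds ht0) d).mono fun t ht => hL _ ht)
    have h5 := h3.unique h4
    simp only [ContinuousLinearMap.comp_apply, zero_smul, add_zero, Function.comp_apply, hP0,
      hNp] at h5
    linarith
  refine ⟨O, P, A, ⟨hOo, hOz, hPs.mono fun z hz => (hO hz).1, fun z hz => ?_, ?_, fun d => ?_,
    fun d => ?_, fun d => ?_, fun d => ?_⟩, hP0⟩
  · obtain ⟨h1, h2, h3⟩ := hO hz
    have h4 := hsol z h1
    rw [h2] at h3 h4
    exact ⟨hPS z, h4.1, h4.2, h3⟩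
  · rw [hP0]
    exact ⟨fun w h1 h2 => hpt w ((hT w).2 ⟨h1, h2⟩), fun w w' h1 h2 h3 h4 =>
      hsym w ((hT w).2 ⟨h1, h2⟩) w' ((hT w').2 ⟨h3, h4⟩), fun w h1 h2 h3 => by
      by_contra hw
      exact hdef w ((hT w).2 ⟨h1, h2⟩) hw h3⟩
  · rw [hP0]; exact ((hT _).1 (hPT d)).1
  · rw [hP0]; exact ((hT _).1 (hPT d)).2
  · rw [hP0]; exact hderiv (ContinuousLinearMap.fst ℝ R4 R4) (fun z hz => (hsol z hz).1) d
  · rw [hP0]; exact hderiv (ContinuousLinearMap.snd ℝ R4 R4) (fun z hz => (hsol z hz).2) d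

/-! ### Smoothness of the billiard map -/

theorem contDiff_refl : ContDiff ℝ ∞ fun x : R4 × R4 => refl κ x.1 x.2 :=
  ((contDiff_const.mul (contDiff_form contDiff_fst contDiff_snd)).smul contDiff_fst).sub
    contDiff_snd

/-- The symmetry of a frame `z` in the point `P z`. -/
def reflFrame (κ : ℤˣ) (P : R4 × R4 → R4) (z : R4 × R4) : R4 × R4 :=
  (refl κ (P z) z.1, refl κ (P z) z.2)

theorem contDiffOn_reflFrame {P : R4 × R4 → R4} {O : Set (R4 × R4)} (hP : ContDiffOn ℝ ∞ P O) :
    ContDiffOn ℝ ∞ (reflFrame κ P) O :=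
  (contDiff_refl.comp_contDiffOn (hP.prodMk contDiff_fst.contDiffOn)).prodMk
    (contDiff_refl.comp_contDiffOn (hP.prodMk contDiff_snd.contDiffOn))

/-- The reversal of a frame. -/
def revFrame (z : R4 × R4) : R4 × R4 := (z.1, -z.2)

theorem contDiff_revFrame : ContDiff ℝ ∞ revFrame := contDiff_fst.prodMk contDiff_snd.neg

theorem revFrame_mem {z : R4 × R4} (hz : z ∈ unitTangent κ) : revFrame z ∈ unitTangent κ := by
  refine ⟨hz.1, ?_, ?_⟩
  · simp only [revFrame, form_neg_right, hz.2.1, neg_zero]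
  · simp only [revFrame, form_neg_right, form_neg_left, hz.2.2, neg_neg]

theorem reverse_cls_geodesicOf (z : unitTangent κ) :
    (geodesicOf z).cls.reverse = (geodesicOf ⟨revFrame z, revFrame_mem z.2⟩).cls := by
  rw [← UnitGeodesic.cls_reverse, cls_eq_iff_frame 0]
  refine ⟨0, Subtype.ext ?_⟩
  rw [frame_geodesicOf]
  simp only [UnitGeodesic.frame, UnitGeodesic.reverse_apply, UnitGeodesic.deriv_reverse, neg_zero,
    geodesicOf_zero, deriv_geodesicOf_zero, revFrame]

/-- Near a frame in the table, the symmetry in the tangent point lifts to frames. -/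
theorem exists_lift (hS : IsSurface κ S) (hν : IsGaussMap κ S ν) (hc : IsCompact S)
    {z : unitTangent κ} (hz : (geodesicOf z).cls ∈ table κ S) :
    ∃ O P A, IsTangentFamily κ S ν z.1 O P A ∧ ∀ᶠ y in 𝓝 z.1, y ∈ O ∧ ∀ hy : y ∈ unitTangent κ,
      (geodesicOf ⟨y, hy⟩).cls ∈ table κ S ∧ ∃ h : reflFrame κ P y ∈ unitTangent κ,
        reflectMap κ S ν (geodesicOf ⟨y, hy⟩).cls = (geodesicOf ⟨reflFrame κ P y, h⟩).cls := by
  obtain ⟨p, hp, hgauss⟩ := (cls_mem_table hS hν hc).1 hz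
  rw [frame_geodesicOf] at hp
  rw [geodesicOf_zero, deriv_geodesicOf_zero] at hgauss
  obtain ⟨O, P, A, hfam, rfl⟩ := exists_tangentFamily hν hp
  refine ⟨O, P, A, hfam, ?_⟩
  have hPc : ContinuousAt P z.1 :=
    hfam.contDiffOn.continuousOn.continuousAt (hfam.isOpen.mem_nhds hfam.mem)
  have hne : ∀ᶠ y in 𝓝 z.1, κ = 1 → ¬(form κ (P y) y.1 = 0 ∧ form κ (P y) y.2 = 0) := by
    by_cases hκ : κ = 1
    · have hclosed : IsClosed {x : R4 × (R4 × R4) | form κ x.1 x.2.1 = 0 ∧ form κ x.1 x.2.2 = 0} :=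
        (isClosed_eq (continuous_form κ continuous_fst (continuous_fst.comp continuous_snd))
          continuous_const).inter
        (isClosed_eq (continuous_form κ continuous_fst (continuous_snd.comp continuous_snd))
          continuous_const)
      have := (hPc.tendsto.prodMk_nhds tendsto_id).eventually
        (hclosed.isOpen_compl.mem_nhds (x := (P z.1, z.1)) (hgauss hκ))
      exact this.mono fun y hy _ => hy
    · exact Eventually.of_forall fun y h => absurd h hκ
  filter_upwards [hfam.isOpen.mem_nhds hfam.mem, hne] with y hyO hy
  refine ⟨hyO, fun hyT => ?_⟩
  have ht : IsTangentAt κ S ν ((geodesicOf ⟨y, hyT⟩).frame 0).1 (P y) := by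
    rw [frame_geodesicOf]; exact hfam.isTangentAt y hyO
  refine ⟨(cls_mem_table hS hν hc).2 ⟨P y, ht, ?_⟩,
    refl_mem_unitTangent (hν.subset ht.mem) hyT, ?_⟩
  · rw [geodesicOf_zero, deriv_geodesicOf_zero]; exact hy
  · rw [reflectMap_cls hν ht, cls_eq_iff_frame 0]
    refine ⟨0, Subtype.ext ?_⟩
    rw [UnitGeodesic.frame_reflect, frame_geodesicOf, geodesicOf_zero, deriv_geodesicOf_zero]
    rfl

theorem IsTangentFamily.contDiffAt {z : R4 × R4} {O : Set (R4 × R4)} {P : R4 × R4 → R4}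
    {A : R4 →L[ℝ] R4} (h : IsTangentFamily κ S ν z O P A) :
    ContDiffAt ℝ ∞ (reflFrame κ P) z :=
  (contDiffOn_reflFrame h.contDiffOn).contDiffAt (h.isOpen.mem_nhds h.mem)

theorem isSmoothMap_billiardMap (hS : IsSurface κ S) (hν : IsGaussMap κ S ν) (hc : IsCompact S) :
    IsSmoothMap (billiardMap hS hν hc) := by
  intro z hz
  obtain ⟨O, P, A, hfam, hev⟩ := exists_lift hS hν hc hz
  refine ⟨revFrame ∘ reflFrame κ P, contDiff_revFrame.contDiffAt.comp _ hfam.contDiffAt, ?_⟩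
  filter_upwards [continuous_subtype_val.continuousAt.eventually hev] with y hy
  obtain ⟨h1, h2, h3⟩ := hy.2 y.2
  refine ⟨h1, revFrame_mem h2, ?_⟩
  change (reflectMap κ S ν (geodesicOf y).cls).reverse = _
  rw [h3, reverse_cls_geodesicOf]
  rfl

theorem isSmoothMap_billiardMap_symm (hS : IsSurface κ S) (hν : IsGaussMap κ S ν)
    (hc : IsCompact S) : IsSmoothMap (billiardMap hS hν hc).symm := by
  intro z hz
  have hz' : (geodesicOf (⟨revFrame z, revFrame_mem z.2⟩ : unitTangent κ)).cls ∈ table κ S := by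
    rw [← reverse_cls_geodesicOf]; exact hz
  obtain ⟨O, P, A, hfam, hev⟩ := exists_lift hS hν hc hz'
  refine ⟨reflFrame κ P ∘ revFrame, hfam.contDiffAt.comp z.1 contDiff_revFrame.contDiffAt, ?_⟩
  have hcont : Continuous fun y : unitTangent κ => revFrame y :=
    contDiff_revFrame.continuous.comp continuous_subtype_val
  filter_upwards [hcont.continuousAt.eventually hev] with y hy
  obtain ⟨h1, h2, h3⟩ := hy.2 (revFrame_mem y.2)
  rw [← reverse_cls_geodesicOf] at h1
  refine ⟨h1, h2, ?_⟩
  change reflectMap κ S ν (geodesicOf y).cls.reverse = _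
  rw [reverse_cls_geodesicOf, h3]
  rfl

/-! ### Jacobi fields and the fundamental form -/

theorem vol_bilinear (u v i i' j j' : R4) (a b c d : ℝ) :
    vol u v (a • i + b • i') (c • j + d • j') =
      a * c * vol u v i j + a * d * vol u v i j' + b * c * vol u v i' j +
        b * d * vol u v i' j' := by
  simp only [vol_eq, Pi.add_apply, Pi.smul_apply, smul_eq_mul]; ring

theorem form_cross (x a b c : R4) : form κ (cross κ x a b) c = vol x a b c := by
  have hk := curv_mul_self κ
  have e : curv κ * (curv κ * vol x a b (Pi.single 0 1) * c 0) =
      vol x a b (Pi.single 0 1) * c 0 := by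
    linear_combination (vol x a b (Pi.single 0 1) * c 0) * hk
  simp only [form, cross, if_true, e]
  simp [vol_eq]
  ring

/-- The cross product as a linear map of its second argument. -/
def crossL (κ : ℤˣ) (x a : R4) : R4 →L[ℝ] R4 := LinearMap.toContinuousLinearMap
  { toFun := cross κ x a
    map_add' := fun b b' => by
      funext i
      simp only [cross, vol_eq, Pi.add_apply]; ring
    map_smul' := fun r b => by
      funext i
      simp only [cross, vol_eq, Pi.smul_apply, smul_eq_mul, RingHom.id_apply]; ring }

theorem jacobi_deriv {γ : UnitGeodesic κ} (J : jacobi γ) :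
    ContDiff ℝ ∞ (J : ℝ → R4) ∧ (∀ t, form κ (γ t) (deriv (J : ℝ → R4) t) = 0) ∧
      (∀ t, form κ (deriv γ t) (deriv (J : ℝ → R4) t) = 0) ∧
      (∀ t, covD κ γ J t = deriv (J : ℝ → R4) t) ∧
      ∀ t, deriv (deriv (J : ℝ → R4)) t = -curv κ • (J : ℝ → R4) t := by
  obtain ⟨J, hJ, h1, h2, h3⟩ := J
  simp only
  have hJ' : ContDiff ℝ ∞ (deriv J) := (contDiff_infty_iff_deriv.1 hJ).2
  have e1 : ∀ t, form κ (γ t) (deriv J t) = 0 := fun t => by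
    have := form_deriv_of_const γ.smooth hJ h1 t
    rw [h2] at this
    linarith
  have e2 : ∀ t, form κ (deriv γ t) (deriv J t) = 0 := fun t => by
    have := form_deriv_of_const γ.contDiff_deriv hJ h2 t
    rw [γ.deriv_deriv, form_smul_left, h1] at this
    linarith
  have e3 : covD κ γ J = deriv J := by
    funext t
    simp only [covD, tangentProj]
    rw [form_comm, e1]
    simp
  refine ⟨hJ, e1, e2, congrFun e3, fun t => ?_⟩
  have h4 := form_deriv_of_const γ.smooth hJ' e1 t
  rw [e2, zero_add] at h4
  have h5 := h3 t
  rw [e3] at h5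
  simp only [covD, tangentProj] at h5
  rw [form_comm, h4] at h5
  rw [neg_smul, ← add_eq_zero_iff_eq_neg, ← h5]
  simp

theorem jacobi_add_apply {γ : UnitGeodesic κ} (J : jacobi γ) (t s : ℝ) :
    (J : ℝ → R4) (t + s) = cosK κ s • (J : ℝ → R4) t + sinK κ s • deriv (J : ℝ → R4) t ∧
      deriv (J : ℝ → R4) (t + s) =
        (-(curv κ * sinK κ s)) • (J : ℝ → R4) t + cosK κ s • deriv (J : ℝ → R4) t :=
  harmonic (jacobi_deriv J).1 (jacobi_deriv J).2.2.2.2 t s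

/-- The fundamental form in terms of the values and derivatives of Jacobi fields at any point of
the geodesic. -/
theorem omegaK_eq {γ : UnitGeodesic κ} (I J : jacobi γ) (c : ℝ) : omegaK γ I J =
    vol (γ c) (deriv γ c) ((I : ℝ → R4) c) ((J : ℝ → R4) c) +
      curv κ * vol (γ c) (deriv γ c) (deriv (I : ℝ → R4) c) (deriv (J : ℝ → R4) c) := by
  have hk := curv_mul_self κ
  have h0 : omegaK γ I J = vol (γ 0) (deriv γ 0) ((I : ℝ → R4) 0) ((J : ℝ → R4) 0) +
      curv κ * vol (γ 0) (deriv γ 0) (deriv (I : ℝ → R4) 0) (deriv (J : ℝ → R4) 0) := by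
    -- the cross product with `γ'` is a constant linear map
    have hcs : complexStructure γ (I : ℝ → R4) =
        fun r => crossL κ (γ 0) (deriv γ 0) ((I : ℝ → R4) r) := by
      funext r i
      change cross κ (γ r) (deriv γ r) ((I : ℝ → R4) r) i =
        cross κ (γ 0) (deriv γ 0) ((I : ℝ → R4) r) i
      simp only [cross]
      rw [← vol_swap_pairs, vol_frame γ _ _ r 0, vol_swap_pairs]
    have hd : HasDerivAt (complexStructure γ (I : ℝ → R4))
        (crossL κ (γ 0) (deriv γ 0) (deriv (I : ℝ → R4) 0)) 0 := by
      rw [hcs]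
      exact (crossL κ (γ 0) (deriv γ 0)).hasFDerivAt.comp_hasDerivAt (0 : ℝ)
        ((jacobi_deriv I).1.differentiable (by simp) 0).hasDerivAt
    rw [omegaK, gK, (jacobi_deriv J).2.2.2.1, covD, hd.deriv,
      form_tangentProj _ ((jacobi_deriv J).2.1 0), complexStructure, form_cross]
    congr 2
    exact form_cross _ _ _ _
  rw [h0]
  have hI := jacobi_add_apply I 0 c
  have hJ := jacobi_add_apply J 0 c
  rw [zero_add] at hI hJ
  have hv : ∀ x y, vol (γ c) (deriv γ c) x y = vol (γ 0) (deriv γ 0) x y := fun x y => by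
    rw [← vol_swap_pairs, vol_frame γ _ _ c 0, vol_swap_pairs]
  rw [hv, hv, hI.1, hI.2, hJ.1, hJ.2, vol_bilinear, vol_bilinear]
  have hc := cosK_sq_add κ c
  generalize vol (γ 0) (deriv γ 0) ((I : ℝ → R4) 0) ((J : ℝ → R4) 0) = A at *
  generalize vol (γ 0) (deriv γ 0) (deriv (I : ℝ → R4) 0) (deriv (J : ℝ → R4) 0) = B at *
  generalize vol (γ 0) (deriv γ 0) ((I : ℝ → R4) 0) (deriv (J : ℝ → R4) 0) = C at *
  generalize vol (γ 0) (deriv γ 0) (deriv (I : ℝ → R4) 0) ((J : ℝ → R4) 0) = D at *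
  linear_combination (-(A + curv κ * B)) * hc + (cosK κ c * sinK κ c * (C + D)
    - sinK κ c * sinK κ c * (curv κ * A) + sinK κ c * sinK κ c * B) * hk

/-- The Jacobi field along `γ` with prescribed value and derivative at `0`. -/
def jacobiOf (γ : UnitGeodesic κ) {a b : R4} (ha : form κ a (γ 0) = 0 ∧ form κ a (deriv γ 0) = 0)
    (hb : form κ b (γ 0) = 0 ∧ form κ b (deriv γ 0) = 0) : jacobi γ := by
  refine ⟨fun r => cosK κ r • a + sinK κ r • b, ?_⟩
  have hd1 : deriv (fun r => cosK κ r • a + sinK κ r • b) =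
      fun r => (-(curv κ * sinK κ r)) • a + cosK κ r • b := funext fun r =>
    (((hasDerivAt_cosK κ r).smul_const a).add ((hasDerivAt_sinK κ r).smul_const b)).deriv
  have hd2 : ∀ r, deriv (fun r => (-(curv κ * sinK κ r)) • a + cosK κ r • b) r =
      -curv κ • (cosK κ r • a + sinK κ r • b) := fun r => by
    have := ((((hasDerivAt_sinK κ r).const_mul (curv κ)).neg).smul_const a).add
      ((hasDerivAt_cosK κ r).smul_const b)
    refine this.deriv.trans ?_
    module
  have h0 : ∀ r s t : ℝ, form κ (γ r) (s • a + t • b) = 0 ∧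
      form κ (deriv γ r) (s • a + t • b) = 0 := fun r s t => by
    have e1 := orthogonal_frame_change ha r
    have e2 := orthogonal_frame_change hb r
    simp only [form_add_right, form_smul_right, form_comm κ _ a, form_comm κ _ b, e1.1, e1.2,
      e2.1, e2.2]
    simp
  have hcov : covD κ γ (fun r => cosK κ r • a + sinK κ r • b) =
      fun r => (-(curv κ * sinK κ r)) • a + cosK κ r • b := by
    funext r
    simp only [covD, tangentProj, hd1]
    rw [form_comm, (h0 r _ _).1]
    simp
  refine ⟨((contDiff_cosK κ).smul contDiff_const).add ((contDiff_sinK κ).smul contDiff_const),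
    fun r => (h0 r _ _).1, fun r => (h0 r _ _).2, fun r => ?_⟩
  rw [hcov]
  simp only [covD, tangentProj, hd2]
  rw [form_comm, form_smul_right, (h0 r _ _).1]
  module

theorem deriv_jacobiOf_zero (γ : UnitGeodesic κ) {a b : R4}
    (ha : form κ a (γ 0) = 0 ∧ form κ a (deriv γ 0) = 0)
    (hb : form κ b (γ 0) = 0 ∧ form κ b (deriv γ 0) = 0) :
    deriv (jacobiOf γ ha hb : ℝ → R4) 0 = b := by
  have : HasDerivAt (jacobiOf γ ha hb : ℝ → R4) ((-(curv κ * sinK κ 0)) • a + cosK κ 0 • b) 0 :=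
    ((hasDerivAt_cosK κ 0).smul_const a).add ((hasDerivAt_sinK κ 0).smul_const b)
  rw [this.deriv, sinK_zero, cosK_zero]
  simp

/-- `x` is tangent to the unit tangent bundle at `z`. -/
structure IsTangentFrame (κ : ℤˣ) (z x : R4 × R4) : Prop where
  fst : form κ x.1 z.1 = 0
  snd : form κ x.2 z.2 = 0
  mixed : form κ x.1 z.2 + form κ x.2 z.1 = 0

/-- The component of a tangent vector of the unit tangent bundle transversal to the geodesic
flow. -/
def transversal (κ : ℤˣ) (z : R4 × R4) : R4 × R4 →ₗ[ℝ] R4 × R4 where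
  toFun x := (x.1 - form κ x.1 z.2 • z.2, x.2 + (curv κ * form κ x.1 z.2) • z.1)
  map_add' x y := by
    simp only [Prod.fst_add, Prod.snd_add, form_add_left, Prod.mk_add_mk, Prod.mk.injEq]
    constructor <;> module
  map_smul' r x := by
    simp only [Prod.smul_fst, Prod.smul_snd, form_smul_left, Prod.smul_mk, RingHom.id_apply,
      Prod.mk.injEq]
    constructor <;> module

theorem transversal_apply (z x : R4 × R4) : transversal κ z x =
    (x.1 - form κ x.1 z.2 • z.2, x.2 + (curv κ * form κ x.1 z.2) • z.1) := rfl

theorem transversal_orthogonal {z x : R4 × R4} (hz : z ∈ unitTangent κ)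
    (hx : IsTangentFrame κ z x) :
    (form κ (transversal κ z x).1 z.1 = 0 ∧ form κ (transversal κ z x).1 z.2 = 0) ∧
      form κ (transversal κ z x).2 z.1 = 0 ∧ form κ (transversal κ z x).2 z.2 = 0 := by
  obtain ⟨⟨h1, -⟩, h2, h3⟩ := hz
  obtain ⟨k1, k2, k3⟩ := hx
  simp only [transversal_apply, form_sub_left, form_add_left, form_smul_left, h1, h2, h3,
    form_comm κ z.2 z.1, k1, k2]
  refine ⟨⟨by ring, by ring⟩, ?_, by ring⟩
  linear_combination k3 + form κ x.1 z.2 * curv_mul_self κ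

/-- The part orthogonal to `γ'` of the variation field with initial data `x`. -/
theorem variation_orthogonal {γ : UnitGeodesic κ} {c : ℝ} {x : R4 × R4}
    (hx : IsTangentFrame κ (γ.frame c).1 x) (r : ℝ) :
    (cosK κ r • x.1 + sinK κ r • x.2) -
      form κ (cosK κ r • x.1 + sinK κ r • x.2) (deriv γ (c + r)) • deriv γ (c + r) =
    cosK κ r • (transversal κ (γ.frame c).1 x).1 +
      sinK κ r • (transversal κ (γ.frame c).1 x).2 := by
  obtain ⟨k1, k2, k3⟩ := hx
  simp only [UnitGeodesic.frame] at k1 k2 k3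
  have e : form κ (cosK κ r • x.1 + sinK κ r • x.2) (deriv γ (c + r)) =
      form κ x.1 (deriv γ c) := by
    rw [γ.deriv_add_apply]
    simp only [form_add_left, form_add_right, form_smul_left, form_smul_right, k1, k2]
    linear_combination (form κ x.1 (deriv γ c)) * cosK_sq_add κ r
      - (curv κ * sinK κ r * sinK κ r) * k3
  rw [e, γ.deriv_add_apply]
  simp only [transversal_apply, UnitGeodesic.frame]
  module

/-! ### Invariance of the fundamental form -/

/-- The infinitesimal rotation by which the symmetry `refl κ p` changes, up to the symmetry itself,
when `p` moves with velocity `q`. -/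
def twist (κ : ℤˣ) (p q x : R4) : R4 :=
  (2 * curv κ * form κ q x) • p - (2 * curv κ * form κ p x) • q

theorem form_twist_skew (p q x y : R4) :
    form κ (twist κ p q x) y + form κ (twist κ p q y) x = 0 := by
  simp only [twist, form_sub_left, form_smul_left]; ring

theorem HasDerivAt.refl {p x : ℝ → R4} {p' x' : R4} {t : ℝ} (hp : HasDerivAt p p' t)
    (hx : HasDerivAt x x' t) (hpp : OuterBilliard.form κ (p t) (p t) = curv κ)
    (hpp' : OuterBilliard.form κ (p t) p' = 0) :
    HasDerivAt (fun t => OuterBilliard.refl κ (p t) (x t))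
      (OuterBilliard.refl κ (p t) (x' + twist κ (p t) p' (x t))) t := by
  have h := (((HasDerivAt.form (κ := κ) hp hx).const_mul (2 * curv κ)).smul hp).sub hx
  refine h.congr_deriv ?_
  have e : (2 * curv κ * (2 * curv κ * OuterBilliard.form κ p' (x t) * curv κ)) =
      2 * (2 * curv κ * OuterBilliard.form κ p' (x t)) := by
    linear_combination (4 * curv κ * OuterBilliard.form κ p' (x t)) * curv_mul_self κ
  simp only [OuterBilliard.refl, twist, form_add_right, form_sub_right, form_smul_right, hpp, hpp',
    mul_add, mul_sub, e]
  module

/-- The fundamental form in terms of tangent vectors of the unit tangent bundle. -/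
def frameForm (κ : ℤˣ) (z x y : R4 × R4) : ℝ :=
  vol z.1 z.2 x.1 y.1 + curv κ * vol z.1 z.2 x.2 y.2

theorem frameForm_transversal (z x y : R4 × R4) :
    frameForm κ z (transversal κ z x) (transversal κ z y) = frameForm κ z x y := by
  have e1 : ∀ (u v i j : R4) (a b : ℝ), vol u v (i - a • v) (j - b • v) = vol u v i j := by
    intro u v i j a b
    simp only [vol_eq, Pi.sub_apply, Pi.smul_apply, smul_eq_mul]; ring
  have e2 : ∀ (u v i j : R4) (a b : ℝ), vol u v (i + a • u) (j + b • u) = vol u v i j := by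
    intro u v i j a b
    simp only [vol_eq, Pi.add_apply, Pi.smul_apply, smul_eq_mul]; ring
  simp only [frameForm, transversal_apply, e1, e2]

/-- A vector of the linear hull of the plane of `u`, `v` and `p` in coordinates. -/
theorem exists_combination {p n u v w : R4} (hn : form κ n n = 1) (hp : form κ n p = 0)
    (hu : form κ n u = 0) (hv : form κ n v = 0) (hvol : vol p n u v ≠ 0) (hw : form κ n w = 0) :
    ∃ x y e : ℝ, w = x • u + y • v + e • p := by
  have h := cramer w p n u v
  rw [vol_eq_mul_form hn hp hu hv w, hw, mul_zero, zero_smul, add_zero] at h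
  refine ⟨(vol p n u v)⁻¹ * vol p n w v, (vol p n u v)⁻¹ * vol p n u w,
    (vol p n u v)⁻¹ * vol w n u v, ?_⟩
  rw [mul_smul, mul_smul, mul_smul, ← smul_add, ← smul_add, eq_inv_smul_iff₀ hvol, h]
  module

/-- The symmetry of the shape operator makes the contributions of the motion of the tangent point
to the fundamental form cancel. -/
theorem frameForm_add_twist {p n : R4} {z d d' : R4 × R4} {A : R4 →L[ℝ] R4}
    (hn : form κ n n = 1) (hnp : form κ n p = 0) (hz : z ∈ unitTangent κ)
    (hu : form κ n z.1 = 0) (hv : form κ n z.2 = 0) (hvol : vol p n z.1 z.2 ≠ 0)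
    (hA : IsShape κ p n A) {q q' : R4} (hq : form κ p q = 0 ∧ form κ n q = 0)
    (hq' : form κ p q' = 0 ∧ form κ n q' = 0)
    (h1 : form κ (A q) z.1 = -form κ n d.1) (h2 : form κ (A q) z.2 = -form κ n d.2)
    (h1' : form κ (A q') z.1 = -form κ n d'.1) (h2' : form κ (A q') z.2 = -form κ n d'.2) :
    frameForm κ z (d.1 + twist κ p q z.1, d.2 + twist κ p q z.2)
      (d'.1 + twist κ p q' z.1, d'.2 + twist κ p q' z.2) = frameForm κ z d d' := by
  obtain ⟨u, v⟩ := z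
  obtain ⟨⟨huu, -⟩, huv, hvv⟩ := hz
  simp only at *
  have hk := curv_mul_self κ
  -- modulo the plane of `u` and `v`, the rotations only contribute multiples of `p`
  have key : ∀ q, form κ n q = 0 → ∃ x y e : ℝ, q = x • u + y • v + e • p ∧
      (twist κ p q u = (2 * x) • p + (-2 * curv κ * form κ p u) • (x • u + y • v)) ∧
      twist κ p q v = (2 * curv κ * y) • p + (-2 * curv κ * form κ p v) • (x • u + y • v) := by
    intro q hq
    obtain ⟨x, y, e, rfl⟩ := exists_combination hn hnp hu hv hvol hq
    refine ⟨x, y, e, rfl, ?_, ?_⟩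
    · have : 2 * curv κ * form κ (x • u + y • v + e • p) u =
          2 * x + 2 * curv κ * form κ p u * e := by
        simp only [form_add_left, form_smul_left, huu, form_comm κ v u, huv]
        linear_combination (2 * x) * hk
      rw [twist, this]
      module
    · have : 2 * curv κ * form κ (x • u + y • v + e • p) v =
          2 * curv κ * y + 2 * curv κ * form κ p v * e := by
        simp only [form_add_left, form_smul_left, hvv, huv]
        ring
      rw [twist, this]
      module
  obtain ⟨x, y, e, hqe, t1, t2⟩ := key q hq.2
  obtain ⟨x', y', e', hqe', t1', t2'⟩ := key q' hq'.2
  have hsymm := hA.symm q q' hq.1 hq.2 hq'.1 hq'.2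
  have hp1 := hA.form_point q hq.1 hq.2
  have hp2 := hA.form_point q' hq'.1 hq'.2
  have e1 : form κ (A q) q' = x' * form κ (A q) u + y' * form κ (A q) v := by
    have := congrArg (form κ (A q)) hqe'
    simpa only [form_add_right, form_smul_right, hp1, mul_zero, add_zero] using this
  have e2 : form κ (A q') q = x * form κ (A q') u + y * form κ (A q') v := by
    have := congrArg (form κ (A q')) hqe
    simpa only [form_add_right, form_smul_right, hp2, mul_zero, add_zero] using this
  rw [e1, e2, h1, h2, h1', h2'] at hsymm
  have hexp : ∀ (i j : R4) (a b c f g k : ℝ),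
      vol u v (i + (a • p + c • (f • u + g • v))) (j + (b • p + k • (x' • u + y' • v))) =
        vol u v i j + a * vol p j u v - b * vol p i u v := by
    intro i j a b c f g k
    simp only [vol_eq, Pi.add_apply, Pi.smul_apply, smul_eq_mul]; ring
  simp only [frameForm]
  rw [t1, t2, t1', t2', hexp, hexp, vol_eq_mul_form hn hnp hu hv d.1,
    vol_eq_mul_form hn hnp hu hv d.2, vol_eq_mul_form hn hnp hu hv d'.1,
    vol_eq_mul_form hn hnp hu hv d'.2]
  linear_combination (2 * vol p n u v) * hsymm +
    (2 * vol p n u v * (y * form κ n d'.2 - y' * form κ n d.2)) * hk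

namespace IsTangentFamily

variable {z : R4 × R4} {O : Set (R4 × R4)} {P : R4 × R4 → R4} {A : R4 →L[ℝ] R4}

theorem fderiv_apply (hν : IsGaussMap κ S ν) (h : IsTangentFamily κ S ν z O P A) (d : R4 × R4) :
    fderiv ℝ (revFrame ∘ reflFrame κ P) z d =
      (refl κ (P z) (d.1 + twist κ (P z) (fderiv ℝ P z d) z.1),
        -refl κ (P z) (d.2 + twist κ (P z) (fderiv ℝ P z d) z.2)) := by
  have hdiff : DifferentiableAt ℝ (revFrame ∘ reflFrame κ P) z :=
    (contDiff_revFrame.contDiffAt.comp z h.contDiffAt).differentiableAt (by simp)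
  have hP : DifferentiableAt ℝ P z :=
    (h.contDiffOn.contDiffAt (h.isOpen.mem_nhds h.mem)).differentiableAt (by simp)
  have e0 : z + (0 : ℝ) • d = z := by simp
  have hΘ := hasDerivAt_comp_line hdiff.hasFDerivAt d
  have hPl := hasDerivAt_comp_line hP.hasFDerivAt d
  have hl1 : HasDerivAt (fun t : ℝ => (z + t • d).1) d.1 0 :=
    hasDerivAt_comp_line (ContinuousLinearMap.fst ℝ R4 R4).hasFDerivAt d
  have hl2 : HasDerivAt (fun t : ℝ => (z + t • d).2) d.2 0 :=
    hasDerivAt_comp_line (ContinuousLinearMap.snd ℝ R4 R4).hasFDerivAt d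
  have hp : form κ (P (z + (0 : ℝ) • d)) (P (z + (0 : ℝ) • d)) = curv κ := by
    rw [e0]; exact (hν.subset (h.isTangentAt z h.mem).mem).1
  have hq : form κ (P (z + (0 : ℝ) • d)) (fderiv ℝ P z d) = 0 := by
    rw [e0]; exact h.form_point d
  have h1 := HasDerivAt.refl (κ := κ) hPl hl1 hp hq
  have h2 := (HasDerivAt.refl (κ := κ) hPl hl2 hp hq).neg
  have := hΘ.unique (h1.prodMk h2)
  simpa only [Function.comp_apply, e0] using this

theorem isTangentFrame (hν : IsGaussMap κ S ν) (h : IsTangentFamily κ S ν z O P A) {d : R4 × R4}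
    (hd : IsTangentFrame κ z d) : IsTangentFrame κ ((revFrame ∘ reflFrame κ P) z)
      (fderiv ℝ (revFrame ∘ reflFrame κ P) z d) := by
  have hp := (hν.subset (h.isTangentAt z h.mem).mem).1
  obtain ⟨k1, k2, k3⟩ := hd
  have hs := form_twist_skew (κ := κ) (P z) (fderiv ℝ P z d)
  rw [h.fderiv_apply hν]
  refine ⟨?_, ?_, ?_⟩ <;>
    simp only [revFrame, reflFrame, Function.comp_apply, form_neg_left, form_neg_right,
      form_refl_refl hp, form_add_left]
  · linarith [hs z.1 z.1]
  · linarith [hs z.2 z.2]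
  · linarith [hs z.1 z.2]

theorem frameForm_fderiv (hν : IsGaussMap κ S ν) (h : IsTangentFamily κ S ν z O P A)
    (hz : z ∈ unitTangent κ) (d d' : R4 × R4) :
    frameForm κ ((revFrame ∘ reflFrame κ P) z) (fderiv ℝ (revFrame ∘ reflFrame κ P) z d)
      (fderiv ℝ (revFrame ∘ reflFrame κ P) z d') = frameForm κ z d d' := by
  have ht := h.isTangentAt z h.mem
  have hp := (hν.subset ht.mem).1
  rw [← frameForm_add_twist (hν.form_self _ ht.mem) (hν.form_point _ ht.mem) hz ht.form_fst
    ht.form_snd ht.vol_pos.ne' h.shape ⟨h.form_point d, h.form_normal d⟩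
    ⟨h.form_point d', h.form_normal d'⟩ (h.eq_fst d) (h.eq_snd d) (h.eq_fst d') (h.eq_snd d'),
    h.fderiv_apply hν, h.fderiv_apply hν]
  have e : ∀ a b c d : R4, vol a (-b) c d = -vol a b c d := fun a b c d => by
    simp only [vol_eq, Pi.neg_apply]; ring
  simp only [frameForm, revFrame, reflFrame, Function.comp_apply, e, vol_neg_three, vol_neg_four,
    vol_refl hp]
  ring

/-- The tangent point does not move along the geodesic flow. -/
theorem fderiv_flow (hν : IsGaussMap κ S ν) (h : IsTangentFamily κ S ν z O P A) :
    fderiv ℝ P z (z.2, -curv κ • z.1) = 0 := by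
  have ht := h.isTangentAt z h.mem
  set d : R4 × R4 := (z.2, -curv κ • z.1)
  set q := fderiv ℝ P z d
  have h1 : form κ (A q) z.1 = 0 := by rw [h.eq_fst d, ht.form_snd, neg_zero]
  have h2 : form κ (A q) z.2 = 0 := by
    rw [h.eq_snd d, form_smul_right, ht.form_fst, mul_zero, neg_zero]
  have h3 := h.shape.form_point q (h.form_point d) (h.form_normal d)
  obtain ⟨x, y, e, hc⟩ := exists_combination (hν.form_self _ ht.mem) (hν.form_point _ ht.mem)
    ht.form_fst ht.form_snd ht.vol_pos.ne' (h.form_normal d)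
  refine h.shape.definite q (h.form_point d) (h.form_normal d) ?_
  have := congrArg (form κ (A q)) hc
  simpa only [form_add_right, form_smul_right, h1, h2, h3, mul_zero, add_zero] using this

/-- The geodesic flow does not contribute to the transversal part of the differential. -/
theorem transversal_fderiv (hν : IsGaussMap κ S ν) (h : IsTangentFamily κ S ν z O P A)
    (hz : z ∈ unitTangent κ) (d : R4 × R4) :
    transversal κ ((revFrame ∘ reflFrame κ P) z)
      (fderiv ℝ (revFrame ∘ reflFrame κ P) z (transversal κ z d)) =
    transversal κ ((revFrame ∘ reflFrame κ P) z) (fderiv ℝ (revFrame ∘ reflFrame κ P) z d) := by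
  have hp := (hν.subset (h.isTangentAt z h.mem).mem).1
  have hd : d = transversal κ z d + form κ d.1 z.2 • (z.2, -curv κ • z.1) := by
    rw [transversal_apply]
    ext1
    · simp
    · simp only [Prod.snd_add, Prod.smul_snd]; module
  have h0 : transversal κ ((revFrame ∘ reflFrame κ P) z)
      (fderiv ℝ (revFrame ∘ reflFrame κ P) z (z.2, -curv κ • z.1)) = 0 := by
    have hm : form κ (refl κ (P z) z.2) (refl κ (P z) z.2) = 1 := by
      rw [form_refl_refl hp]; exact hz.2.2
    have e0 : ∀ x, twist κ (P z) 0 x = 0 := fun x => by simp [twist, form_zero_left]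
    rw [h.fderiv_apply hν, h.fderiv_flow hν]
    simp only [e0, add_zero, transversal_apply, revFrame, reflFrame, Function.comp_apply,
      form_neg_right, hm, refl_smul]
    ext1 <;> simp only [Prod.fst_zero, Prod.snd_zero] <;> module
  conv_rhs => rw [hd, map_add, map_smul, map_add, map_smul, h0, smul_zero, add_zero]

end IsTangentFamily

/-! ### The differential of the billiard map -/

/-- The value and the derivative at `c` of the Jacobi fields along `γ`. -/
def jacobiJet (γ : UnitGeodesic κ) (c : ℝ) : jacobi γ →ₗ[ℝ] R4 × R4 where
  toFun J := ((J : ℝ → R4) c, deriv (J : ℝ → R4) c)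
  map_add' I J := Prod.ext rfl (deriv_add ((jacobi_deriv I).1.differentiable (by simp) c)
    ((jacobi_deriv J).1.differentiable (by simp) c))
  map_smul' a J := Prod.ext rfl (deriv_const_smul a ((jacobi_deriv J).1.differentiable (by simp) c))

theorem jacobiJet_apply {γ : UnitGeodesic κ} (J : jacobi γ) (c : ℝ) :
    jacobiJet γ c J = ((J : ℝ → R4) c, deriv (J : ℝ → R4) c) := rfl

theorem isTangentFrame_jacobiJet {γ : UnitGeodesic κ} (J : jacobi γ) (c : ℝ) :
    IsTangentFrame κ (γ.frame c).1 (jacobiJet γ c J) := by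
  obtain ⟨-, h1, h2, -⟩ := jacobi_deriv J
  refine ⟨?_, ?_, ?_⟩ <;> simp only [jacobiJet_apply, UnitGeodesic.frame, form_comm κ _ (γ c),
    form_comm κ _ (deriv γ c)]
  · exact J.2.2.1 c
  · exact h2 c
  · rw [J.2.2.2.1 c, h1, add_zero]

/-- The frames of a smooth family of geodesics depend smoothly on the parameter. -/
theorem contDiffOn_frame {φ : ℝ → UnitGeodesic κ} {δ : ℝ}
    (h : ContDiffOn ℝ ∞ (fun q : ℝ × ℝ => φ q.2 q.1) (univ ×ˢ Ioo (-δ) δ)) (c : ℝ) :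
    ContDiffOn ℝ ∞ (fun s => ((φ s).frame c).1) (Ioo (-δ) δ) := by
  have h1 : ∀ r, ContDiffOn ℝ ∞ (fun s => φ s r) (Ioo (-δ) δ) := fun r =>
    h.comp (contDiff_const.prodMk contDiff_id).contDiffOn fun s hs => ⟨mem_univ r, hs⟩
  refine (h1 c).prodMk ?_
  -- the velocity is determined by the values at two points
  have hs1 : sinK κ 1 ≠ 0 := (sinK_pos one_pos fun _ => by linarith [Real.pi_gt_three]).ne'
  have e : (fun s => deriv (φ s) c) =
      fun s => (sinK κ 1)⁻¹ • (φ s (c + 1) - cosK κ 1 • φ s c) := by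
    funext s
    rw [(φ s).add_apply, add_sub_cancel_left, inv_smul_smul₀ hs1]
  rw [e]
  exact ((h1 _).sub ((h1 _).const_smul _)).const_smul _

theorem isTangentFrame_of_hasDerivAt {w : ℝ → R4 × R4} {x : R4 × R4} {s : ℝ}
    (h : HasDerivAt w x s) (hw : ∀ s, w s ∈ unitTangent κ) : IsTangentFrame κ (w s) x := by
  have h1 : HasDerivAt (fun s => (w s).1) x.1 s :=
    (ContinuousLinearMap.fst ℝ R4 R4).hasFDerivAt.comp_hasDerivAt s h
  have h2 : HasDerivAt (fun s => (w s).2) x.2 s :=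
    (ContinuousLinearMap.snd ℝ R4 R4).hasFDerivAt.comp_hasDerivAt s h
  have hconst : ∀ {X Y : ℝ → R4} {X' Y' : R4} (a : ℝ), HasDerivAt X X' s → HasDerivAt Y Y' s →
      (∀ s, form κ (X s) (Y s) = a) → form κ X' (Y s) + form κ (X s) Y' = 0 := by
    intro X Y X' Y' a hX hY h
    have := HasDerivAt.form (κ := κ) hX hY
    rw [funext h] at this
    exact this.unique (hasDerivAt_const s a)
  have e1 := hconst _ h1 h1 fun s => (hw s).1.1
  have e2 := hconst _ h2 h2 fun s => (hw s).2.2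
  have e3 := hconst _ h1 h2 fun s => (hw s).2.1
  rw [form_comm κ (w s).1] at e1 e3
  rw [form_comm κ (w s).2] at e2
  exact ⟨by linarith, by linarith, e3⟩

/-- The velocity of a variation in terms of the derivative of the frames. -/
theorem velocity_eq {γ : UnitGeodesic κ} {φ : ℝ → UnitGeodesic κ} {w : ℝ → R4 × R4}
    {x : R4 × R4} {c : ℝ} (hw : HasDerivAt w x 0)
    (hφ : ∀ᶠ s in 𝓝 (0 : ℝ), w s = ((φ s).frame c).1)
    (hx : IsTangentFrame κ (γ.frame c).1 x) (r : ℝ) :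
    velocity γ φ (c + r) = cosK κ r • (transversal κ (γ.frame c).1 x).1 +
      sinK κ r • (transversal κ (γ.frame c).1 x).2 := by
  have h1 : HasDerivAt (fun s => (w s).1) x.1 0 :=
    (ContinuousLinearMap.fst ℝ R4 R4).hasFDerivAt.comp_hasDerivAt 0 hw
  have h2 : HasDerivAt (fun s => (w s).2) x.2 0 :=
    (ContinuousLinearMap.snd ℝ R4 R4).hasFDerivAt.comp_hasDerivAt 0 hw
  have h3 : HasDerivAt (fun s => φ s (c + r)) (cosK κ r • x.1 + sinK κ r • x.2) 0 := by
    refine ((h1.const_smul (cosK κ r)).add (h2.const_smul (sinK κ r))).congr_of_eventuallyEq ?_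
    filter_upwards [hφ] with s hs
    rw [(φ s).add_apply]
    simp only [Pi.add_apply, Pi.smul_apply, hs, UnitGeodesic.frame]
  rw [velocity, h3.deriv]
  exact variation_orthogonal hx r

/-- The linear map of Jacobi fields induced by a linear map of tangent vectors of the unit tangent
bundle at the frames `γ.frame c` and `σ.frame 0`. -/
def jacobiMap (γ σ : UnitGeodesic κ) (c : ℝ) (T : R4 × R4 →ₗ[ℝ] R4 × R4)
    (hT : ∀ x, IsTangentFrame κ (γ.frame c).1 x → IsTangentFrame κ (σ.frame 0).1 (T x)) :
    jacobi γ →ₗ[ℝ] jacobi σ where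
  toFun J := jacobiOf σ
    (transversal_orthogonal (σ.frame 0).2 (hT _ (isTangentFrame_jacobiJet J c))).1
    (transversal_orthogonal (σ.frame 0).2 (hT _ (isTangentFrame_jacobiJet J c))).2
  map_add' I J := Subtype.ext (funext fun r => by
    let L := (transversal κ (σ.frame 0).1 ∘ₗ T) ∘ₗ jacobiJet γ c
    change cosK κ r • (L (I + J)).1 + sinK κ r • (L (I + J)).2 =
      (cosK κ r • (L I).1 + sinK κ r • (L I).2) + (cosK κ r • (L J).1 + sinK κ r • (L J).2)
    rw [map_add, Prod.fst_add, Prod.snd_add]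
    module)
  map_smul' a J := Subtype.ext (funext fun r => by
    let L := (transversal κ (σ.frame 0).1 ∘ₗ T) ∘ₗ jacobiJet γ c
    change cosK κ r • (L (a • J)).1 + sinK κ r • (L (a • J)).2 =
      a • (cosK κ r • (L J).1 + sinK κ r • (L J).2)
    rw [map_smul, Prod.smul_fst, Prod.smul_snd]
    module)

theorem jacobiMap_apply {γ σ : UnitGeodesic κ} {c : ℝ} {T : R4 × R4 →ₗ[ℝ] R4 × R4}
    (hT : ∀ x, IsTangentFrame κ (γ.frame c).1 x → IsTangentFrame κ (σ.frame 0).1 (T x))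
    (J : jacobi γ) (r : ℝ) : (jacobiMap γ σ c T hT J : ℝ → R4) r =
      cosK κ r • (transversal κ (σ.frame 0).1 (T (jacobiJet γ c J))).1 +
        sinK κ r • (transversal κ (σ.frame 0).1 (T (jacobiJet γ c J))).2 := rfl

theorem omegaK_eq_frameForm {γ : UnitGeodesic κ} (I J : jacobi γ) (c : ℝ) : omegaK γ I J =
    frameForm κ (γ.frame c).1 (jacobiJet γ c I) (jacobiJet γ c J) := omegaK_eq I J c

theorem omegaK_jacobiMap {γ σ : UnitGeodesic κ} {c : ℝ} {T : R4 × R4 →ₗ[ℝ] R4 × R4}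
    (hT : ∀ x, IsTangentFrame κ (γ.frame c).1 x → IsTangentFrame κ (σ.frame 0).1 (T x))
    (hform : ∀ x y, frameForm κ (σ.frame 0).1 (T x) (T y) = frameForm κ (γ.frame c).1 x y)
    (I J : jacobi γ) :
    omegaK σ (jacobiMap γ σ c T hT I) (jacobiMap γ σ c T hT J) = omegaK γ I J := by
  have e : ∀ J : jacobi γ, jacobiJet σ 0 (jacobiMap γ σ c T hT J) =
      transversal κ (σ.frame 0).1 (T (jacobiJet γ c J)) := fun J => by
    have hj := transversal_orthogonal (σ.frame 0).2 (hT _ (isTangentFrame_jacobiJet J c))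
    refine Prod.ext ?_ (deriv_jacobiOf_zero σ hj.1 hj.2)
    simp only [jacobiJet_apply, jacobiMap_apply, cosK_zero, sinK_zero, one_smul, zero_smul,
      add_zero]
  rw [omegaK_eq_frameForm _ _ 0, e, e, frameForm_transversal, hform, omegaK_eq_frameForm I J c]

/-- A map with a smooth lift `Θ` to frames has a differential, induced by the derivative of `Θ`. -/
theorem isDifferential_jacobiMap {U V : Set (OrientedGeodesic κ)} {f : U → V}
    {γ σ : UnitGeodesic κ} {c : ℝ} {Θ : R4 × R4 → R4 × R4}
    {O : Set (R4 × R4)} (hO : IsOpen O) (hmem : (γ.frame c).1 ∈ O) (hΘ : ContDiffOn ℝ ∞ Θ O)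
    (h0 : Θ (γ.frame c).1 = (σ.frame 0).1)
    (hlift : ∀ᶠ y in 𝓝 (γ.frame c).1, ∀ hy : y ∈ unitTangent κ,
      ∃ (hU : (geodesicOf ⟨y, hy⟩).cls ∈ U) (h : Θ y ∈ unitTangent κ),
        (f ⟨_, hU⟩ : OrientedGeodesic κ) = (geodesicOf ⟨Θ y, h⟩).cls)
    (hT : ∀ x, IsTangentFrame κ (γ.frame c).1 x →
      IsTangentFrame κ (σ.frame 0).1 ((fderiv ℝ Θ (γ.frame c).1).toLinearMap x))
    (htrans : ∀ x, transversal κ (σ.frame 0).1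
      (fderiv ℝ Θ (γ.frame c).1 (transversal κ (γ.frame c).1 x)) =
        transversal κ (σ.frame 0).1 (fderiv ℝ Θ (γ.frame c).1 x)) :
    IsDifferential f γ σ (jacobiMap γ σ c (fderiv ℝ Θ (γ.frame c).1).toLinearMap hT) := by
  classical
  rintro J φ ⟨hφ0, δ, hδ, hφ⟩ hvel
  have hw := contDiffOn_frame hφ c
  set w : ℝ → R4 × R4 := fun s => ((φ s).frame c).1 with hwdef
  have hw0 : w 0 = (γ.frame c).1 := by rw [hwdef]; simp only [hφ0]
  have hwd : HasDerivAt w (deriv w 0) 0 :=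
    ((hw.contDiffAt (Ioo_mem_nhds (neg_lt_zero.2 hδ) hδ)).differentiableAt (by simp)).hasDerivAt
  set x := deriv w 0
  have hx : IsTangentFrame κ (γ.frame c).1 x := by
    rw [← hw0]; exact isTangentFrame_of_hasDerivAt hwd fun s => ((φ s).frame c).2
  -- the value and the derivative of the Jacobi field at `c`
  have hJ : transversal κ (γ.frame c).1 x = jacobiJet γ c J := by
    have h1 : ∀ r, (J : ℝ → R4) (c + r) = cosK κ r • (transversal κ (γ.frame c).1 x).1 +
        sinK κ r • (transversal κ (γ.frame c).1 x).2 := fun r => by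
      rw [← hvel]
      exact velocity_eq hwd (Eventually.of_forall fun _ => rfl) hx r
    have e0 : (transversal κ (γ.frame c).1 x).1 = (J : ℝ → R4) c := by
      simpa [cosK_zero, sinK_zero] using (h1 0).symm
    have hs1 : sinK κ 1 ≠ 0 := (sinK_pos one_pos fun _ => by linarith [Real.pi_gt_three]).ne'
    have e1 := h1 1
    rw [(jacobi_add_apply J c 1).1, e0, add_right_inj] at e1
    exact Prod.ext e0 (smul_right_injective _ hs1 e1).symm
  have hcont : ContinuousAt w 0 := hwd.continuousAt
  have hev : ∀ᶠ s in 𝓝 (0 : ℝ), w s ∈ O ∧ ∃ (hU : (φ s).cls ∈ U) (h : Θ (w s) ∈ unitTangent κ),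
      (f ⟨_, hU⟩ : OrientedGeodesic κ) = (geodesicOf ⟨Θ (w s), h⟩).cls := by
    rw [← hw0] at hlift hmem
    filter_upwards [hcont.eventually hlift, hcont.eventually (hO.mem_nhds hmem)] with s hs hsO
    obtain ⟨hU, h, hf⟩ := hs ((φ s).frame c).2
    refine ⟨hsO, ?_⟩
    have e : (geodesicOf ⟨w s, ((φ s).frame c).2⟩).cls = (φ s).cls := cls_geodesicOf_frame _ _
    simp only [e] at hU hf
    exact ⟨hU, h, hf⟩
  -- away from `s = 0` the lift need not be a frame, and any geodesic will do
  let ψ : ℝ → UnitGeodesic κ := fun s =>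
    if h : Θ (w s) ∈ unitTangent κ then geodesicOf ⟨Θ (w s), h⟩ else σ
  have hψ : ∀ s (h : Θ (w s) ∈ unitTangent κ), ψ s = geodesicOf ⟨Θ (w s), h⟩ := fun s h => dif_pos h
  have hΘ0 : Θ (w 0) = (σ.frame 0).1 := by rw [hw0, h0]
  have hψ0 : ψ 0 = σ := by
    rw [hψ 0 (hΘ0 ▸ (σ.frame 0).2)]
    refine UnitGeodesic.ext_frame 0 ?_
    rw [frame_geodesicOf]
    exact Subtype.ext hΘ0
  have hΘd : HasDerivAt (fun s => Θ (w s)) (fderiv ℝ Θ (γ.frame c).1 x) 0 := by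
    have : HasFDerivAt Θ (fderiv ℝ Θ (γ.frame c).1) (w 0) := by
      rw [hw0]
      exact ((hΘ.contDiffAt (hO.mem_nhds hmem)).differentiableAt (by simp)).hasFDerivAt
    exact this.comp_hasDerivAt 0 hwd
  refine ⟨ψ, ⟨hψ0, ?_⟩, ?_, ?_⟩
  · obtain ⟨ε, hε, hball⟩ := Metric.eventually_nhds_iff.1 hev
    have hsmall : ∀ s ∈ Ioo (-min ε δ) (min ε δ), |s| < ε ∧ s ∈ Ioo (-δ) δ := fun s hs => by
      have := abs_lt.2 hs
      exact ⟨this.trans_le (min_le_left _ _), abs_lt.1 (this.trans_le (min_le_right _ _))⟩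
    have hP : ∀ s ∈ Ioo (-min ε δ) (min ε δ), _ := fun s hs =>
      hball (y := s) (by rw [Real.dist_eq, sub_zero]; exact (hsmall s hs).1)
    refine ⟨min ε δ, lt_min hε hδ, ?_⟩
    have hΘw : ContDiffOn ℝ ∞ (fun q : ℝ × ℝ => Θ (w q.2))
        (univ ×ˢ Ioo (-min ε δ) (min ε δ)) :=
      (hΘ.comp (hw.mono fun s hs => (hsmall s hs).2) fun s hs => (hP s hs).1).comp
        contDiff_snd.contDiffOn fun q hq => hq.2
    refine ContDiffOn.congr (((contDiff_cosK κ).comp contDiff_fst).contDiffOn.smul hΘw.fst |>.add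
      (((contDiff_sinK κ).comp contDiff_fst).contDiffOn.smul hΘw.snd)) fun q hq => ?_
    obtain ⟨-, -, h, -⟩ := hP q.2 hq.2
    rw [hψ _ h]
    rfl
  · funext r
    have := velocity_eq (φ := ψ) hΘd (hev.mono fun s hs => ?_) (hT x hx) r
    · rw [zero_add] at this
      rw [this, jacobiMap_apply, ← hJ]
      simp only [ContinuousLinearMap.coe_coe, htrans]
    · obtain ⟨-, -, h, -⟩ := hs
      rw [hψ s h, frame_geodesicOf]
  · filter_upwards [hev] with s hs
    obtain ⟨-, hU, h, hf⟩ := hs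
    exact ⟨hU, by rw [hf, hψ s h]⟩

theorem isSymplectomorphism_billiardMap (hS : IsSurface κ S) (hν : IsGaussMap κ S ν)
    (hc : IsCompact S) : IsSymplectomorphism (billiardMap hS hν hc) := by
  refine ⟨isSmoothMap_billiardMap hS hν hc, isSmoothMap_billiardMap_symm hS hν hc, ?_⟩
  intro γ σ hγ hσ
  obtain ⟨p, hp, -⟩ := (cls_mem_table hS hν hc).1 hγ
  have hBγ : ((γ.reflect (hν.subset hp.mem)).reverse).cls = σ.cls := by
    rw [← hσ, UnitGeodesic.cls_reverse, ← reflectMap_cls hν hp]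
    rfl
  -- the frame of `σ` at `0` comes from the frame of `γ` at `-b`
  obtain ⟨b, hb⟩ := (cls_eq_iff_frame 0).1 hBγ
  obtain ⟨O, P, A, hfam, hev⟩ := exists_lift hS hν hc (z := γ.frame (-b))
    (by rw [cls_geodesicOf_frame]; exact hγ)
  have hPp : P (γ.frame (-b)).1 = p :=
    (hfam.isTangentAt _ hfam.mem).unique hν (hp.frame_change (-b))
  have h0 : (revFrame ∘ reflFrame κ P) (γ.frame (-b)).1 = (σ.frame 0).1 := by
    rw [← hb]
    have := γ.frame_reflect (hν.subset hp.mem) (-b)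
    simp only [UnitGeodesic.frame, Prod.mk.injEq] at this
    simp only [Function.comp_apply, revFrame, reflFrame, hPp]
    simp only [UnitGeodesic.frame,
      UnitGeodesic.reverse_apply, UnitGeodesic.deriv_reverse, this.1, this.2]
  have hT : ∀ x, IsTangentFrame κ (γ.frame (-b)).1 x → IsTangentFrame κ (σ.frame 0).1
      ((fderiv ℝ (revFrame ∘ reflFrame κ P) (γ.frame (-b)).1).toLinearMap x) := fun x hx => by
    rw [← h0]; exact hfam.isTangentFrame hν hx
  refine ⟨jacobiMap γ σ (-b) _ hT, isDifferential_jacobiMap hfam.isOpen hfam.mem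
    (contDiff_revFrame.comp_contDiffOn (contDiffOn_reflFrame hfam.contDiffOn)) h0 ?_ hT ?_,
    omegaK_jacobiMap hT ?_⟩
  · filter_upwards [hev] with y hy hyT
    obtain ⟨h1, h2, h3⟩ := hy.2 hyT
    refine ⟨h1, revFrame_mem h2, ?_⟩
    change (reflectMap κ S ν _).reverse = _
    rw [h3, reverse_cls_geodesicOf]
    rfl
  · intro x
    rw [← h0]; exact hfam.transversal_fderiv hν (γ.frame (-b)).2 x
  · intro x y
    rw [← h0]; exact hfam.frameForm_fderiv hν (γ.frame (-b)).2 x y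

end OuterBilliard

end

theorem mainTheorem2 (κ : ℤˣ) (S : Set OuterBilliard.R4)
    (hS : OuterBilliard.IsSurface κ S) (hcompact : IsCompact S) (hconn : IsConnected S)
    (hconvex : OuterBilliard.IsQuadraticallyConvex κ S) :
    (κ = -1 → OuterBilliard.reversedTable κ S = OuterBilliard.table κ S) ∧
    ∃ B : OuterBilliard.table κ S ≃ OuterBilliard.reversedTable κ S,
      (∀ (ℓ : OuterBilliard.table κ S) (ℓ' : OuterBilliard.OrientedGeodesic κ),
        OuterBilliard.IsOuterBilliardImage S (ℓ : OuterBilliard.OrientedGeodesic κ) ℓ' ↔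
          ℓ' = (B ℓ : OuterBilliard.OrientedGeodesic κ)) ∧
      OuterBilliard.IsSymplectomorphism B := by
  obtain ⟨ν, hν⟩ := OuterBilliard.exists_gaussMap hS hconn hconvex
  refine ⟨?_, OuterBilliard.billiardMap hS hν hcompact, fun ℓ ℓ' => ?_,
    OuterBilliard.isSymplectomorphism_billiardMap hS hν hcompact⟩
  · rintro rfl
    exact OuterBilliard.reversedTable_eq_table S
  · exact OuterBilliard.isOuterBilliardImage_iff hS hν hcompact ℓ.2 ℓ'
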